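/- **Setting.** Let $\Gamma$ be a finite connected graph with oriented edges, and let $f\colon\Gamma\to\Gamma$ be a homotopy equivalence that maps vertices to vertices and edges across edge-paths and fixes a vertex $*$. Let $H\subset\Gamma$ be a subgraph with $f(H)\subseteq H$. Put $\mathbb F=\pi_1(\Gamma,*)$, let $\Phi_f\in\mathrm{Aut}(\mathbb F)$ be induced by $f$, and let $G_\phi=\mathbb F\rtimes\langle t\rangle$ with $t^{-1}xt=\Phi_f(x)$ for $x\in\mathbb F$. Let $\widetilde\Gamma$ be the universal cover, $\widetilde H$ the preimage of $H$, and $\tilde f$ the lift of $f$ fixing a given lift of $*$. Let $C_1(\widetilde\Gamma,\widetilde H;\mathbb Q)$ be the space of finitely supported rational $1$-chains that vanish on the edges of $\widetilde H$, with its $L^2$-inner product and norm, let $\pi_H^\perp$ be the projection of $C_1(\widetilde\Gamma;\mathbb Q)$ onto it, and let $A_{f,H}=\pi_H^\perp\circ\tilde f_*$ on $C_1(\widetilde\Gamma,\widetilde H;\mathbb Q)$. **Nielsen $1$-chains.** Let $\rho=\pi_H^\perp([u,v])$, where $u\ne v$ are vertices of $\widetilde\Gamma$ fixed by $\tilde f$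 and $[u,v]$ is the $1$-chain with boundary $v-u$. It is a *Nielsen $1$-chain* if one of the following holds. (Non-geometric) There is an edge $e\notin\widetilde H$ with $\rho_e=\pm1$ and $\rho_{ge}=0$ for all $1\neq g\in\mathbb F$. (Geometric) For $g_1\ne g_2$ in $\mathbb F$ the set $\mathrm{supp}(g_1\rho)\cap\mathrm{supp}(g_2\rho)$ is empty or a single edge; for each edge $e\notin\widetilde H$ there is exactly one pair $\{g_1,g_2\}$ of distinct elements for which this set is $\{e\}$; and there are non-commuting $g_1,g_2\in\mathbb F$ such that $\mathrm{supp}(\rho)$ meets both $\mathrm{supp}(g_1\rho)$ and $\mathrm{supp}(g_2\rho)$. **Chain flare condition.** There are $\mathbb Q[\mathbb F]$-submodules $V_{\rm h},V_{\rm qf}$ of $C_1(\widetilde\Gamma,\widetilde H;\mathbb Q)$ such that (1) $V_{\rm h}+V_{\rm qf}=C_1(\widetilde\Gamma,\widetilde H;\mathbb Q)$; (2) there are $\lambda>1$ and $0<\theta<1$ with $\lambda\|A_{f,H}x\|\le\max\{\|A_{f,H}^2x\|,\|x\|\}$ for all $x\in N_\theta(V_{\rm h})^\infty$, where $N_\theta(V)=\{x'\mid\langle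 x,x'\rangle>\theta\|x\|\|x'\|\text{ for some }x\in V\}$ and $N^\infty=\bigcup_{k\in\mathbb Z}A_{f,H}^k(N)$ (preimages for $k<0$); (3) if $V_{\rm qf}\ne0$, then $V_{\rm qf}$ is generated as a $\mathbb Q[\mathbb F]$-module by a Nielsen $1$-chain. **Operators.** Choose a lift to $\widetilde\Gamma$ of each of the $n_H$ edges of $\Gamma$ outside $H$. This identifies $C_1(\widetilde\Gamma,\widetilde H;\mathbb Q)$ with $\mathbb Q[\mathbb F]^{n_H}\subset L^2(\mathbb F)^{n_H}\subset L^2(G_\phi)^{n_H}$. Let $J$ be the matrix over $\mathbb Z[\mathbb F]$ whose $i$-th row lists the coordinates of $A_{f,H}$ of the $i$-th basis element, and let $L_{f,H}$ be the operator on $L^2(G_\phi)^{n_H}$ given by right multiplication by $tJ$. Let $V^{(2)}_{\rm qf}$ be the closure of the complex span of $V_{\rm qf}$ in $L^2(\mathbb F)^{n_H}$, and let $W^{(2)}_{\rm qf}$ be the closure of $\sum_{\ell\in\mathbb Z}t^\ell V^{(2)}_{\rm qf}$ in $L^2(G_\phi)^{n_H}$. The Fuglede–Kadison determinant of a morphism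 $A$ of Hilbert $G$-modules is $\det_G(A)=\exp\int_{0^+}^\infty\log r\,dF_A(r)$ if the integral exists and $0$ otherwise, where $F_A(r)$ is the von Neumann trace of the spectral projection of $A^*A$ for $[0,r^2]$. **Theorem.** Suppose that $f$ satisfies the chain flare condition relative to $H$, with submodules $V_{\rm h}$ and $V_{\rm qf}$. Then $W^{(2)}_{\rm qf}$ is invariant under $I-L_{f,H}^k$ for every integer $k\ge0$, and $$\log{\det}_{G_\phi}\bigl(I-L_{f,H}^k\bigr)\big|_{W^{(2)}_{\rm qf}}=0$$ (in particular, this determinant is positive). Moreover, let $P_k$ be right multiplication by $1-t^k$ on $L^2(\langle t\rangle)$. If $W^{(2)}_{\rm qf}\neq0$, there is a $G_\phi$-equivariant bounded isomorphism $O\colon L^2(G_\phi)\to W^{(2)}_{\rm qf}$ such that, for every $k\ge0$, $(I-L_{f,H}^k)|_{W^{(2)}_{\rm qf}}=O\,(\iota'_*P_k)\,O^{-1}$, where $\iota'_*P_k$ is the operator on $L^2(G_\phi)$ induced from $P_k$ along the inclusion $\iota'\colon\langle t\rangle\to G_\phi$; and ${\det}_{\langle t\rangle}(P_k)=1$ for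 every $k\ge0$. -/

import Mathlib

open CategoryTheory MeasureTheory

noncomputable section

namespace FreeByCyclic

/-! ## Graphs, edge-paths, morphisms and homotopy equivalences

A graph (a 1-dimensional CW-complex) is given by its set of vertices `V` and its oriented edges,
that is, by a quiver structure on `V`; `Quiver.Total V` is the set of all edges. -/

section Graphs

variable {V : Type*} [Quiver V]

/-- Edge-paths that start at `a`: each step runs along an edge in the positive or in the negative
direction. -/
inductive EdgePath (a : V) : V → Type _
  | nil : EdgePath a a
  | pos {b c : V} (p : EdgePath a b) (e : b ⟶ c) : EdgePath a c
  | neg {b c : V} (p : EdgePath a b) (e : c ⟶ b) : EdgePath a c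

/-- A vertex, as an object of the fundamental groupoid of the graph, which is the free groupoid on
the quiver. -/
abbrev vtx (a : V) : Quiver.FreeGroupoid V := (Quiver.FreeGroupoid.of V).obj a

/-- Homotopy classes rel endpoints of edge-paths from `a` to `b`: the morphisms of the
fundamental groupoid (edge-paths modulo insertion and deletion of backtracks). -/
abbrev PathClass (a b : V) := vtx a ⟶ vtx b

/-- The class of the edge-path that consists of the single edge `e`. -/
abbrev edgeClass {a b : V} (e : a ⟶ b) : PathClass a b := (Quiver.FreeGroupoid.of V).map e

/-- The homotopy class rel endpoints of an edge-path. -/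
def EdgePath.cls {a : V} : {b : V} → EdgePath a b → PathClass a b
  | _, .nil => 𝟙 (vtx a)
  | _, .pos p e => p.cls ≫ edgeClass e
  | _, .neg p e => p.cls ≫ inv (edgeClass e)

/-- The set of (unoriented) edges crossed by an edge-path. -/
def EdgePath.edges {a : V} : {b : V} → EdgePath a b → Set (Quiver.Total V)
  | _, .nil => ∅
  | _, .pos p e => insert ⟨_, _, e⟩ p.edges
  | _, .neg p e => insert ⟨_, _, e⟩ p.edges

/-- The fundamental group of the graph at a vertex; the product is concatenation. -/
abbrev PiOne (v : V) := PathClass v v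

/-- A graph is connected if any two vertices are joined by an edge-path. -/
def IsConnectedGraph (V : Type*) [Quiver V] : Prop :=
  ∀ a b : V, Nonempty (EdgePath a b)

/-- A morphism of a graph to itself: vertices go to vertices and each edge is mapped across an
edge-path (possibly with backtracking, possibly trivial). -/
structure GraphMorphism (V : Type*) [Quiver V] where
  onV : V → V
  onE : ∀ {a b : V}, (a ⟶ b) → EdgePath (onV a) (onV b)

/-- The functor induced by a morphism on the fundamental groupoid. -/
def GraphMorphism.functor (f : GraphMorphism V) :
    Quiver.FreeGroupoid V ⥤ Quiver.FreeGroupoid V :=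
  Quiver.FreeGroupoid.lift
    { obj := fun a => vtx (f.onV a)
      map := fun e => (f.onE e).cls }

/-- A homotopy between morphisms of graphs is the choice, for every vertex `v`, of a homotopy class
`h v` of paths from `f v` to `g v` such that `f e · h (t e) = h (o e) · g e` up to homotopy rel
endpoints for all edges `e`: a natural isomorphism between the induced functors. This definition
says that `f` has a homotopy inverse. -/
def GraphMorphism.IsHomotopyEquiv (f : GraphMorphism V) : Prop :=
  ∃ g : GraphMorphism V,
    Nonempty (f.functor ⋙ g.functor ≅ 𝟭 (Quiver.FreeGroupoid V)) ∧
      Nonempty (g.functor ⋙ f.functor ≅ 𝟭 (Quiver.FreeGroupoid V))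

/-- A morphism that is a homotopy equivalence and fixes the vertex `base`. -/
structure BasedHomotopyEquiv (V : Type*) [Quiver V] extends GraphMorphism V where
  base : V
  base_fixed : onV base = base
  isHomotopyEquiv : toGraphMorphism.IsHomotopyEquiv

/-- A subgraph: a set of vertices and a set of edges with endpoints among these vertices. -/
structure Subgraph (V : Type*) [Quiver V] where
  verts : Set V
  edges : Set (Quiver.Total V)
  left_mem : ∀ e ∈ edges, e.left ∈ verts
  right_mem : ∀ e ∈ edges, e.right ∈ verts

/-- `f(H) ⊆ H`. -/
def Subgraph.IsInvariant (H : Subgraph V) (f : GraphMorphism V) : Prop :=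
  (∀ v ∈ H.verts, f.onV v ∈ H.verts) ∧ ∀ e ∈ H.edges, (f.onE e.hom).edges ⊆ H.edges

namespace BasedHomotopyEquiv

variable (f : BasedHomotopyEquiv V)

/-- The free group `𝔽 = π₁(Γ, ∗)`. -/
abbrev F := PiOne f.base

lemma functor_obj_base : f.functor.obj (vtx f.base) = vtx f.base :=
  congrArg vtx f.base_fixed

/-- The effect of `f` on classes of paths that start at the fixed vertex `∗`. -/
def mapFromBase {v : V} (p : PathClass f.base v) : PathClass f.base (f.onV v) :=
  eqToHom f.functor_obj_base.symm ≫ f.functor.map p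

/-- The endomorphism of `𝔽` induced by `f` and the trivial path at `∗`. -/
def phiHom : f.F →* f.F where
  toFun g := eqToHom f.functor_obj_base.symm ≫ f.functor.map g ≫ eqToHom f.functor_obj_base
  map_one' := by
    simp [Groupoid.vertexGroup_one]
  map_mul' g h := by
    simp [Groupoid.vertexGroup_mul]

lemma phiHom_bijective : Function.Bijective f.phiHom := by
  obtain ⟨g, ⟨α⟩, ⟨β⟩⟩ := f.isHomotopyEquiv
  have hf : f.functor.IsEquivalence :=
    (CategoryTheory.Equivalence.mk f.functor g.functor α.symm β).isEquivalence_functor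
  constructor
  · intro a b hab
    apply f.functor.map_injective
    simp only [phiHom, MonoidHom.coe_mk, OneHom.coe_mk] at hab
    exact (cancel_mono _).1 ((cancel_epi _).1 hab)
  · intro b
    obtain ⟨a, ha⟩ := f.functor.map_surjective
      (eqToHom f.functor_obj_base ≫ b ≫ eqToHom f.functor_obj_base.symm)
    refine ⟨a, ?_⟩
    simp [phiHom, ha]

/-- The automorphism `Φ_f` of `𝔽` induced by `f` and the trivial path at `∗`. -/
def Phi : MulAut f.F := MulEquiv.ofBijective f.phiHom f.phiHom_bijective

/-- The free-by-cyclic group `G_φ = 𝔽 ⋊ ⟨t⟩`, with `t⁻¹ x t = Φ_f x` for `x ∈ 𝔽`. -/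
abbrev G := f.F ⋊[zpowersHom (MulAut f.F) f.Phi⁻¹] Multiplicative ℤ

/-- The stable letter `t` of `G_φ`. -/
def t : f.G := SemidirectProduct.inr (Multiplicative.ofAdd 1)

lemma t_inv_mul_mul_t (x : f.F) :
    f.t⁻¹ * SemidirectProduct.inl x * f.t = SemidirectProduct.inl (f.Phi x) := by
  have h := SemidirectProduct.inl_aut_inv (φ := zpowersHom (MulAut f.F) f.Phi⁻¹)
    (Multiplicative.ofAdd (1 : ℤ)) x
  simp at h
  rw [t, h]

/-! ## The universal cover and its chains -/

/-- Vertices of the universal cover: homotopy classes of edge-paths that start at `∗`. -/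
abbrev CoverVertex := Σ v : V, PathClass f.base v

/-- Edges of the universal cover: an edge `e` of the graph together with a lift of its initial
vertex. -/
abbrev CoverEdge := Σ e : Quiver.Total V, PathClass f.base e.left

/-- The initial vertex of an edge of the universal cover. -/
def origin (e : f.CoverEdge) : f.CoverVertex := ⟨e.1.left, e.2⟩

/-- The terminal vertex of an edge of the universal cover. -/
def terminus (e : f.CoverEdge) : f.CoverVertex :=
  ⟨e.1.right, e.2 ≫ edgeClass e.1.hom⟩

/-- The action of `𝔽` on the edges of the universal cover by deck transformations. -/
def edgeAct (g : f.F) (e : f.CoverEdge) : f.CoverEdge := ⟨e.1, g ≫ e.2⟩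

/-- The lift of `f` to the universal cover that fixes the lift of `∗`, on vertices. -/
def fTilde (v : f.CoverVertex) : f.CoverVertex := ⟨f.onV v.1, f.mapFromBase v.2⟩

/-- Rational cellular 0-chains of the universal cover. -/
abbrev C0 := f.CoverVertex →₀ ℚ

/-- Rational cellular 1-chains of the universal cover. -/
abbrev C1 := f.CoverEdge →₀ ℚ

/-- The boundary map, `∂ e = t(e) - o(e)`. -/
def boundary : f.C1 →ₗ[ℚ] f.C0 :=
  Finsupp.linearCombination ℚ fun e =>
    Finsupp.single (f.terminus e) (1 : ℚ) - Finsupp.single (f.origin e) (1 : ℚ)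

/-- The action of `g ∈ 𝔽` on 1-chains. -/
def chainAct (g : f.F) : f.C1 →ₗ[ℚ] f.C1 := Finsupp.lmapDomain ℚ ℚ (f.edgeAct g)

/-- The 1-chain of the lift to the universal cover of an edge-path, starting at the vertex given
by `p`: each edge of the lifted path contributes `1` or `-1` according to its direction. -/
def pathChain {a : V} (p : PathClass f.base a) : {b : V} → EdgePath a b → f.C1
  | _, .nil => 0
  | _, .pos q e => pathChain p q + Finsupp.single ⟨⟨_, _, e⟩, p ≫ q.cls⟩ 1
  | _, .neg q e => pathChain p q - Finsupp.single ⟨⟨_, _, e⟩, p ≫ q.cls ≫ inv (edgeClass e)⟩ 1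

/-- The map `A_f` induced by the lift of `f` on 1-chains. -/
def chainMap : f.C1 →ₗ[ℚ] f.C1 :=
  Finsupp.linearCombination ℚ fun e => f.pathChain (f.mapFromBase e.2) (f.onE e.1.hom)

/-! ## Relative chains -/

variable (H : Subgraph V)

/-- The edges of the universal cover that are not lifts of edges of `H`. -/
def relCoverEdges : Set f.CoverEdge := {e | e.1 ∉ H.edges}

/-- The relative 1-chains: those that vanish on all lifts of edges of `H`. -/
abbrev RelC1 : Submodule ℚ f.C1 := Finsupp.supported ℚ ℚ (f.relCoverEdges H)

/-- The projection of 1-chains to relative 1-chains that forgets the lifts of edges of `H`. -/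
def relProj : f.C1 →ₗ[ℚ] f.RelC1 H :=
  letI := Classical.decPred (· ∈ f.relCoverEdges H)
  Finsupp.restrictDom ℚ ℚ (f.relCoverEdges H)

/-- The map `A_{f,H}` on relative 1-chains. -/
def relChainMap : f.RelC1 H →ₗ[ℚ] f.RelC1 H :=
  f.relProj H ∘ₗ f.chainMap ∘ₗ (f.RelC1 H).subtype

/-- The action of `g ∈ 𝔽` on relative 1-chains. -/
def relAct (g : f.F) : f.RelC1 H →ₗ[ℚ] f.RelC1 H :=
  (f.chainAct g).restrict (fun x hx => by
    classical
    rw [Finsupp.mem_supported] at hx ⊢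
    intro e he
    obtain ⟨e', he', rfl⟩ := Finset.mem_image.1 (Finsupp.mapDomain_support he)
    exact (show e' ∈ f.relCoverEdges H from hx he'))

variable {f H}

/-- The set of edges on which a relative 1-chain is non-zero. -/
def supp (x : f.RelC1 H) : Set f.CoverEdge := ↑(x : f.C1).support

/-- The inner product of relative 1-chains. -/
def chainInner (x y : f.RelC1 H) : ℝ :=
  ∑ e ∈ (x : f.C1).support, ((x : f.C1) e : ℝ) * ((y : f.C1) e : ℝ)

/-- The `L²`-norm of relative 1-chains. -/
def chainNorm (x : f.RelC1 H) : ℝ := √(chainInner x x)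

variable (f H)

/-! ## Nielsen 1-chains and the chain flare condition -/

/-- `ρ` is the image of the chain `[u, v]` for two vertices `u, v` of the universal cover that are
fixed by the lift of `f`; here `[u, v]` is the 1-chain with boundary `v - u`. -/
def IsFixedSegment (ρ : f.RelC1 H) : Prop :=
  ∃ u v : f.CoverVertex, u ≠ v ∧ f.fTilde u = u ∧ f.fTilde v = v ∧
    ∃ c : f.C1, f.boundary c = Finsupp.single v 1 - Finsupp.single u 1 ∧ ρ = f.relProj H c

/-- Non-geometric Nielsen 1-chains. -/
def IsNonGeometricNielsen (ρ : f.RelC1 H) : Prop :=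
  f.IsFixedSegment H ρ ∧
    ∃ e ∈ f.relCoverEdges H, ((ρ : f.C1) e = 1 ∨ (ρ : f.C1) e = -1) ∧
      ∀ g : f.F, g ≠ 1 → (ρ : f.C1) (f.edgeAct g e) = 0

/-- Geometric Nielsen 1-chains. -/
structure IsGeometricNielsen (ρ : f.RelC1 H) : Prop where
  fixedSegment : f.IsFixedSegment H ρ
  single : ∀ g₁ g₂ : f.F, g₁ ≠ g₂ →
    supp (f.relAct H g₁ ρ) ∩ supp (f.relAct H g₂ ρ) = ∅ ∨
      ∃ e, supp (f.relAct H g₁ ρ) ∩ supp (f.relAct H g₂ ρ) = {e}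
  pair : ∀ e ∈ f.relCoverEdges H, ∃ g₁ g₂ : f.F, g₁ ≠ g₂ ∧
    supp (f.relAct H g₁ ρ) ∩ supp (f.relAct H g₂ ρ) = {e} ∧
      ∀ h₁ h₂ : f.F, h₁ ≠ h₂ → supp (f.relAct H h₁ ρ) ∩ supp (f.relAct H h₂ ρ) = {e} →
        ({h₁, h₂} : Set f.F) = {g₁, g₂}
  noncommuting : ∃ g₁ g₂ : f.F, g₁ * g₂ ≠ g₂ * g₁ ∧
    (supp ρ ∩ supp (f.relAct H g₁ ρ)).Nonempty ∧ (supp ρ ∩ supp (f.relAct H g₂ ρ)).Nonempty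

/-- Nielsen 1-chains. -/
def IsNielsen (ρ : f.RelC1 H) : Prop := f.IsNonGeometricNielsen H ρ ∨ f.IsGeometricNielsen H ρ

/-- The relative 1-chains that make a small angle with an element of `S`. -/
def angleNhd (θ : ℝ) (S : Set (f.RelC1 H)) : Set (f.RelC1 H) :=
  {x' | ∃ x ∈ S, θ * chainNorm x * chainNorm x' < chainInner x x'}

/-- `N^∞`, the union of the sets `A_{f,H}^k(N)` over all integers `k`; for negative `k` these are
preimages. -/
def saturate (N : Set (f.RelC1 H)) : Set (f.RelC1 H) :=
  {x' | ∃ k : ℕ, (∃ x ∈ N, x' = (f.relChainMap H ^ k) x) ∨ (f.relChainMap H ^ k) x' ∈ N}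

/-- The chain flare condition of `f` relative to `H`, for a given hyperbolic submodule `Vh` and a
given quasi-fixed submodule `Vqf`. A `ℚ[𝔽]`-submodule is an `𝔽`-invariant `ℚ`-subspace. -/
structure ChainFlare (Vh Vqf : Submodule ℚ (f.RelC1 H)) : Prop where
  hyperbolic_invariant : ∀ (g : f.F), ∀ x ∈ Vh, f.relAct H g x ∈ Vh
  quasiFixed_invariant : ∀ (g : f.F), ∀ x ∈ Vqf, f.relAct H g x ∈ Vqf
  sum_eq_top : Vh ⊔ Vqf = ⊤
  flare : ∃ lam θ : ℝ, 1 < lam ∧ 0 < θ ∧ θ < 1 ∧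
    ∀ x ∈ f.saturate H (f.angleNhd H θ Vh),
      lam * chainNorm (f.relChainMap H x) ≤
        max (chainNorm (f.relChainMap H (f.relChainMap H x))) (chainNorm x)
  generated : Vqf ≠ ⊥ → ∃ ρ : f.RelC1 H, f.IsNielsen H ρ ∧
    Vqf = Submodule.span ℚ (Set.range fun g : f.F => f.relAct H g ρ)

end BasedHomotopyEquiv

end Graphs

/-! ## Square summable functions and Hilbert modules -/

section L2

/-- The Hilbert space of square summable complex functions on `X`. -/
abbrev L2 (X : Type*) := lp (fun _ : X => ℂ) 2

/-- The basis vector at `x`. -/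
def delta {X : Type*} (x : X) : L2 X :=
  letI := Classical.decEq X
  lp.single 2 x (1 : ℂ)

lemma orthonormal_delta (X : Type*) : Orthonormal ℂ (delta : X → L2 X) := by
  classical
  rw [orthonormal_iff_ite]
  intro i j
  have : delta i = lp.single (E := fun _ : X => ℂ) 2 i (1 : ℂ) := by
    unfold delta; congr
  rw [this, lp.inner_single_left]
  have : delta j = lp.single (E := fun _ : X => ℂ) 2 j (1 : ℂ) := by
    unfold delta; congr
  rw [this, lp.single_apply]
  by_cases h : i = j
  · subst h; simp
  · simp [h]

/-- The isometry of `L²`-spaces that sends the basis vector at `x` to the one at `σ x`. -/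
def pushforward {X Y : Type*} (σ : X → Y) (hσ : Function.Injective σ) : L2 X →ₗᵢ[ℂ] L2 Y :=
  (((orthonormal_delta Y).comp σ hσ).orthogonalFamily).linearIsometry

lemma pushforward_delta {X Y : Type*} (σ : X → Y) (hσ : Function.Injective σ) (x : X) :
    pushforward σ hσ (delta x) = delta (σ x) := by
  classical
  have : delta x = lp.single (E := fun _ : X => ℂ) 2 x (1 : ℂ) := by
    unfold delta; congr
  rw [this, pushforward, OrthogonalFamily.linearIsometry_apply_single]
  simp

variable {G : Type*} [Group G] {ι : Type*} [Fintype ι]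

/-- The Hilbert space `L²(G)^n`, with `n` the number of elements of `ι`. -/
abbrev L2pow (G : Type*) (ι : Type*) [Fintype ι] := PiLp 2 (fun _ : ι => L2 G)

/-- The vector of `L²(G)^n` with entry the basis vector at the identity in place `i`. -/
def unitVec (G : Type*) [Group G] {ι : Type*} [Fintype ι] (i : ι) : L2pow G ι :=
  letI := Classical.decEq ι
  PiLp.single 2 i (delta (1 : G))

/-- The left action of `g` on `L²(G)`. -/
def leftMul (g : G) : L2 G →L[ℂ] L2 G :=
  (pushforward (g * ·) (mul_right_injective g)).toContinuousLinearMap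

/-- Right multiplication by `a ∈ ℂ[G]` on `L²(G)`. -/
def rightMul (a : MonoidAlgebra ℂ G) : L2 G →L[ℂ] L2 G :=
  a.coeff.sum fun g c =>
    c • (pushforward (· * g) (mul_left_injective g)).toContinuousLinearMap

/-- The operator `(ξ_i)_i ↦ (∑ i, T i j (ξ_i))_j`. -/
def matrixOp {X Y κ : Type*} [Fintype κ] (T : ι → κ → L2 X →L[ℂ] L2 Y) :
    L2pow X ι →L[ℂ] L2pow Y κ :=
  ((PiLp.continuousLinearEquiv 2 ℂ (fun _ : κ => L2 Y)).symm :
      (κ → L2 Y) →L[ℂ] L2pow Y κ) ∘L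
    ContinuousLinearMap.pi
      (fun j => ∑ i, T i j ∘L ContinuousLinearMap.proj (R := ℂ) (φ := fun _ : ι => L2 X) i) ∘L
    ((PiLp.continuousLinearEquiv 2 ℂ (fun _ : ι => L2 X)) : L2pow X ι →L[ℂ] (ι → L2 X))

/-- Right multiplication by a matrix over `ℂ[G]` on (row vectors in) `L²(G)^n`. -/
def rightMulMatrix (M : Matrix ι ι (MonoidAlgebra ℂ G)) : L2pow G ι →L[ℂ] L2pow G ι :=
  matrixOp fun i j => rightMul (M i j)

/-- The restriction of an operator to an invariant subspace. -/
def restrictOp {E : Type*} [NormedAddCommGroup E] [NormedSpace ℂ E] (T : E →L[ℂ] E)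
    (W : Submodule ℂ E) (h : ∀ w ∈ W, T w ∈ W) : W →L[ℂ] W :=
  (T ∘L W.subtypeL).codRestrict W fun w => h w w.2

/-- An operator applied in each coordinate. -/
def diagOp {X Y : Type*} (T : L2 X →L[ℂ] L2 Y) : L2pow X ι →L[ℂ] L2pow Y ι :=
  letI := Classical.decEq ι
  matrixOp fun i j => if i = j then T else 0

end L2

/-! ## The Fuglede–Kadison determinant

A Hilbert `G`-module is given by a Hilbert space `U` with an isometric embedding `j` onto a
`G`-invariant subspace of some `L²(G)^n`. -/

section Determinant

variable {G : Type*} [Group G] {ι : Type*} [Fintype ι]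
variable {U : Type*} [NormedAddCommGroup U] [InnerProductSpace ℂ U] [CompleteSpace U]
variable {U' : Type*} [NormedAddCommGroup U'] [InnerProductSpace ℂ U'] [CompleteSpace U']

/-- The von Neumann trace of an operator `T` on `U`: the sum of the diagonal entries
`⟨T' 1_i, 1_i⟩`, for `T'` the operator on `L²(G)^n` that is `T` on the image of `U` and `0` on its
orthogonal complement. -/
def vnTrace (j : U →ₗᵢ[ℂ] L2pow G ι) (T : U →L[ℂ] U) : ℂ :=
  ∑ i : ι, inner ℂ (unitVec G i)
    (j (T (ContinuousLinearMap.adjoint j.toContinuousLinearMap (unitVec G i))))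

/-- The spectral family of a self-adjoint operator: the orthogonal projection onto the kernel of the
positive part of `T - c`, which is the spectral projection of `T` for `(-∞, c]`. -/
def spectralProj (T : U →L[ℂ] U) (c : ℝ) : U →L[ℂ] U :=
  (LinearMap.ker (cfc (fun s : ℝ => max (s - c) 0) T : U →L[ℂ] U).toLinearMap).starProjection

/-- The spectral density function `F_A(r) = Tr_G(E^{A* A}_{r²})` of an operator, extended by `0` to
negative `r`. -/
def spectralDensity (j : U →ₗᵢ[ℂ] L2pow G ι) (A : U →L[ℂ] U') (r : ℝ) : ℝ :=
  if r < 0 then 0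
  else (vnTrace j (spectralProj (ContinuousLinearMap.adjoint A ∘L A) (r ^ 2))).re

lemma vnTrace_starProjection (j : U →ₗᵢ[ℂ] L2pow G ι) (K : Submodule ℂ U)
    [K.HasOrthogonalProjection] :
    (vnTrace j K.starProjection).re = ∑ i : ι, ‖K.starProjection
      (ContinuousLinearMap.adjoint j.toContinuousLinearMap (unitVec G i))‖ ^ 2 := by
  rw [vnTrace, Complex.re_sum]
  refine Finset.sum_congr rfl fun i _ => ?_
  have h := ContinuousLinearMap.adjoint_inner_left j.toContinuousLinearMap
    (K.starProjection (ContinuousLinearMap.adjoint j.toContinuousLinearMap (unitVec G i)))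
    (unitVec G i)
  rw [LinearIsometry.coe_toContinuousLinearMap] at h
  rw [← h]
  generalize ContinuousLinearMap.adjoint j.toContinuousLinearMap (unitVec G i) = x
  have h2 : inner ℂ x (K.starProjection x) =
      inner ℂ (K.starProjection x) (K.starProjection x) := by
    rw [K.inner_starProjection_left_eq_right,
      Submodule.starProjection_eq_self_iff.2 (K.starProjection_apply_mem x)]
  rw [h2, inner_self_eq_norm_sq_to_K]
  norm_cast

lemma spectralKer_mono (T : U →L[ℂ] U) {c d : ℝ} (h : c ≤ d) :
    LinearMap.ker (cfc (fun s : ℝ => max (s - c) 0) T : U →L[ℂ] U).toLinearMap ≤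
      LinearMap.ker (cfc (fun s : ℝ => max (s - d) 0) T : U →L[ℂ] U).toLinearMap := by
  rcases h.eq_or_lt with rfl | h
  · exact le_rfl
  intro x hx
  have hpos : ∀ s : ℝ, max (s - c) (d - c) ≠ 0 := fun s =>
    (lt_of_lt_of_le (sub_pos.2 h) (le_max_right _ _)).ne'
  have hg : Continuous fun s : ℝ => max (s - d) 0 / max (s - c) (d - c) :=
    Continuous.div (by fun_prop) (by fun_prop) hpos
  have key : (fun s : ℝ => max (s - d) 0) =
      fun s => (max (s - d) 0 / max (s - c) (d - c)) * max (s - c) 0 := by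
    funext s
    rcases le_total s d with hs | hs
    · simp [max_eq_right (sub_nonpos.2 hs)]
    · have hc : (0 : ℝ) < s - c := by linarith
      rw [max_eq_left (sub_nonneg.2 hs), max_eq_left (by linarith : d - c ≤ s - c),
        max_eq_left hc.le]
      field_simp
  have hx' : (cfc (fun s : ℝ => max (s - c) 0) T : U →L[ℂ] U) x = 0 := hx
  change (cfc (fun s : ℝ => max (s - d) 0) T : U →L[ℂ] U) x = 0
  rw [key, cfc_mul _ _ T hg.continuousOn (by fun_prop), mul_apply_eq_comp, hx',
    map_zero]

lemma spectralDensity_mono (j : U →ₗᵢ[ℂ] L2pow G ι) (A : U →L[ℂ] U') :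
    Monotone (spectralDensity j A) := by
  intro r s hrs
  unfold spectralDensity
  split_ifs with h1 h2
  · exact le_rfl
  · rw [spectralProj, vnTrace_starProjection]
    positivity
  · exact absurd (hrs.trans_lt ‹s < 0›) h1
  · rw [spectralProj, spectralProj, vnTrace_starProjection, vnTrace_starProjection]
    refine Finset.sum_le_sum fun i _ => ?_
    have hle := spectralKer_mono (ContinuousLinearMap.adjoint A ∘L A)
      (pow_le_pow_left₀ (not_lt.1 h1) hrs 2)
    rw [← Submodule.starProjection_comp_starProjection_of_le hle]
    gcongr
    exact Submodule.norm_starProjection_apply_le _ _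

/-- The measure `dF_A`. (`F_A` is right-continuous.) -/
def spectralDensityMeasure (j : U →ₗᵢ[ℂ] L2pow G ι) (A : U →L[ℂ] U') : Measure ℝ :=
  (spectralDensity_mono j A).stieltjesFunction.measure

open Classical in
/-- The Fuglede–Kadison determinant `exp ∫_{0+}^∞ log r dF_A(r)` if the integral exists, and `0`
otherwise. -/
def fkDet (j : U →ₗᵢ[ℂ] L2pow G ι) (A : U →L[ℂ] U') : ℝ :=
  if IntegrableOn Real.log (Set.Ioi 0) (spectralDensityMeasure j A) then
    Real.exp (∫ r in Set.Ioi 0, Real.log r ∂(spectralDensityMeasure j A))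
  else 0

/-- The embedding of `L²(G)` in `L²(G)^1`. -/
def regularEmbedding (G : Type*) : L2 G →ₗᵢ[ℂ] L2pow G Unit where
  toFun ξ := WithLp.toLp 2 fun _ => ξ
  map_add' _ _ := rfl
  map_smul' _ _ := rfl
  norm_map' ξ := by
    rw [PiLp.norm_eq_of_L2]
    simp only [Finset.univ_unique, Finset.sum_singleton]
    exact Real.sqrt_sq (norm_nonneg ξ)

end Determinant

/-! ## Induction from a subgroup -/

/-- Right multiplication by `1 - t^k` on `L²(⟨t⟩)`, for the cyclic subgroup `⟨t⟩` of `G`. -/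
def cyclicOp {G : Type*} [Group G] (t : G) (k : ℕ) :
    L2 (Subgroup.zpowers t) →L[ℂ] L2 (Subgroup.zpowers t) :=
  rightMul (1 - MonoidAlgebra.single (⟨t, Subgroup.mem_zpowers t⟩ ^ k : Subgroup.zpowers t) 1)

/-- For a subgroup `K` of `G`, the induced module of `L²(K)` is `L²(G)`, and the induced morphism
of `P` is the unique bounded `G`-equivariant operator that extends `P`. -/
def IsInduced {G : Type*} [Group G] (K : Subgroup G) (P : L2 K →L[ℂ] L2 K) (Q : L2 G →L[ℂ] L2 G) :
    Prop :=
  (∀ (g : G) (ξ : L2 G), Q (leftMul g ξ) = leftMul g (Q ξ)) ∧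
    ∀ ξ : L2 K, Q (pushforward (fun x : K => (x : G)) Subtype.val_injective ξ) =
      pushforward (fun x : K => (x : G)) Subtype.val_injective (P ξ)

/-! ## The operator `L_{f,H}` and the induced quasi-fixed subspace -/

section Operators

variable {V : Type*} [Quiver V] [Finite (Quiver.Total V)]

/-- The edges of the graph outside `H`; there are `n_H` of them. -/
abbrev RelEdge (H : Subgraph V) := {e : Quiver.Total V // e ∉ H.edges}

instance (H : Subgraph V) : Fintype (RelEdge H) := Fintype.ofFinite _

namespace BasedHomotopyEquiv

variable (f : BasedHomotopyEquiv V) (H : Subgraph V)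

/-- A choice of a lift to the universal cover of every edge outside `H`. These lifts form a basis of
the relative 1-chains as a `ℚ[𝔽]`-module. -/
abbrev LiftChoice := ∀ e : RelEdge H, PathClass f.base e.1.left

variable {f H} (lift : f.LiftChoice H)

/-- The chosen lift of an edge, as a relative 1-chain. -/
def basisChain (e : RelEdge H) : f.RelC1 H :=
  ⟨Finsupp.single ⟨e.1, lift e⟩ 1, by
    rw [Finsupp.mem_supported]
    intro e' he'
    have := Finsupp.support_single_subset he'
    simp only [Finset.mem_singleton] at this
    subst this
    exact e.2⟩

/-- The coordinates in `ℂ[𝔽]` of a relative 1-chain with respect to the chosen lifts: the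
coefficient of `g` in coordinate `e` is the coefficient of the chain at the `g`-translate of the
chosen lift of `e`. -/
def coords (x : f.RelC1 H) (e : RelEdge H) : MonoidAlgebra ℂ f.F :=
  .ofCoeff (((x : f.C1).comapDomain (fun g : f.F => f.edgeAct g ⟨e.1, lift e⟩) (by
    intro g _ h _ hgh
    simp only [edgeAct, Sigma.mk.injEq, heq_eq_eq, true_and] at hgh
    exact (cancel_mono _).1 hgh)).mapRange (fun q : ℚ => (q : ℂ)) Rat.cast_zero)

/-- A relative 1-chain as an element of `L²(𝔽)^{n_H}`. -/
def toL2 (x : f.RelC1 H) : L2pow f.F (RelEdge H) :=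
  WithLp.toLp 2 fun e => (coords lift x e).coeff.sum fun g c => c • delta g

/-- The Jacobian: row `i` records the coordinates of `A_{f,H}` of the `i`-th basis element. -/
def jacobian : Matrix (RelEdge H) (RelEdge H) (MonoidAlgebra ℂ f.F) :=
  fun i j => coords lift (f.relChainMap H (basisChain lift i)) j

/-- The operator `L_{f,H}`: right multiplication by `t J` on `L²(G_φ)^{n_H}`. -/
def opL : L2pow f.G (RelEdge H) →L[ℂ] L2pow f.G (RelEdge H) :=
  rightMulMatrix fun i j =>
    MonoidAlgebra.single f.t 1 *
      MonoidAlgebra.mapDomain (SemidirectProduct.inl : f.F →* f.G) (jacobian lift i j)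

/-- `V^{(2)}`: the closure in `L²(𝔽)^{n_H}` of the complex span of a submodule `W` of the relative
1-chains. -/
def completed (W : Submodule ℚ (f.RelC1 H)) : Submodule ℂ (L2pow f.F (RelEdge H)) :=
  (Submodule.span ℂ (toL2 lift '' W)).topologicalClosure

/-- The inclusion of `L²(𝔽)^{n_H}` in `L²(G_φ)^{n_H}`. -/
def inclF : L2pow f.F (RelEdge H) →L[ℂ] L2pow f.G (RelEdge H) :=
  diagOp (pushforward (SemidirectProduct.inl : f.F →* f.G)
    SemidirectProduct.inl_injective).toContinuousLinearMap

/-- `W^{(2)}`: the closure of the sum of the translates `t^ℓ V^{(2)}` in `L²(G_φ)^{n_H}`. -/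
def inducedSpace (W : Submodule ℚ (f.RelC1 H)) : Submodule ℂ (L2pow f.G (RelEdge H)) :=
  (⨆ l : ℤ, (completed lift W).map
    ((diagOp (leftMul (f.t ^ l)) : L2pow f.G (RelEdge H) →L[ℂ] L2pow f.G (RelEdge H)) ∘L
      (inclF : L2pow f.F (RelEdge H) →L[ℂ] L2pow f.G (RelEdge H))).toLinearMap).topologicalClosure

instance (W : Submodule ℚ (f.RelC1 H)) : CompleteSpace (inducedSpace lift W) :=
  inferInstanceAs (CompleteSpace (Submodule.topologicalClosure _))

end BasedHomotopyEquiv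

end Operators

end FreeByCyclic

end

/-!
A Nielsen 1-chain `ρ` is fixed by `A_{f,H}`, so the orbit map `δ_g ↦ g ρ` intertwines right
translation by `t` on `L²(G_φ)` with `L_{f,H}`. The orbit map is bounded below: a non-geometric `ρ`
has a coordinate that is `±` a single group element, and a geometric `ρ` has coordinates with
exactly two terms, so that `‖O ξ‖` dominates `‖|ξ| g - |ξ|‖` for two non-commuting `g ∈ 𝔽`; these
generate a non-abelian free group, whose regular representation has a spectral gap. Hence the orbit
map is an isomorphism onto `W^{(2)}_qf` which conjugates `I - L^k` to right multiplication by
`1 - t^k`.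

For the determinant of the conjugate with `k ≥ 1`, polar decomposition of the isomorphism leaves an
operator `S (1 - u) S⁻¹`, with `S` invertible in the group von Neumann algebra and `u` right
translation by `t^k`. Twice the logarithm of the determinant of `a` is the limit as `δ ↓ 0` of the
traces of `log (a⋆a + δ)`, and up to rescaling `δ` by constants these do not see the conjugation by
`S`. For `δ = (2 sinh y)²` one has `|1 - u|² + δ = e^{2y} |1 - e^{-2y} u|²`, and as the traces of
all powers `uⁿ` and `u⁻ⁿ`, `n ≥ 1`, vanish, the trace of the logarithm is exactly `2y`, which tends
to `0`.
-/

open CategoryTheory MeasureTheory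

noncomputable section

namespace FreeByCyclic

section Paths

variable {V : Type*} [Quiver V]

theorem PathClass.induction {a : V} {P : ∀ b : V, PathClass a b → Prop}
    (hid : P a (𝟙 (vtx a)))
    (hpos : ∀ (b c : V) (p : PathClass a b) (e : b ⟶ c), P b p → P c (p ≫ edgeClass e))
    (hneg : ∀ (b c : V) (p : PathClass a b) (e : c ⟶ b), P b p → P c (p ≫ inv (edgeClass e)))
    {b : V} (p : PathClass a b) : P b p := by
  induction p using Quot.inductionOn with
  | h q =>
    change Quiver.Path (V := Quiver.Symmetrify V) a b at q
    induction q with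
    | nil => exact hid
    | @cons c d q s ih =>
      rcases s with e | e
      · exact hpos c d _ e ih
      · have := hneg c d _ e ih
        rw [← Groupoid.inv_eq_inv] at this
        exact this

lemma lift_map_edgeClass {C : Type*} [Groupoid C] (φ : V ⥤q C) {a b : V} (e : a ⟶ b) :
    (Quiver.FreeGroupoid.lift φ).map (edgeClass e) = φ.map e :=
  Category.id_comp _

/-- The functor that sends a vertex `v` to the product of `A` with the set of lifts of `v` to the
universal cover, and an edge to the path lifting along this edge, which adds to the component in
`A` the value of the cochain `ω` at the lifted edge. -/
def cochainFunctor {A : Type*} [AddGroup A] {a : V}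
    (ω : (Σ e : Quiver.Total V, PathClass a e.left) → A) :
    Quiver.FreeGroupoid V ⥤ Core (Type _) :=
  Quiver.FreeGroupoid.lift
    { obj := fun v => ⟨PathClass a v × A⟩
      map := fun {v w} e => ⟨Equiv.toIso
        { toFun := fun x => (x.1 ≫ edgeClass e, x.2 + ω ⟨⟨v, w, e⟩, x.1⟩)
          invFun := fun y =>
            (y.1 ≫ inv (edgeClass e), y.2 - ω ⟨⟨v, w, e⟩, y.1 ≫ inv (edgeClass e)⟩)
          left_inv := fun x => by simp
          right_inv := fun y => by simp }⟩ }

/-- The lift to the universal cover of a path `p`, together with the sum of the values of the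
cochain `ω` along it. -/
def liftSum {A : Type*} [AddGroup A] {a : V}
    (ω : (Σ e : Quiver.Total V, PathClass a e.left) → A) {v : V} (p : PathClass a v) :
    PathClass a v × A :=
  ((cochainFunctor ω).map p).iso.hom (𝟙 (vtx a), (0 : A))

section LiftSum

variable {A : Type*} [AddGroup A] {a : V} (ω : (Σ e : Quiver.Total V, PathClass a e.left) → A)

lemma liftSum_id : liftSum ω (𝟙 (vtx a)) = (𝟙 (vtx a), 0) := by
  have hmap := (cochainFunctor ω).map_id (vtx a)
  rw [liftSum, hmap]
  rfl

lemma liftSum_comp_edgeClass {v w : V} (p : PathClass a v) (e : v ⟶ w) :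
    liftSum ω (p ≫ edgeClass e) =
      ((liftSum ω p).1 ≫ edgeClass e, (liftSum ω p).2 + ω ⟨⟨v, w, e⟩, (liftSum ω p).1⟩) := by
  have hmap : (cochainFunctor ω).map (p ≫ edgeClass e) =
      (cochainFunctor ω).map p ≫ _ :=
    ((cochainFunctor ω).map_comp p (edgeClass e)).trans
      (congrArg _ (lift_map_edgeClass _ e))
  rw [liftSum, hmap]
  rfl

lemma liftSum_fst {v : V} (p : PathClass a v) : (liftSum ω p).1 = p := by
  induction p using PathClass.induction with
  | hid => rw [liftSum_id]
  | hpos b c p e ih => rw [liftSum_comp_edgeClass, ih]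
  | hneg b c p e ih =>
    have h := liftSum_comp_edgeClass ω (p ≫ inv (edgeClass e)) e
    rw [Category.assoc, IsIso.inv_hom_id, Category.comp_id] at h
    exact (IsIso.eq_comp_inv _).2 ((congrArg Prod.fst h).symm.trans ih)

end LiftSum

/-- The universal cover is a tree, so every 1-cochain on it is a coboundary. -/
lemma exists_potential {A : Type*} [AddGroup A] {a : V}
    (ω : (Σ e : Quiver.Total V, PathClass a e.left) → A) :
    ∃ χ : ∀ v, PathClass a v → A, ∀ e : Σ e : Quiver.Total V, PathClass a e.left,
      χ _ (e.2 ≫ edgeClass e.1.hom) = χ _ e.2 + ω e :=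
  ⟨fun _ p => (liftSum ω p).2, fun e => by
    simp only [liftSum_comp_edgeClass, liftSum_fst]⟩

end Paths

section FreeGroupEmbedding

variable {V : Type*} [Quiver V]

/-- The functor from the fundamental groupoid to the free group on the set of all edges that labels
every edge by the corresponding generator. The opposite group accounts for the order of composition
in `SingleObj`. -/
def wordFunctor (V : Type*) [Quiver V] :
    Quiver.FreeGroupoid V ⥤ SingleObj (FreeGroup (Quiver.Total V))ᵐᵒᵖ :=
  Quiver.FreeGroupoid.lift
    { obj := fun _ => SingleObj.star _
      map := fun {a b} e => MulOpposite.op (FreeGroup.of (⟨a, b, e⟩ : Quiver.Total V)) }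

/-- The word in the edges read along a homotopy class of edge-paths. -/
def word {a b : V} (p : PathClass a b) : FreeGroup (Quiver.Total V) :=
  MulOpposite.unop ((wordFunctor V).map p)

lemma word_id (a : V) : word (𝟙 (vtx a)) = 1 :=
  congrArg MulOpposite.unop ((wordFunctor V).map_id (vtx a))

lemma word_comp {a b c : V} (p : PathClass a b) (q : PathClass b c) :
    word (p ≫ q) = word p * word q :=
  congrArg MulOpposite.unop ((wordFunctor V).map_comp p q)

lemma word_edgeClass {a b : V} (e : a ⟶ b) : word (edgeClass e) = FreeGroup.of ⟨a, b, e⟩ :=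
  congrArg MulOpposite.unop (lift_map_edgeClass _ e)

lemma word_inv {a b : V} (p : PathClass a b) : word (inv p) = (word p)⁻¹ := by
  rw [eq_inv_iff_mul_eq_one, ← word_comp, IsIso.inv_hom_id, word_id]

open Classical in
/-- The homotopy class of a path, closed up to a loop at `o` by means of chosen paths from `o` to
its ends; the trivial loop, if there are no such paths. -/
def closeUp (o : V) {a b : V} (p : PathClass a b) : PiOne o :=
  if h : Nonempty (PathClass o a) then
    h.some ≫ p ≫ inv (h.map fun q => q ≫ p : Nonempty (PathClass o b)).some
  else 1

lemma closeUp_id (o a : V) : closeUp o (𝟙 (vtx a)) = 1 := by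
  rw [closeUp]
  split_ifs
  · rw [Category.id_comp, IsIso.hom_inv_id, Groupoid.vertexGroup_one]
  · rfl

lemma closeUp_comp (o : V) {a b c : V} (p : PathClass a b) (q : PathClass b c) :
    closeUp o (p ≫ q) = closeUp o p * closeUp o q := by
  by_cases h : Nonempty (PathClass o a)
  · have h' : Nonempty (PathClass o b) := h.map fun q => q ≫ p
    simp only [closeUp, dif_pos h, dif_pos h', Groupoid.vertexGroup_mul, Category.assoc,
      IsIso.inv_hom_id_assoc]
  · have h' : ¬ Nonempty (PathClass o b) := fun h' => h (h'.map fun q => q ≫ inv p)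
    simp only [closeUp, dif_neg h, dif_neg h', mul_one]

lemma closeUp_inv (o : V) {a b : V} (p : PathClass a b) : closeUp o (inv p) = (closeUp o p)⁻¹ := by
  rw [eq_inv_iff_mul_eq_one, ← closeUp_comp, IsIso.inv_hom_id, closeUp_id]

lemma closeUp_injective (a b : V) : Function.Injective (closeUp a : PathClass a b → PiOne a) := by
  intro p q hpq
  have h : Nonempty (PathClass a a) := ⟨𝟙 _⟩
  simpa only [closeUp, dif_pos h, cancel_epi, cancel_mono] using hpq

open Classical in
/-- The permutation of `V × π₁` given by an edge: on the vertices it exchanges the ends of the edge,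
and over the initial vertex it multiplies by the loop that the edge closes up to. -/
def edgePerm (o : V) (e : Quiver.Total V) : Equiv.Perm (V × PiOne o) :=
  (Equiv.prodShear (Equiv.refl V) fun v =>
      if v = e.left then Equiv.mulRight (closeUp o (edgeClass e.hom)) else Equiv.refl _).trans
    (Equiv.prodCongr (Equiv.swap e.left e.right) (Equiv.refl _))

lemma edgePerm_apply (o : V) {a b : V} (e : a ⟶ b) (x : PiOne o) :
    edgePerm o ⟨a, b, e⟩ (a, x) = (b, x * closeUp o (edgeClass e)) := by
  simp [edgePerm, Equiv.prodShear]

/-- The right action of the free group on the edges on `V × π₁` by the permutations `edgePerm`. -/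
def wordAction (o : V) : FreeGroup (Quiver.Total V) →* (Equiv.Perm (V × PiOne o))ᵐᵒᵖ :=
  FreeGroup.lift fun e => MulOpposite.op (edgePerm o e)

lemma wordAction_word_edgeClass (o : V) {a b : V} (e : a ⟶ b) (x : PiOne o) :
    (wordAction o (word (edgeClass e))).unop (a, x) = (b, x * closeUp o (edgeClass e)) := by
  rw [word_edgeClass, wordAction, FreeGroup.lift_apply_of, MulOpposite.unop_op, edgePerm_apply]

lemma wordAction_word (o : V) {a b : V} (p : PathClass a b) (x : PiOne o) :
    (wordAction o (word p)).unop (a, x) = (b, x * closeUp o p) := by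
  induction p using PathClass.induction with
  | hid => simp [word_id, closeUp_id]
  | hpos b c p e ih =>
    rw [word_comp, map_mul, MulOpposite.unop_mul, Equiv.Perm.mul_apply, ih,
      wordAction_word_edgeClass, closeUp_comp, mul_assoc]
  | hneg b c p e ih =>
    rw [word_comp, map_mul, MulOpposite.unop_mul, Equiv.Perm.mul_apply, ih, word_inv, map_inv,
      MulOpposite.unop_inv, Equiv.Perm.inv_eq_iff_eq, wordAction_word_edgeClass, closeUp_comp,
      closeUp_inv, ← mul_assoc, inv_mul_cancel_right]

/-- The embedding of the fundamental group in the free group on the set of edges. -/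
def wordHom (o : V) : PiOne o →* FreeGroup (Quiver.Total V) where
  toFun := word
  map_one' := word_id o
  map_mul' p q := word_comp p q

lemma wordHom_injective (o : V) : Function.Injective (wordHom o) := by
  intro p q hpq
  have hloop : (o, 1 * closeUp o p) = (o, 1 * closeUp o q) := by
    rw [← wordAction_word o p 1, ← wordAction_word o q 1, show word p = word q from hpq]
  exact closeUp_injective o o (by simpa using hloop)

instance isFreeGroup_piOne (o : V) : IsFreeGroup (PiOne o) :=
  IsFreeGroup.ofMulEquiv (MonoidHom.ofInjective (wordHom_injective o)).symm

end FreeGroupEmbedding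

section Chains

variable {V : Type*} [Quiver V] (f : BasedHomotopyEquiv V)

namespace BasedHomotopyEquiv

/-- Up to sign, `χ` is the indicator of one of the two sides of `e` in the universal cover. -/
lemma exists_cut (e : f.CoverEdge) :
    ∃ χ : f.CoverVertex → ℚ, (∀ v, χ v = 0 ∨ χ v = 1) ∧ χ (f.terminus e) ≠ χ (f.origin e) ∧
      ∀ e', e' ≠ e → χ (f.terminus e') = χ (f.origin e') := by
  classical
  obtain ⟨b, hb⟩ := exists_potential (A := ZMod 2) fun e' : f.CoverEdge => if e' = e then 1 else 0
  have hval : ∀ z : ZMod 2, (z.val : ℚ) = 0 ∨ (z.val : ℚ) = 1 := by decide +revert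
  refine ⟨fun v => ((b v.1 v.2).val : ℚ), fun v => hval _, fun h => ?_, fun e' he' => ?_⟩
  · have h' := ZMod.val_injective 2 (Nat.cast_injective h)
    rw [terminus, hb e, if_pos rfl] at h'
    exact one_ne_zero (left_eq_add.1 h'.symm)
  · simp only [terminus, origin, hb e', if_neg he', add_zero]

lemma boundary_single (e : f.CoverEdge) (q : ℚ) :
    f.boundary (Finsupp.single e q) =
      q • (Finsupp.single (f.terminus e) (1 : ℚ) - Finsupp.single (f.origin e) (1 : ℚ)) :=
  Finsupp.linearCombination_single _ _ _

lemma linearCombination_boundary {e : f.CoverEdge} {χ : f.CoverVertex → ℚ}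
    (hχ : ∀ e', e' ≠ e → χ (f.terminus e') = χ (f.origin e')) (c : f.C1) :
    Finsupp.linearCombination ℚ χ (f.boundary c) =
      c e * (χ (f.terminus e) - χ (f.origin e)) := by
  classical
  induction c using Finsupp.induction_linear with
  | zero => simp
  | add x y hx hy => simp [hx, hy, add_mul]
  | single e' q =>
    rw [boundary_single, map_smul, map_sub, Finsupp.linearCombination_single,
      Finsupp.linearCombination_single, one_smul, one_smul, Finsupp.single_apply, smul_eq_mul]
    split_ifs with h
    · rw [h]
    · rw [hχ e' h, sub_self, mul_zero, zero_mul]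

lemma boundary_injective : Function.Injective f.boundary := by
  intro x y hxy
  ext e
  obtain ⟨χ, -, hne, hχ⟩ := f.exists_cut e
  apply mul_right_cancel₀ (sub_ne_zero.2 hne)
  rw [← f.linearCombination_boundary hχ, hxy, f.linearCombination_boundary hχ]

lemma segment_coeff {u v : f.CoverVertex} {c : f.C1}
    (hc : f.boundary c = Finsupp.single v 1 - Finsupp.single u 1) (e : f.CoverEdge) :
    c e = 0 ∨ c e = 1 ∨ c e = -1 := by
  obtain ⟨χ, hval, hne, hχ⟩ := f.exists_cut e
  have h := f.linearCombination_boundary hχ c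
  rw [hc, map_sub, Finsupp.linearCombination_single, Finsupp.linearCombination_single, one_smul,
    one_smul] at h
  rcases hval u with hu | hu <;> rcases hval v with hv | hv <;>
    rcases hval (f.terminus e) with ht | ht <;> rcases hval (f.origin e) with ho | ho <;>
    rw [hu, hv, ht, ho] at h <;> grind

lemma boundary_pathChain {a b : V} (p : PathClass f.base a) (q : EdgePath a b) :
    f.boundary (f.pathChain p q) =
      Finsupp.single ⟨b, p ≫ q.cls⟩ 1 - Finsupp.single ⟨a, p⟩ 1 := by
  induction q with
  | nil => simp [pathChain, EdgePath.cls]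
  | pos q e ih =>
    rw [pathChain, map_add, ih, boundary_single, one_smul, terminus, origin, EdgePath.cls]
    simp
  | neg q e ih =>
    rw [pathChain, map_sub, ih, boundary_single, one_smul, terminus, origin, EdgePath.cls]
    simp

lemma mapFromBase_comp {a b : V} (p : PathClass f.base a) (q : PathClass a b) :
    f.mapFromBase (p ≫ q) = f.mapFromBase p ≫ f.functor.map q :=
  (congrArg (eqToHom f.functor_obj_base.symm ≫ ·) (f.functor.map_comp p q)).trans
    (Category.assoc _ _ _).symm

lemma mapFromBase_mul {a : V} (g : f.F) (p : PathClass f.base a) :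
    f.mapFromBase (g ≫ p) = f.Phi g ≫ f.mapFromBase p := by
  rw [mapFromBase_comp]
  have hPhi : f.mapFromBase g = f.Phi g ≫ eqToHom f.functor_obj_base.symm := by
    change eqToHom _ ≫ f.functor.map g = (eqToHom _ ≫ f.functor.map g ≫ eqToHom _) ≫ eqToHom _
    rw [Category.assoc, Category.assoc, eqToHom_trans, eqToHom_refl, Category.comp_id]
  rw [hPhi]
  exact Category.assoc _ _ _

lemma functor_map_edgeClass {a b : V} (e : a ⟶ b) :
    f.functor.map (edgeClass e) = (f.onE e).cls :=
  lift_map_edgeClass _ e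

lemma chainMap_single (e : f.CoverEdge) (q : ℚ) :
    f.chainMap (Finsupp.single e q) =
      q • f.pathChain (f.mapFromBase e.2) (f.onE e.1.hom) :=
  Finsupp.linearCombination_single _ _ _

lemma boundary_chainMap (c : f.C1) :
    f.boundary (f.chainMap c) = Finsupp.mapDomain f.fTilde (f.boundary c) := by
  induction c using Finsupp.induction_linear with
  | zero => simp
  | add x y hx hy => simp [hx, hy, Finsupp.mapDomain_add]
  | single e q =>
    rw [chainMap_single, map_smul, boundary_pathChain, boundary_single,
      ← Finsupp.lmapDomain_apply ℚ ℚ, map_smul, map_sub, Finsupp.lmapDomain_apply,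
      Finsupp.lmapDomain_apply, Finsupp.mapDomain_single, Finsupp.mapDomain_single]
    simp only [fTilde, terminus, origin]
    have h : f.mapFromBase (e.2 ≫ edgeClass e.1.hom) =
        f.mapFromBase e.2 ≫ (f.onE e.1.hom).cls :=
      (f.mapFromBase_comp _ _).trans (congrArg _ (f.functor_map_edgeClass _))
    rw [h]

lemma pathChain_mem_supported {a b : V} (p : PathClass f.base a) (q : EdgePath a b) :
    f.pathChain p q ∈ Finsupp.supported ℚ ℚ {e : f.CoverEdge | e.1 ∈ q.edges} := by
  induction q with
  | nil => exact Submodule.zero_mem _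
  | pos q e ih =>
    refine Submodule.add_mem _ (Finsupp.supported_mono ?_ ih) (Finsupp.single_mem_supported _ _ ?_)
    · exact fun x hx => Set.mem_insert_of_mem _ hx
    · exact Set.mem_insert _ _
  | neg q e ih =>
    refine Submodule.sub_mem _ (Finsupp.supported_mono ?_ ih) (Finsupp.single_mem_supported _ _ ?_)
    · exact fun x hx => Set.mem_insert_of_mem _ hx
    · exact Set.mem_insert _ _

variable (H : Subgraph V)

lemma relProj_apply_of_mem (c : f.C1) {e : f.CoverEdge} (he : e ∈ f.relCoverEdges H) :
    (f.relProj H c : f.C1) e = c e := by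
  classical
  simp [relProj, Finsupp.restrictDom_apply, he]

lemma relProj_apply_of_notMem (c : f.C1) {e : f.CoverEdge} (he : e ∉ f.relCoverEdges H) :
    (f.relProj H c : f.C1) e = 0 := by
  classical
  simp [relProj, Finsupp.restrictDom_apply, he]

lemma relProj_single_of_mem {e : f.CoverEdge} (he : e ∈ f.relCoverEdges H) (q : ℚ) :
    (f.relProj H (Finsupp.single e q) : f.C1) = Finsupp.single e q := by
  classical
  ext e'
  by_cases he' : e' ∈ f.relCoverEdges H
  · rw [relProj_apply_of_mem f H _ he']
  · rw [relProj_apply_of_notMem f H _ he',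
      Finsupp.single_eq_of_ne fun h : e' = e => he' (h ▸ he)]

lemma relProj_eq_zero {c : f.C1} (hc : ∀ e ∈ f.relCoverEdges H, c e = 0) : f.relProj H c = 0 := by
  ext e
  by_cases he : e ∈ f.relCoverEdges H
  · rw [relProj_apply_of_mem f H _ he, hc e he]
    rfl
  · rw [relProj_apply_of_notMem f H _ he]
    rfl

variable {H} in
lemma relProj_chainMap_single (hH : H.IsInvariant f.toGraphMorphism) {e : f.CoverEdge}
    (he : e ∉ f.relCoverEdges H) (q : ℚ) : f.relProj H (f.chainMap (Finsupp.single e q)) = 0 := by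
  rw [chainMap_single, map_smul]
  refine smul_eq_zero_of_right _ (relProj_eq_zero f H fun e' he' => ?_)
  by_contra hne
  exact he' (hH.2 _ (not_not.1 he) (pathChain_mem_supported f _ _ (Finsupp.mem_support_iff.2 hne)))

variable {H} in
lemma relChainMap_relProj (hH : H.IsInvariant f.toGraphMorphism) (c : f.C1) :
    f.relChainMap H (f.relProj H c) = f.relProj H (f.chainMap c) := by
  induction c using Finsupp.induction_linear with
  | zero => simp
  | add x y hx hy => simp [hx, hy]
  | single e q =>
    by_cases he : e ∈ f.relCoverEdges H
    · rw [relChainMap, LinearMap.comp_apply, LinearMap.comp_apply, Submodule.subtype_apply,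
        relProj_single_of_mem f H he]
    · rw [relProj_chainMap_single f hH he, relProj_eq_zero f H fun e' he' =>
        Finsupp.single_eq_of_ne fun h : e' = e => he (h ▸ he'), map_zero]

variable {H} in
lemma relChainMap_fixedSegment (hH : H.IsInvariant f.toGraphMorphism)
    {ρ : f.RelC1 H} (hρ : f.IsFixedSegment H ρ) : f.relChainMap H ρ = ρ := by
  obtain ⟨u, v, -, hu, hv, c, hc, rfl⟩ := hρ
  rw [relChainMap_relProj f hH]
  congr 1
  apply f.boundary_injective
  rw [boundary_chainMap, hc, ← Finsupp.lmapDomain_apply ℚ ℚ, map_sub, Finsupp.lmapDomain_apply,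
    Finsupp.lmapDomain_apply, Finsupp.mapDomain_single, Finsupp.mapDomain_single, hu, hv]

variable {H} in
lemma fixedSegment_coeff {ρ : f.RelC1 H}
    (hρ : f.IsFixedSegment H ρ) (e : f.CoverEdge) :
    (ρ : f.C1) e = 0 ∨ (ρ : f.C1) e = 1 ∨ (ρ : f.C1) e = -1 := by
  obtain ⟨u, v, -, -, -, c, hc, rfl⟩ := hρ
  by_cases he : e ∈ f.relCoverEdges H
  · rw [relProj_apply_of_mem f H _ he]
    exact f.segment_coeff hc e
  · exact Or.inl (relProj_apply_of_notMem f H _ he)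

lemma edgeAct_injective (g : f.F) : Function.Injective (f.edgeAct g) := by
  rintro ⟨e, p⟩ ⟨e', p'⟩ h
  simp only [edgeAct, Sigma.mk.injEq] at h
  obtain ⟨rfl, h⟩ := h
  rw [heq_eq_eq, cancel_epi] at h
  rw [h]

lemma edgeAct_mul (g h : f.F) (e : f.CoverEdge) :
    f.edgeAct (g * h) e = f.edgeAct g (f.edgeAct h e) := by
  simp [edgeAct, Groupoid.vertexGroup_mul]

lemma edgeAct_one (e : f.CoverEdge) : f.edgeAct 1 e = e := by
  simp [edgeAct, Groupoid.vertexGroup_one]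

lemma edgeAct_edgeAct_inv (g : f.F) (e : f.CoverEdge) : f.edgeAct g (f.edgeAct g⁻¹ e) = e := by
  rw [← edgeAct_mul, mul_inv_cancel, edgeAct_one]

lemma chainAct_single (g : f.F) (e : f.CoverEdge) (q : ℚ) :
    f.chainAct g (Finsupp.single e q) = Finsupp.single (f.edgeAct g e) q :=
  Finsupp.mapDomain_single

lemma chainAct_apply (g : f.F) (c : f.C1) (e : f.CoverEdge) :
    f.chainAct g c e = c (f.edgeAct g⁻¹ e) := by
  conv_lhs => rw [← f.edgeAct_edgeAct_inv g e]
  exact Finsupp.mapDomain_apply (f.edgeAct_injective g) _ _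

lemma relAct_apply (g : f.F) (x : f.RelC1 H) (e : f.CoverEdge) :
    (f.relAct H g x : f.C1) e = (x : f.C1) (f.edgeAct g⁻¹ e) :=
  f.chainAct_apply g x e

lemma chainAct_pathChain (g : f.F) {a b : V} (p : PathClass f.base a) (q : EdgePath a b) :
    f.pathChain (show PathClass f.base a from g ≫ p) q = f.chainAct g (f.pathChain p q) := by
  induction q with
  | nil => simp [pathChain]
  | pos q e ih =>
    rw [pathChain, pathChain, map_add, ih]
    simp [chainAct, edgeAct]
  | neg q e ih =>
    rw [pathChain, pathChain, map_sub, ih]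
    simp [chainAct, edgeAct]

lemma chainMap_chainAct (g : f.F) (c : f.C1) :
    f.chainMap (f.chainAct g c) = f.chainAct (f.Phi g) (f.chainMap c) := by
  induction c using Finsupp.induction_linear with
  | zero => simp
  | add x y hx hy => simp [hx, hy]
  | single e q =>
    rw [chainAct_single, chainMap_single, chainMap_single, map_smul, ← chainAct_pathChain,
      ← mapFromBase_mul]
    rfl

lemma relProj_chainAct (g : f.F) (c : f.C1) :
    f.relProj H (f.chainAct g c) = f.relAct H g (f.relProj H c) := by
  ext e
  rw [relAct_apply]
  by_cases he : e ∈ f.relCoverEdges H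
  · have he' : f.edgeAct g⁻¹ e ∈ f.relCoverEdges H := he
    rw [relProj_apply_of_mem f H _ he, relProj_apply_of_mem f H _ he', chainAct_apply]
  · have he' : f.edgeAct g⁻¹ e ∉ f.relCoverEdges H := he
    rw [relProj_apply_of_notMem f H _ he, relProj_apply_of_notMem f H _ he']

lemma relChainMap_relAct (g : f.F) (x : f.RelC1 H) :
    f.relChainMap H (f.relAct H g x) = f.relAct H (f.Phi g) (f.relChainMap H x) := by
  have h : ((f.relAct H g x : f.RelC1 H) : f.C1) = f.chainAct g x := rfl
  simp only [relChainMap, LinearMap.comp_apply, Submodule.subtype_apply, h, chainMap_chainAct,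
    relProj_chainAct]

end BasedHomotopyEquiv

end Chains

section L2Basics

variable {X Y : Type*}

lemma delta_eq_single [DecidableEq X] (x : X) :
    (delta x : L2 X) = lp.single (E := fun _ : X => ℂ) 2 x (1 : ℂ) := by
  unfold delta
  congr
  exact Subsingleton.elim _ _

lemma inner_delta (x : X) (ξ : L2 X) : inner ℂ (delta x) ξ = ξ x := by
  classical
  rw [delta_eq_single, lp.inner_single_left]
  simp

lemma delta_apply_self (x : X) : (delta x : L2 X) x = 1 := by
  classical
  rw [delta_eq_single, lp.single_apply_self]

lemma delta_apply_of_ne {x y : X} (h : y ≠ x) : (delta x : L2 X) y = 0 := by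
  classical
  rw [delta_eq_single, lp.single_apply_ne _ _ _ h]

lemma closure_span_delta (X : Type*) :
    (Submodule.span ℂ (Set.range (delta : X → L2 X))).topologicalClosure = ⊤ := by
  classical
  rw [eq_top_iff]
  intro ξ _
  have h := lp.hasSum_single (E := fun _ : X => ℂ) (p := 2) (by norm_num) ξ
  refine mem_closure_of_tendsto h (Filter.Eventually.of_forall fun s => ?_)
  refine Submodule.sum_mem _ fun x _ => ?_
  have hsingle : lp.single (E := fun _ : X => ℂ) 2 x (ξ x) = ξ x • delta x := by
    rw [delta_eq_single, ← lp.single_smul, smul_eq_mul, mul_one]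
  rw [hsingle]
  exact Submodule.smul_mem _ _ (Submodule.subset_span ⟨x, rfl⟩)

lemma ext_delta {E : Type*} [NormedAddCommGroup E] [NormedSpace ℂ E] {S T : L2 X →L[ℂ] E}
    (h : ∀ x, S (delta x) = T (delta x)) : S = T := by
  refine ContinuousLinearMap.ext_on (s := Set.range delta) ?_ ?_
  · rw [Submodule.dense_iff_topologicalClosure_eq_top]
    exact closure_span_delta X
  · rintro _ ⟨x, rfl⟩
    exact h x

lemma pushforward_apply (σ : X → Y) (hσ : Function.Injective σ) (ξ : L2 X) (x : X) :
    pushforward σ hσ ξ (σ x) = ξ x := by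
  rw [← inner_delta, ← pushforward_delta σ hσ, LinearIsometry.inner_map_map, inner_delta]

lemma hasSum_norm_sq (ξ : L2 X) : HasSum (fun x => ‖ξ x‖ ^ 2) (‖ξ‖ ^ 2) := by
  simpa using lp.hasSum_norm (E := fun _ : X => ℂ) (p := 2) (by norm_num) ξ

lemma memℓp_of_norm_le (ξ : L2 X) (a : X → ℂ) (h : ∀ x, ‖a x‖ ≤ ‖ξ x‖) : Memℓp a 2 := by
  refine memℓp_gen ?_
  refine Summable.of_nonneg_of_le (fun x => by positivity) (fun x => ?_)
    (hasSum_norm_sq ξ).summable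
  simpa using pow_le_pow_left₀ (norm_nonneg _) (h x) 2

open Classical in
/-- The restriction of a square summable function to a subset. -/
def restr (S : Set X) : L2 X →ₗ[ℂ] L2 X where
  toFun ξ := ⟨fun x => if x ∈ S then ξ x else 0, memℓp_of_norm_le ξ _ fun x => by
    split_ifs <;> simp⟩
  map_add' ξ η := by
    ext x
    change (if x ∈ S then ξ x + η x else 0) = (if x ∈ S then ξ x else 0) + if x ∈ S then η x else 0
    split_ifs <;> simp
  map_smul' c ξ := by
    ext x
    change (if x ∈ S then c * ξ x else 0) = c * (if x ∈ S then ξ x else 0)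
    split_ifs <;> simp

lemma restr_apply_of_mem {S : Set X} (ξ : L2 X) {x : X} (h : x ∈ S) : restr S ξ x = ξ x :=
  if_pos h

lemma restr_apply_of_notMem {S : Set X} (ξ : L2 X) {x : X} (h : x ∉ S) : restr S ξ x = 0 :=
  if_neg h

lemma norm_restr_le (S : Set X) (ξ : L2 X) : ‖restr S ξ‖ ≤ ‖ξ‖ := by
  refine (sq_le_sq₀ (norm_nonneg _) (norm_nonneg _)).1 ?_
  refine hasSum_le (fun x => ?_) (hasSum_norm_sq _) (hasSum_norm_sq _)
  by_cases h : x ∈ S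
  · rw [restr_apply_of_mem ξ h]
  · rw [restr_apply_of_notMem ξ h]
    simp

lemma norm_sq_le_restr {S T : Set X} (h : ∀ x, x ∈ S ∨ x ∈ T) (ξ : L2 X) :
    ‖ξ‖ ^ 2 ≤ ‖restr S ξ‖ ^ 2 + ‖restr T ξ‖ ^ 2 := by
  refine hasSum_le (fun x => ?_) (hasSum_norm_sq ξ)
    ((hasSum_norm_sq (restr S ξ)).add (hasSum_norm_sq (restr T ξ)))
  rcases h x with h | h
  · rw [restr_apply_of_mem ξ h]
    exact le_add_of_nonneg_right (by positivity)
  · rw [restr_apply_of_mem ξ h]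
    exact le_add_of_nonneg_left (by positivity)

lemma restr_le_norm_sq {S T U : Set X} (hST : ∀ x ∈ S, x ∉ T) (hSU : ∀ x ∈ S, x ∉ U)
    (hTU : ∀ x ∈ T, x ∉ U) (ξ : L2 X) :
    ‖restr S ξ‖ ^ 2 + ‖restr T ξ‖ ^ 2 + ‖restr U ξ‖ ^ 2 ≤ ‖ξ‖ ^ 2 := by
  refine hasSum_le (fun x => ?_) (((hasSum_norm_sq (restr S ξ)).add
    (hasSum_norm_sq (restr T ξ))).add (hasSum_norm_sq (restr U ξ))) (hasSum_norm_sq ξ)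
  by_cases hS : x ∈ S
  · simp [restr_apply_of_mem ξ hS, restr_apply_of_notMem ξ (hST x hS),
      restr_apply_of_notMem ξ (hSU x hS)]
  by_cases hT : x ∈ T
  · simp [restr_apply_of_mem ξ hT, restr_apply_of_notMem ξ hS, restr_apply_of_notMem ξ (hTU x hT)]
  by_cases hU : x ∈ U
  · simp [restr_apply_of_mem ξ hU, restr_apply_of_notMem ξ hS, restr_apply_of_notMem ξ hT]
  · simp [restr_apply_of_notMem ξ hU, restr_apply_of_notMem ξ hS, restr_apply_of_notMem ξ hT]

end L2Basics

section Gap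

variable {G : Type*} [Group G]

/-- The right translation of square summable functions by `s`. -/
def rshift (s : G) : L2 G →ₗᵢ[ℂ] L2 G := pushforward (· * s) (mul_left_injective s)

lemma rshift_delta (s g : G) : rshift s (delta g) = delta (g * s) := pushforward_delta _ _ _

lemma rshift_apply (s : G) (ξ : L2 G) (g : G) : rshift s ξ g = ξ (g * s⁻¹) := by
  have := pushforward_apply (· * s) (mul_left_injective s) ξ (g * s⁻¹)
  simpa [rshift] using this

lemma rshift_mul (s r : G) (ξ : L2 G) : rshift (s * r) ξ = rshift r (rshift s ξ) := by
  ext g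
  simp [rshift_apply, mul_assoc]

lemma rshift_one (ξ : L2 G) : rshift 1 ξ = ξ := by
  ext g
  simp [rshift_apply]

lemma norm_restr_rshift (S : Set G) (s : G) (ξ : L2 G) :
    ‖restr S (rshift s ξ)‖ = ‖restr {g | g * s ∈ S} ξ‖ := by
  refine (pow_left_inj₀ (norm_nonneg _) (norm_nonneg _) two_ne_zero).1 ?_
  have h := (Equiv.mulRight s).hasSum_iff.2 (hasSum_norm_sq (restr S (rshift s ξ)))
  refine h.unique ?_
  convert hasSum_norm_sq (restr {g | g * s ∈ S} ξ) using 2 with g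
  simp only [Function.comp_apply, Equiv.coe_mulRight]
  by_cases hg : g * s ∈ S
  · rw [restr_apply_of_mem _ hg, restr_apply_of_mem ξ (show g ∈ {g | g * s ∈ S} from hg),
      rshift_apply, mul_inv_cancel_right]
  · rw [restr_apply_of_notMem _ hg, restr_apply_of_notMem ξ (show g ∉ {g | g * s ∈ S} from hg)]

lemma norm_rshift_mul_sub_le (s r : G) (ξ : L2 G) :
    ‖rshift (s * r) ξ - ξ‖ ≤ ‖rshift s ξ - ξ‖ + ‖rshift r ξ - ξ‖ := by
  have h : rshift (s * r) ξ - ξ = rshift r (rshift s ξ - ξ) + (rshift r ξ - ξ) := by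
    rw [map_sub, rshift_mul]
    abel
  rw [h]
  refine (norm_add_le _ _).trans ?_
  rw [LinearIsometry.norm_map]

lemma norm_rshift_inv_sub (s : G) (ξ : L2 G) : ‖rshift s⁻¹ ξ - ξ‖ = ‖rshift s ξ - ξ‖ := by
  rw [← (rshift s).norm_map (rshift s⁻¹ ξ - ξ), map_sub, ← rshift_mul, inv_mul_cancel, rshift_one,
    norm_sub_rev]

/-- A set such that `S` and `S * x⁻¹` cover the group, although `S`, `S * y⁻¹` and `S * (y * y)⁻¹`
are disjoint. -/
structure IsParadoxical (S : Set G) (x y : G) : Prop where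
  cover : ∀ g, g ∈ S ∨ g * x ∈ S
  disjoint : ∀ g ∈ S, g * y ∉ S
  disjoint_sq : ∀ g ∈ S, g * (y * y) ∉ S

/-- Here `m` is the mass of an almost invariant unit vector on a paradoxical set, and `a`, `b`, `c`
are the masses of its translates. -/
lemma le_mul_of_sq_le_of_sq_le {n m a b c ε : ℝ} (hm : 0 ≤ m) (ha : 0 ≤ a) (hε : 0 ≤ ε)
    (hma : a ≤ m + ε) (hmb : m - 2 * ε ≤ b) (hmc : m - 2 * ε ≤ c)
    (hle : n ^ 2 ≤ m ^ 2 + a ^ 2) (hge : m ^ 2 + b ^ 2 + c ^ 2 ≤ n ^ 2) : n ≤ 15 * ε := by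
  have ha2 : a ^ 2 ≤ (m + ε) ^ 2 := pow_le_pow_left₀ ha hma 2
  have hm10 : m ≤ 10 * ε := by
    by_contra! hcon
    have hpos : 0 ≤ m - 2 * ε := by linarith
    have hb2 := pow_le_pow_left₀ hpos hmb 2
    have hc2 := pow_le_pow_left₀ hpos hmc 2
    nlinarith
  refine abs_le_of_sq_le_sq' ?_ (by positivity) |>.2
  nlinarith

lemma IsParadoxical.norm_le {S : Set G} {x y : G} (hS : IsParadoxical S x y) (ξ : L2 G) :
    ‖ξ‖ ≤ 15 * (‖rshift x ξ - ξ‖ + ‖rshift y ξ - ξ‖) := by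
  have hle := norm_sq_le_restr (T := {g | g * x ∈ S}) hS.cover ξ
  have hge := restr_le_norm_sq (T := {g | g * y ∈ S}) (U := {g | g * (y * y) ∈ S}) hS.disjoint
    hS.disjoint_sq (fun g hg hg' => hS.disjoint _ hg (by simpa [mul_assoc] using hg')) ξ
  rw [← norm_restr_rshift] at hle
  rw [← norm_restr_rshift, ← norm_restr_rshift] at hge
  have hsub : ∀ s : G, |‖restr S (rshift s ξ)‖ - ‖restr S ξ‖| ≤ ‖rshift s ξ - ξ‖ := by
    intro s
    refine (abs_norm_sub_norm_le _ _).trans ?_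
    rw [← map_sub]
    exact norm_restr_le _ _
  have hx := abs_le.1 (hsub x)
  have hy := abs_le.1 (hsub y)
  have hyy := abs_le.1 ((hsub (y * y)).trans (norm_rshift_mul_sub_le y y ξ))
  have hx0 := norm_nonneg (rshift x ξ - ξ)
  have hy0 := norm_nonneg (rshift y ξ - ξ)
  exact le_mul_of_sq_le_of_sq_le (norm_nonneg _) (norm_nonneg _) (add_nonneg hx0 hy0)
    (by linarith) (by linarith) (by linarith) hle hge

lemma inv_mem_startsWith {α : Type*} [DecidableEq α] (s : α) {w : FreeGroup α}
    (hw : w⁻¹ ∉ FreeGroup.startsWith (s, true)) :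
    (w * FreeGroup.of s)⁻¹ ∈ FreeGroup.startsWith (s, false) := by
  rw [mul_inv_rev]
  exact FreeGroup.startsWith_mk_mul (w⁻¹) hw

lemma eq_of_mem_startsWith {α : Type*} [DecidableEq α] {v w : α × Bool} {g : FreeGroup α}
    (hv : g ∈ FreeGroup.startsWith v) (hw : g ∈ FreeGroup.startsWith w) : v = w := by
  by_contra h
  exact Set.disjoint_left.1 (FreeGroup.startsWith.disjoint_iff_ne.2 h) hv hw

lemma exists_isParadoxical_freeGroup {α : Type*} {x y : α} (hxy : x ≠ y) :
    ∃ S : Set (FreeGroup α), IsParadoxical S (FreeGroup.of x) (FreeGroup.of y) := by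
  classical
  let S : Set (FreeGroup α) := {w | ∃ b : Bool, w⁻¹ ∈ FreeGroup.startsWith (x, b)}
  have mul_y_mem : ∀ w ∈ S, (w * FreeGroup.of y)⁻¹ ∈ FreeGroup.startsWith (y, false) :=
    fun w ⟨_, hb⟩ => inv_mem_startsWith y fun h =>
      hxy (congrArg Prod.fst (eq_of_mem_startsWith hb h))
  have notMem_S : ∀ w : FreeGroup α, w⁻¹ ∈ FreeGroup.startsWith (y, false) → w ∉ S :=
    fun w hw ⟨_, hb⟩ => hxy (congrArg Prod.fst (eq_of_mem_startsWith hb hw))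
  refine ⟨S, fun w => ?_, fun w hw => notMem_S _ (mul_y_mem w hw), fun w hw => notMem_S _ ?_⟩
  · by_cases h : w⁻¹ ∈ FreeGroup.startsWith (x, true)
    · exact Or.inl ⟨true, h⟩
    · exact Or.inr ⟨false, inv_mem_startsWith x h⟩
  · rw [← mul_assoc]
    refine inv_mem_startsWith y fun h => ?_
    simpa using eq_of_mem_startsWith h (mul_y_mem w hw)

/-- A choice of representatives of the left cosets of the image of `κ`. -/
lemma exists_rightEquivariant {K : Type*} [Group K] {κ : K →* G} (hκ : Function.Injective κ) :
    ∃ c : G → K, ∀ g v, c (g * κ v) = c g * v := by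
  let r : G → G := fun g => (QuotientGroup.mk g : G ⧸ κ.range).out
  have hr : ∀ g v, r (g * κ v) = r g := fun g v =>
    congrArg Quotient.out (QuotientGroup.mk_mul_of_mem g ⟨v, rfl⟩)
  have hrep : ∀ g, ∃ v, κ v = (r g)⁻¹ * g := fun g =>
    QuotientGroup.eq.1 (Quotient.out_eq (QuotientGroup.mk g : G ⧸ κ.range))
  choose c hc using hrep
  refine ⟨c, fun g v => hκ ?_⟩
  rw [hc, hr, map_mul, hc, mul_assoc]

lemma IsParadoxical.exists_of_injective {K : Type*} [Group K] {κ : K →* G}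
    (hκ : Function.Injective κ) {S : Set K} {x y : K} (hS : IsParadoxical S x y) :
    ∃ S' : Set G, IsParadoxical S' (κ x) (κ y) := by
  obtain ⟨c, hc⟩ := exists_rightEquivariant hκ
  refine ⟨c ⁻¹' S, fun g => ?_, fun g hg => ?_, fun g hg => ?_⟩
  · simpa only [Set.mem_preimage, hc] using hS.cover (c g)
  · simpa only [Set.mem_preimage, hc] using hS.disjoint (c g) hg
  · simpa only [Set.mem_preimage, ← map_mul, hc] using hS.disjoint_sq (c g) hg

/-- The subgroup of the elements `s` whose displacement `‖rshift s ξ - ξ‖` is controlled by the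
displacements by `s₁` and `s₂`, uniformly in `ξ`. -/
def controlled (s₁ s₂ : G) : Subgroup G where
  carrier := {s | ∃ C : ℝ, 0 ≤ C ∧ ∀ ξ : L2 G,
    ‖rshift s ξ - ξ‖ ≤ C * (‖rshift s₁ ξ - ξ‖ + ‖rshift s₂ ξ - ξ‖)}
  one_mem' := ⟨0, le_rfl, fun ξ => by simp [rshift_one]⟩
  mul_mem' := by
    rintro s r ⟨C, hC, h⟩ ⟨D, hD, h'⟩
    exact ⟨C + D, add_nonneg hC hD, fun ξ => (norm_rshift_mul_sub_le s r ξ).trans (by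
      rw [add_mul]; exact add_le_add (h ξ) (h' ξ))⟩
  inv_mem' := by
    rintro s ⟨C, hC, h⟩
    exact ⟨C, hC, fun ξ => by rw [norm_rshift_inv_sub]; exact h ξ⟩

lemma closure_pair_le_controlled (s₁ s₂ : G) :
    Subgroup.closure {s₁, s₂} ≤ controlled s₁ s₂ := by
  rw [Subgroup.closure_le]
  rintro s (rfl | rfl)
  · exact ⟨1, zero_le_one, fun ξ => by simp⟩
  · exact ⟨1, zero_le_one, fun ξ => by simp⟩

lemma freeGroup_mul_comm {α : Type*} [Subsingleton α] (a b : FreeGroup α) : a * b = b * a := by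
  rcases isEmpty_or_nonempty α with hα | ⟨⟨x⟩⟩
  · exact Subsingleton.elim _ _
  · have : Unique α := uniqueOfSubsingleton x
    exact FreeGroup.mulEquivIntOfUnique.injective (by rw [map_mul, map_mul, mul_comm])

/-- Two elements of a free subgroup that do not commute have no common almost invariant vectors: the
subgroup that they generate is free of rank at least two, and thus has paradoxical sets. -/
theorem exists_spectral_gap {F : Type*} [Group F] [IsFreeGroup F] {κ : F →* G}
    (hκ : Function.Injective κ) {g₁ g₂ : F} (hg : g₁ * g₂ ≠ g₂ * g₁) :
    ∃ C : ℝ, 0 ≤ C ∧ ∀ ξ : L2 G,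
      ‖ξ‖ ≤ C * (‖rshift (κ g₁) ξ - ξ‖ + ‖rshift (κ g₂) ξ - ξ‖) := by
  let K : Subgroup F := Subgroup.closure {g₁, g₂}
  let ε : FreeGroup (IsFreeGroup.Generators K) ≃* K := IsFreeGroup.mulEquiv K
  have hnontrivial : Nontrivial (IsFreeGroup.Generators K) := by
    rw [← not_subsingleton_iff_nontrivial]
    intro hsub
    let k₁ : K := ⟨g₁, Subgroup.subset_closure (by simp)⟩
    let k₂ : K := ⟨g₂, Subgroup.subset_closure (by simp)⟩
    have hcomm := congrArg ε (freeGroup_mul_comm (ε.symm k₁) (ε.symm k₂))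
    exact hg (by simpa [k₁, k₂, Subtype.ext_iff] using hcomm)
  obtain ⟨x, y, hxy⟩ := exists_pair_ne (IsFreeGroup.Generators K)
  obtain ⟨S, hS⟩ := exists_isParadoxical_freeGroup hxy
  let θ : FreeGroup (IsFreeGroup.Generators K) →* G := κ.comp (K.subtype.comp ε.toMonoidHom)
  have hθ : Function.Injective θ := hκ.comp (Subtype.val_injective.comp ε.injective)
  obtain ⟨S', hS'⟩ := hS.exists_of_injective hθ
  have hcontrolled : ∀ w, θ w ∈ controlled (κ g₁) (κ g₂) := by
    intro w
    apply closure_pair_le_controlled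
    rw [← Set.image_pair, ← MonoidHom.map_closure]
    exact Subgroup.mem_map_of_mem κ (ε w).2
  obtain ⟨C, hC, hCx⟩ := hcontrolled (FreeGroup.of x)
  obtain ⟨D, hD, hDy⟩ := hcontrolled (FreeGroup.of y)
  refine ⟨15 * (C + D), by positivity, fun ξ => (hS'.norm_le ξ).trans ?_⟩
  rw [mul_assoc, add_mul]
  gcongr
  exacts [hCx ξ, hDy ξ]

end Gap

section LogSeries

open Filter Topology

variable {M : Type*} [CStarAlgebra M]

lemma norm_pow_le_of_norm_le {a : M} {r : ℝ} (ha : ‖a‖ ≤ r) (n : ℕ) : ‖a ^ n‖ ≤ r ^ n := by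
  rcases subsingleton_or_nontrivial M with h | h
  · rw [Subsingleton.elim (a ^ n) 0, norm_zero]
    exact pow_nonneg ((norm_nonneg a).trans ha) n
  · exact (norm_pow_le a n).trans (pow_le_pow_left₀ (norm_nonneg a) ha n)

lemma abs_le_norm_of_mem_spectrum {a : M} {x : ℝ} (hx : x ∈ spectrum ℝ a) : |x| ≤ ‖a‖ := by
  rcases subsingleton_or_nontrivial M with h | h
  · exact absurd hx (by simp [spectrum.of_subsingleton])
  · exact spectrum.norm_le_norm_of_mem hx

/-- The value of a functional `τ` at the power series `∑ aⁿ / n` of `- log (1 - a)`. -/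
def logSeries (τ : M →L[ℂ] ℂ) (a : M) : ℂ := ∑' n : ℕ, τ (a ^ (n + 1)) / (n + 1)

lemma summable_logSeries (τ : M →L[ℂ] ℂ) {a : M} (ha : ‖a‖ < 1) :
    Summable fun n : ℕ => τ (a ^ (n + 1)) / (n + 1) := by
  refine Summable.of_norm_bounded (g := fun n : ℕ => ‖τ‖ * ‖a‖ ^ (n + 1))
    (((summable_nat_add_iff 1).2
      (summable_geometric_of_lt_one (norm_nonneg _) ha)).mul_left _) fun n => ?_
  have hone : 1 ≤ ‖(n : ℂ) + 1‖ := by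
    rw [← Nat.cast_add_one, Complex.norm_natCast]
    exact_mod_cast n.succ_pos
  rw [norm_div]
  refine (div_le_self (norm_nonneg _) hone).trans ((τ.le_opNorm _).trans ?_)
  gcongr
  exact norm_pow_le_of_norm_le le_rfl _

/-- Only under a trace: the factors `k s ^ i * k' * k s ^ (n - i)` of the derivative all have the
same trace, whatever `k s ^ m` multiplies them. -/
lemma exists_hasDerivAt_pow {τ : M →L[ℂ] ℂ} (hτ : ∀ a b, τ (a * b) = τ (b * a)) {k : ℝ → M}
    {k' : M} {s : ℝ} (hk : HasDerivAt k k' s) (n : ℕ) :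
    ∃ D : M, HasDerivAt (fun s => k s ^ (n + 1)) D s ∧
      ∀ m : ℕ, τ (k s ^ m * D) = (n + 1) * τ (k s ^ (m + n) * k') := by
  induction n with
  | zero => exact ⟨k', by simpa using hk, fun m => by simp⟩
  | succ n ih =>
    obtain ⟨D, hD, hDτ⟩ := ih
    refine ⟨D * k s + k s ^ (n + 1) * k', ?_, fun m => ?_⟩
    · simp_rw [pow_succ _ (n + 1)]
      exact hD.mul hk
    · rw [mul_add, map_add, ← mul_assoc, hτ, ← mul_assoc, ← pow_succ', hDτ, ← mul_assoc, ← pow_add,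
        show m + 1 + n = m + (n + 1) by ring]
      push_cast
      ring

lemma hasDerivAt_apply_pow_div {τ : M →L[ℂ] ℂ} (hτ : ∀ a b, τ (a * b) = τ (b * a)) {k : ℝ → M}
    {k' : M} {s : ℝ} (hk : HasDerivAt k k' s) (n : ℕ) :
    HasDerivAt (fun s => τ (k s ^ (n + 1)) / (n + 1)) (τ (k s ^ n * k')) s := by
  obtain ⟨D, hD, hDτ⟩ := exists_hasDerivAt_pow hτ hk n
  have hderiv : τ D / ((n : ℂ) + 1) = τ (k s ^ n * k') := by
    have h := hDτ 0
    rw [pow_zero, one_mul, zero_add] at h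
    rw [h, mul_div_cancel_left₀ _ (Nat.cast_add_one_ne_zero n)]
  rw [← hderiv]
  exact ((τ.restrictScalars ℝ).hasFDerivAt.comp_hasDerivAt s hD).div_const ((n : ℂ) + 1)

lemma hasDerivAt_logSeries {τ : M →L[ℂ] ℂ} (hτ : ∀ a b, τ (a * b) = τ (b * a)) {k k' : ℝ → M}
    {s : ℝ} (hk : ∀ᶠ x in 𝓝 s, HasDerivAt k (k' x) x) (hk' : ContinuousAt k' s) (hs : ‖k s‖ < 1)
    {w : M} (hw : (1 - k s) * w = 1) :
    HasDerivAt (fun s => logSeries τ (k s)) (τ (k' s * w)) s := by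
  obtain ⟨r, hsr, hr1⟩ := exists_between hs
  have hr0 : 0 ≤ r := (norm_nonneg _).trans hsr.le
  have hnear : ∀ᶠ x in 𝓝 s, HasDerivAt k (k' x) x ∧ ‖k x‖ < r ∧ ‖k' x‖ < ‖k' s‖ + 1 :=
    hk.and ((hk.self_of_nhds.continuousAt.norm.eventually_lt continuousAt_const hsr).and
      (hk'.norm.eventually_lt continuousAt_const (lt_add_one _)))
  obtain ⟨δ, hδ, hball⟩ := Metric.eventually_nhds_iff_ball.1 hnear
  have hmem : s ∈ Metric.ball s δ := Metric.mem_ball_self hδ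
  have hderiv : HasDerivAt (fun s => logSeries τ (k s)) (∑' n : ℕ, τ (k s ^ n * k' s)) s := by
    refine hasDerivAt_tsum_of_isPreconnected (u := fun n => ‖τ‖ * (r ^ n * (‖k' s‖ + 1)))
      (((summable_geometric_of_lt_one hr0 hr1).mul_right _).mul_left _) Metric.isOpen_ball
      (convex_ball s δ).isPreconnected
      (fun n y hy => hasDerivAt_apply_pow_div hτ (hball y hy).1 n) (fun n y hy => ?_)
      hmem (summable_logSeries τ hs) hmem
    refine (τ.le_opNorm _).trans (mul_le_mul_of_nonneg_left ?_ (norm_nonneg _))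
    obtain ⟨-, hky, hky'⟩ := hball y hy
    exact (norm_mul_le _ _).trans (mul_le_mul (norm_pow_le_of_norm_le hky.le n) hky'.le
      (norm_nonneg _) (pow_nonneg hr0 n))
  have hgeom : HasSum (fun n : ℕ => k s ^ n) w := by
    have h := (summable_geometric_of_norm_lt_one hs).hasSum
    rwa [← mul_one (∑' i : ℕ, k s ^ i), ← hw, ← mul_assoc, geom_series_mul_neg _ hs, one_mul] at h
  rwa [((hgeom.mul_right (k' s)).mapL τ).tsum_eq, hτ] at hderiv

lemma cfc_log_one_sub {k : M} (hsa : IsSelfAdjoint k) (hk : ‖k‖ < 1) :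
    CFC.log (1 - k) = cfc (fun x : ℝ => Real.log (1 - x)) k := by
  have hsub : (1 : M) - k = cfc (fun x : ℝ => 1 - x) k := by
    rw [cfc_sub (fun _ : ℝ => (1 : ℝ)) (fun x : ℝ => x) k, cfc_const_one ℝ k, cfc_id' ℝ k]
  have hcont : ContinuousOn Real.log ((fun x : ℝ => 1 - x) '' spectrum ℝ k) := by
    rintro y ⟨x, hx, rfl⟩
    have hx1 := (abs_lt.1 ((abs_le_norm_of_mem_spectrum hx).trans_lt hk)).2
    exact (Real.continuousAt_log (sub_pos.2 hx1).ne').continuousWithinAt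
  rw [CFC.log, hsub, ← cfc_comp' Real.log (fun x : ℝ => 1 - x) k hcont]

lemma tendsto_sum_pow_div_log {k : M} (hsa : IsSelfAdjoint k) (hk : ‖k‖ < 1) :
    Tendsto (fun n : ℕ => ∑ i ∈ Finset.range n, ((i : ℝ) + 1)⁻¹ • k ^ (i + 1)) atTop
      (𝓝 (- CFC.log (1 - k))) := by
  have hpartial : ∀ n : ℕ, ∑ i ∈ Finset.range n, ((i : ℝ) + 1)⁻¹ • k ^ (i + 1) =
      cfc (fun x : ℝ => ∑ i ∈ Finset.range n, ((i : ℝ) + 1)⁻¹ * x ^ (i + 1)) k := by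
    intro n
    rw [← Finset.sum_fn, cfc_sum _ _ _ (fun i _ => by fun_prop)]
    refine Finset.sum_congr rfl fun i _ => ?_
    rw [cfc_const_mul _ _ _ (by fun_prop), cfc_pow_id k (i + 1)]
  simp_rw [hpartial]
  rw [cfc_log_one_sub hsa hk, ← cfc_neg]
  refine tendsto_cfc_fun ?_ (Eventually.of_forall fun n => by fun_prop)
  rw [Metric.tendstoUniformlyOn_iff]
  intro ε hε
  have htail : Tendsto (fun n : ℕ => ‖k‖ ^ (n + 1) / (1 - ‖k‖)) atTop (𝓝 0) := by
    simpa using ((tendsto_pow_atTop_nhds_zero_of_lt_one (norm_nonneg k) hk).comp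
      (tendsto_add_atTop_nat 1)).div_const (1 - ‖k‖)
  filter_upwards [htail.eventually_lt_const hε] with n hn x hx
  have hxk := abs_le_norm_of_mem_spectrum hx
  have htaylor := Real.abs_log_sub_add_sum_range_le (hxk.trans_lt hk) n
  simp only [div_eq_inv_mul _ ((_ : ℝ) + 1)] at htaylor
  rw [dist_comm, Real.dist_eq, sub_neg_eq_add]
  refine (htaylor.trans ?_).trans_lt hn
  exact div_le_div₀ (by positivity) (pow_le_pow_left₀ (abs_nonneg x) hxk _) (by linarith)
    (by linarith)

lemma logSeries_eq_neg_apply_log (τ : M →L[ℂ] ℂ) {k : M} (hsa : IsSelfAdjoint k) (hk : ‖k‖ < 1) :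
    logSeries τ k = - τ (CFC.log (1 - k)) := by
  have h := (τ.continuous.tendsto _).comp (tendsto_sum_pow_div_log hsa hk)
  rw [map_neg] at h
  refine tendsto_nhds_unique (summable_logSeries τ hk).hasSum.tendsto_sum_nat (h.congr fun n => ?_)
  rw [Function.comp_apply, map_sum]
  refine Finset.sum_congr rfl fun i _ => ?_
  rw [← Complex.coe_smul, map_smul, smul_eq_mul, div_eq_inv_mul]
  push_cast
  rfl

variable [PartialOrder M] [StarOrderedRing M]

lemma norm_one_sub_smul_lt_one {a : M} (ha : IsStrictlyPositive a) {C : ℝ} (hC : ‖a‖ ≤ C)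
    (hC0 : 0 < C) : ‖1 - C⁻¹ • a‖ < 1 := by
  have hsa : IsSelfAdjoint a := ha.isSelfAdjoint
  have h : (1 : M) - C⁻¹ • a = cfc (fun x : ℝ => 1 - C⁻¹ * x) a := by
    rw [cfc_sub (fun _ : ℝ => (1 : ℝ)) (fun x : ℝ => C⁻¹ * x) a, cfc_const_one ℝ a,
      cfc_const_mul_id C⁻¹ a]
  rw [h]
  refine norm_cfc_lt zero_lt_one fun x hx => ?_
  have hx0 : 0 < C⁻¹ * x := mul_pos (inv_pos.2 hC0) (ha.spectrum_pos hx)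
  have hx1 : C⁻¹ * x ≤ 1 := by
    rw [inv_mul_le_iff₀ hC0, mul_one]
    exact (le_abs_self x).trans ((abs_le_norm_of_mem_spectrum hx).trans hC)
  rw [Real.norm_eq_abs, abs_lt]
  constructor <;> linarith

lemma apply_log_eq_sub_logSeries (τ : M →L[ℂ] ℂ) {a : M} (ha : IsStrictlyPositive a) {C : ℝ}
    (hC : ‖a‖ ≤ C) (hC0 : 0 < C) :
    τ (CFC.log a) = τ (algebraMap ℝ M (Real.log C)) - logSeries τ (1 - C⁻¹ • a) := by
  have hsa : IsSelfAdjoint (1 - C⁻¹ • a) :=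
    (IsSelfAdjoint.one M).sub (IsSelfAdjoint.smul (IsSelfAdjoint.all _) ha.isSelfAdjoint)
  rw [logSeries_eq_neg_apply_log τ hsa (norm_one_sub_smul_lt_one ha hC hC0), sub_sub_cancel,
    sub_neg_eq_add, ← map_add, ← CFC.log_smul' _ hC0 (ha.smul (inv_pos.2 hC0)),
    smul_inv_smul₀ hC0.ne']

lemma hasDerivAt_apply_log {τ : M →L[ℂ] ℂ} (hτ : ∀ a b, τ (a * b) = τ (b * a)) {a a' : ℝ → M}
    {s : ℝ} (hpos : ∀ᶠ x in 𝓝 s, IsStrictlyPositive (a x))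
    (ha : ∀ᶠ x in 𝓝 s, HasDerivAt a (a' x) x) (ha' : ContinuousAt a' s) {b : M}
    (hb : a s * b = 1) : HasDerivAt (fun x => τ (CFC.log (a x))) (τ (a' s * b)) s := by
  set C : ℝ := ‖a s‖ + 1
  have hC0 : 0 < C := by positivity
  have hC : ∀ᶠ x in 𝓝 s, ‖a x‖ < C :=
    ha.self_of_nhds.continuousAt.norm.eventually_lt continuousAt_const (lt_add_one _)
  have hk : ∀ᶠ x in 𝓝 s, HasDerivAt (fun x => 1 - C⁻¹ • a x) (-(C⁻¹ • a' x)) x :=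
    ha.mono fun x hx => (hx.const_smul C⁻¹).const_sub 1
  have hw : (1 - (1 - C⁻¹ • a s)) * (C • b) = 1 := by
    rw [sub_sub_cancel, smul_mul_smul_comm, inv_mul_cancel₀ hC0.ne', one_smul, hb]
  have hseries := (hasDerivAt_logSeries hτ hk (ha'.const_smul C⁻¹).neg (norm_one_sub_smul_lt_one
    hpos.self_of_nhds hC.self_of_nhds.le hC0) hw).const_sub (τ (algebraMap ℝ M (Real.log C)))
  rw [neg_mul, map_neg, neg_neg, smul_mul_smul_comm, inv_mul_cancel₀ hC0.ne', one_smul] at hseries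
  refine hseries.congr_of_eventuallyEq ?_
  filter_upwards [hpos, hC] with x hx hxC
  exact apply_log_eq_sub_logSeries τ hx hxC.le hC0

end LogSeries

section TraceLog

open Filter Topology

variable {M : Type*} [CStarAlgebra M]

lemma apply_mul_geometric_eq_zero {τ : M →L[ℂ] ℂ} {u : M} (hu : ∀ n : ℕ, τ (u ^ (n + 1)) = 0)
    {q : ℝ} (hq : ‖q • u‖ < 1) : τ (u * ∑' n : ℕ, (q • u) ^ n) = 0 := by
  have hterm : ∀ n : ℕ, τ (u * (q • u) ^ n) = 0 := by
    intro n
    rw [smul_pow, mul_smul_comm, ← pow_succ', ← Complex.coe_smul, map_smul, hu, smul_zero]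
  refine (((summable_geometric_of_norm_lt_one hq).hasSum.mul_left u).mapL τ).unique ?_
  simpa only [hterm] using hasSum_zero

/-- The regularization `τ (log (a⋆ a + δ))` of twice the logarithm of the Fuglede–Kadison
determinant of `a`, which it approaches as `δ` decreases to `0`. -/
def regLogDet (τ : M →L[ℂ] ℂ) (δ : ℝ) (a : M) : ℝ :=
  (τ (CFC.log (star a * a + algebraMap ℝ M δ))).re

variable [PartialOrder M] [StarOrderedRing M]

lemma isStrictlyPositive_star_mul_self_add (B : M) {δ : ℝ} (hδ : 0 < δ) :
    IsStrictlyPositive (star B * B + algebraMap ℝ M δ) :=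
  (isStrictlyPositive_algebraMap hδ).nonneg_add (star_mul_self_nonneg B)

lemma isStrictlyPositive_star_mul_self_of_isUnit {Y : M} (hY : IsUnit Y) :
    IsStrictlyPositive (star Y * Y) := by
  simpa using (hY.isStrictlyPositive_star_left_conjugate_iff (a := (1 : M))).2
    isStrictlyPositive_one

lemma apply_log_star_mul_mul {τ : M →L[ℂ] ℂ} (hτ : ∀ a b, τ (a * b) = τ (b * a)) (Y : Mˣ) {a : M}
    (ha : IsStrictlyPositive a) :
    τ (CFC.log (star (Y : M) * a * Y)) = τ (CFC.log (star (Y : M) * Y)) + τ (CFC.log a) := by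
  let : NormedAlgebra ℚ M := NormedAlgebra.restrictScalars ℚ ℝ M
  set h : M := CFC.log a
  have hsa (s : ℝ) : IsSelfAdjoint (s • h) := IsSelfAdjoint.smul (.all _) .log
  have hexp (s : ℝ) : NormedSpace.exp (s • h) * NormedSpace.exp (-(s • h)) = 1 := by
    rw [← NormedSpace.exp_add_of_commute (Commute.refl _).neg_right, add_neg_cancel,
      NormedSpace.exp_zero]
  have hexp_pos (s : ℝ) : IsStrictlyPositive (NormedSpace.exp (s • h)) :=
    IsUnit.isStrictlyPositive (NormedSpace.isUnit_exp _) (hsa s).exp_nonneg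
  let p : ℝ → M := fun s => star (Y : M) * NormedSpace.exp (s • h) * Y
  have hp (s : ℝ) : HasDerivAt p (star (Y : M) * (h * NormedSpace.exp (s • h)) * Y) s :=
    ((hasDerivAt_exp_smul_const' h s).const_mul _).mul_const _
  have hderiv (s : ℝ) : HasDerivAt (fun s => τ (CFC.log (p s)) - s • τ h) 0 s := by
    have hinv : p s * (↑Y⁻¹ * NormedSpace.exp (-(s • h)) * star (↑Y⁻¹ : M)) = 1 := by
      calc p s * (↑Y⁻¹ * NormedSpace.exp (-(s • h)) * star (↑Y⁻¹ : M))
          = star (Y : M) * (NormedSpace.exp (s • h) * (Y * ↑Y⁻¹) * NormedSpace.exp (-(s • h))) *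
              star (↑Y⁻¹ : M) := by simp only [p, mul_assoc]
        _ = 1 := by rw [Units.mul_inv, mul_one, hexp, mul_one, ← star_mul, Units.inv_mul, star_one]
    have hcont : Continuous fun s : ℝ => star (Y : M) * (h * NormedSpace.exp (s • h)) * Y := by
      have := NormedSpace.exp_continuous (𝔸 := M)
      fun_prop
    have htrace : τ (star (Y : M) * (h * NormedSpace.exp (s • h)) * Y *
        (↑Y⁻¹ * NormedSpace.exp (-(s • h)) * star (↑Y⁻¹ : M))) = τ h := by
      calc _ = τ (star (Y : M) * (h * (NormedSpace.exp (s • h) * (Y * ↑Y⁻¹) *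
              NormedSpace.exp (-(s • h))) * star (↑Y⁻¹ : M))) := by simp only [mul_assoc]
        _ = τ h := by
            rw [Units.mul_inv, mul_one, hexp, mul_one, hτ, mul_assoc, ← star_mul, Units.mul_inv,
              star_one, mul_one]
    have := (hasDerivAt_apply_log hτ (.of_forall fun x =>
      (Y.isUnit.isStrictlyPositive_star_left_conjugate_iff).2 (hexp_pos x)) (.of_forall hp)
      hcont.continuousAt hinv).sub ((hasDerivAt_id s).smul_const (τ h))
    rwa [htrace, one_smul, sub_self] at this
  have hconst := is_const_of_deriv_eq_zero (fun s => (hderiv s).differentiableAt)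
    (fun s => (hderiv s).deriv) 1 0
  simp only [p, one_smul, zero_smul, NormedSpace.exp_zero, mul_one, sub_zero] at hconst
  rw [← sub_eq_iff_eq_add, ← hconst, CFC.exp_log a]

lemma apply_log_star_mul_self_add {τ : M →L[ℂ] ℂ} (hτ : ∀ a b, τ (a * b) = τ (b * a)) (B : M)
    {δ : ℝ} (hδ : 0 < δ) :
    τ (CFC.log (star B * B + algebraMap ℝ M δ)) = τ (CFC.log (B * star B + algebraMap ℝ M δ)) := by
  let P : M → ℝ → M := fun a s => s ^ 2 • (star a * a) + algebraMap ℝ M δ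
  have hpos (a : M) (s : ℝ) : IsStrictlyPositive (P a s) :=
    (isStrictlyPositive_algebraMap hδ).nonneg_add
      (smul_nonneg (sq_nonneg s) (star_mul_self_nonneg a))
  have hP (a : M) (s : ℝ) : HasDerivAt (P a) ((2 * s) • (star a * a)) s := by
    simpa only [Nat.cast_ofNat, pow_one, Nat.add_one_sub_one] using
      ((hasDerivAt_pow 2 s).smul_const (star a * a)).add_const (algebraMap ℝ M δ)
  have hlog (a : M) (s : ℝ) := hasDerivAt_apply_log hτ (.of_forall (hpos a)) (.of_forall (hP a))
    (by fun_prop : Continuous fun s : ℝ => (2 * s) • (star a * a)).continuousAt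
    (Ring.mul_inverse_cancel (P a s) (hpos a s).isUnit)
  have hderiv (s : ℝ) :
      HasDerivAt (fun s => τ (CFC.log (P B s)) - τ (CFC.log (P (star B) s))) 0 s := by
    have hcomm : B * P B s = P (star B) s * B := by
      simp only [P, mul_add, add_mul, mul_smul_comm, smul_mul_assoc, star_star, mul_assoc,
        Algebra.commutes]
    have hinv : B * Ring.inverse (P B s) = Ring.inverse (P (star B) s) * B := by
      calc B * Ring.inverse (P B s)
          = Ring.inverse (P (star B) s) * P (star B) s * B * Ring.inverse (P B s) := by
            rw [Ring.inverse_mul_cancel _ (hpos (star B) s).isUnit, one_mul]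
        _ = Ring.inverse (P (star B) s) * B := by
            rw [mul_assoc _ _ B, ← hcomm, mul_assoc, mul_assoc,
              Ring.mul_inverse_cancel _ (hpos B s).isUnit, mul_one]
    have htrace : τ ((2 * s) • (star B * B) * Ring.inverse (P B s)) =
        τ ((2 * s) • (star (star B) * star B) * Ring.inverse (P (star B) s)) := by
      rw [smul_mul_assoc, smul_mul_assoc, star_star, mul_assoc, hinv, ← mul_assoc, mul_assoc B,
        ← Complex.coe_smul, ← Complex.coe_smul, map_smul, map_smul, hτ _ B]
    have := (hlog B s).sub (hlog (star B) s)
    rwa [htrace, sub_self] at this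
  have hconst := is_const_of_deriv_eq_zero (fun s => (hderiv s).differentiableAt)
    (fun s => (hderiv s).deriv) 1 0
  simpa [P, sub_eq_zero] using hconst

lemma apply_log_mul_star {τ : M →L[ℂ] ℂ} (hτ : ∀ a b, τ (a * b) = τ (b * a)) (Y : Mˣ) :
    τ (CFC.log ((Y : M) * star (Y : M))) = τ (CFC.log (star (Y : M) * Y)) := by
  have hpos := isStrictlyPositive_star_mul_self_of_isUnit Y.isUnit
  have hpos' := isStrictlyPositive_star_mul_self_of_isUnit (star Y).isUnit
  have h := apply_log_star_mul_mul hτ (star Y) hpos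
  simp only [Units.coe_star, star_star] at h hpos'
  have hsq : (Y : M) * (star (Y : M) * Y) * star (Y : M) = ((Y : M) * star (Y : M)) ^ 2 := by
    simp only [pow_two, mul_assoc]
  rw [hsq, CFC.log_pow' 2 _ hpos', map_nsmul, two_nsmul] at h
  exact add_left_cancel h

lemma apply_log_inv {τ : M →L[ℂ] ℂ} (hτ : ∀ a b, τ (a * b) = τ (b * a)) (Y : Mˣ) :
    τ (CFC.log (star (↑Y⁻¹ : M) * ↑Y⁻¹)) = - τ (CFC.log (star (Y : M) * Y)) := by
  have h := apply_log_star_mul_mul hτ Y⁻¹ (isStrictlyPositive_star_mul_self_of_isUnit Y.isUnit)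
  have hone : star (↑Y⁻¹ : M) * (star (Y : M) * Y) * ↑Y⁻¹ = 1 := by
    rw [mul_assoc, mul_assoc, Units.mul_inv, mul_one, ← star_mul, Units.mul_inv, star_one]
  rw [hone, CFC.log_one, map_zero] at h
  exact eq_neg_of_add_eq_zero_left h.symm

lemma re_apply_log_le {τ : M →L[ℂ] ℂ} (hpos : ∀ a : M, 0 ≤ (τ (star a * a)).re) {a b : M}
    (ha : IsStrictlyPositive a) (hab : a ≤ b) : (τ (CFC.log a)).re ≤ (τ (CFC.log b)).re := by
  obtain ⟨c, hc⟩ := CStarAlgebra.nonneg_iff_eq_star_mul_self.1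
    (sub_nonneg.2 (CFC.log_le_log hab ha))
  have h := hpos c
  rw [← hc, map_sub, Complex.sub_re] at h
  exact sub_nonneg.1 h

lemma regLogDet_star {τ : M →L[ℂ] ℂ} (hτ : ∀ a b, τ (a * b) = τ (b * a)) {δ : ℝ} (hδ : 0 < δ)
    (a : M) : regLogDet τ δ (star a) = regLogDet τ δ a := by
  rw [regLogDet, regLogDet, star_star, apply_log_star_mul_self_add hτ a hδ]

lemma exists_regLogDet_mul_le {τ : M →L[ℂ] ℂ} (hτ : ∀ a b, τ (a * b) = τ (b * a))
    (hpos : ∀ a : M, 0 ≤ (τ (star a * a)).re) (Y : Mˣ) :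
    ∃ c : ℝ, 0 < c ∧ ∀ (A : M) (δ : ℝ), 0 < δ →
      regLogDet τ δ (A * Y) ≤ (τ (CFC.log (star (Y : M) * Y))).re + regLogDet τ (c * δ) A := by
  set c : ℝ := ‖(↑Y⁻¹ : M)‖ ^ 2 + 1
  have hc : 0 < c := by positivity
  have hone : (1 : M) ≤ c • (star (Y : M) * Y) := by
    have hinv : star (↑Y⁻¹ : M) * ↑Y⁻¹ ≤ algebraMap ℝ M c :=
      CStarAlgebra.star_mul_le_algebraMap_norm_sq.trans (algebraMap_mono M (by simp [c]))
    have h := star_left_conjugate_le_conjugate hinv (Y : M)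
    rwa [← mul_assoc, ← star_mul, Units.inv_mul, star_one, one_mul, Units.inv_mul,
      Algebra.algebraMap_eq_smul_one, mul_smul_comm, mul_one, smul_mul_assoc] at h
  refine ⟨c, hc, fun A δ hδ => ?_⟩
  rw [regLogDet, regLogDet, ← Complex.add_re, ← apply_log_star_mul_mul hτ Y
    (isStrictlyPositive_star_mul_self_add A (mul_pos hc hδ))]
  refine re_apply_log_le hpos (isStrictlyPositive_star_mul_self_add _ hδ) ?_
  calc star (A * Y) * (A * Y) + algebraMap ℝ M δ
      = star (Y : M) * (star A * A) * Y + δ • 1 := by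
        rw [star_mul, Algebra.algebraMap_eq_smul_one]
        simp only [mul_assoc]
    _ ≤ star (Y : M) * (star A * A) * Y + δ • c • (star (Y : M) * Y) := by gcongr
    _ = star (Y : M) * (star A * A + algebraMap ℝ M (c * δ)) * Y := by
        rw [mul_add, add_mul, Algebra.algebraMap_eq_smul_one, mul_smul_comm, mul_one,
          smul_mul_assoc, smul_smul, mul_comm c]

lemma exists_regLogDet_conj_le {τ : M →L[ℂ] ℂ} (hτ : ∀ a b, τ (a * b) = τ (b * a))
    (hpos : ∀ a : M, 0 ≤ (τ (star a * a)).re) (S : Mˣ) :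
    ∃ c : ℝ, 0 < c ∧ ∀ (W : M) (δ : ℝ), 0 < δ →
      regLogDet τ δ (S * W * ↑S⁻¹) ≤ regLogDet τ (c * δ) W := by
  obtain ⟨c₁, hc₁, h₁⟩ := exists_regLogDet_mul_le hτ hpos S⁻¹
  obtain ⟨c₂, hc₂, h₂⟩ := exists_regLogDet_mul_le hτ hpos (star S)
  refine ⟨c₂ * c₁, mul_pos hc₂ hc₁, fun W δ hδ => ?_⟩
  have hδ₁ := mul_pos hc₁ hδ
  have hstar := h₂ (star W) (c₁ * δ) hδ₁
  rw [Units.coe_star, ← star_mul, regLogDet_star hτ hδ₁, star_star, apply_log_mul_star hτ,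
    regLogDet_star hτ (mul_pos hc₂ hδ₁), ← mul_assoc] at hstar
  have hright := h₁ (S * W) δ hδ
  rw [apply_log_inv hτ, Complex.neg_re] at hright
  linarith

lemma norm_smul_lt_one_of_mem_Ioo {E : Type*} [SeminormedAddCommGroup E] [NormedSpace ℝ E] {v : E}
    (hv : ‖v‖ ≤ 1) {s : ℝ} (hs : s ∈ Set.Ioo (-1) 1) : ‖s • v‖ < 1 := by
  rw [norm_smul, Real.norm_eq_abs]
  exact (mul_le_of_le_one_right (abs_nonneg s) hv).trans_lt (abs_lt.2 hs)

lemma hasDerivAt_apply_log_one_sub_smul {τ : M →L[ℂ] ℂ} (hτ : ∀ a b, τ (a * b) = τ (b * a))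
    {u : M} (hu : ‖u‖ ≤ 1) (hτu : ∀ n : ℕ, τ (u ^ (n + 1)) = 0)
    (hτu' : ∀ n : ℕ, τ (star u ^ (n + 1)) = 0) {s : ℝ} (hs : s ∈ Set.Ioo (-1) 1) :
    HasDerivAt (fun s : ℝ => τ (CFC.log (star (1 - s • u) * (1 - s • u)))) 0 s := by
  have hu' : ‖star u‖ ≤ 1 := (norm_star u).trans_le hu
  have hstar (s : ℝ) : star (1 - s • u) = 1 - s • star u := by
    rw [star_sub, star_one, star_smul, star_trivial]
  simp only [hstar]
  let X' : ℝ → M := fun s => -star u * (1 - s • u) + (1 - s • star u) * -u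
  have hX' : Continuous X' := by fun_prop
  have hlin (v : M) (s : ℝ) : HasDerivAt (fun s : ℝ => 1 - s • v) (-v) s := by
    simpa using ((hasDerivAt_id s).smul_const v).const_sub 1
  have hpos : ∀ s ∈ Set.Ioo (-1 : ℝ) 1, IsStrictlyPositive ((1 - s • star u) * (1 - s • u)) := by
    intro s hs
    have h := isStrictlyPositive_star_mul_self_of_isUnit
      (isUnit_one_sub_of_norm_lt_one (norm_smul_lt_one_of_mem_Ioo hu hs))
    rwa [hstar] at h
  have hnorm := norm_smul_lt_one_of_mem_Ioo hu hs
  have hnorm' := norm_smul_lt_one_of_mem_Ioo hu' hs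
  set v : M := ∑' n : ℕ, (s • u) ^ n
  set w : M := ∑' n : ℕ, (s • star u) ^ n
  have hav : (1 - s • u) * v = 1 := mul_neg_geom_series _ hnorm
  have hbw : (1 - s • star u) * w = 1 := mul_neg_geom_series _ hnorm'
  have hwb : w * (1 - s • star u) = 1 := geom_series_mul_neg _ hnorm'
  have hinv : (1 - s • star u) * (1 - s • u) * (v * w) = 1 := by
    rw [mul_assoc, ← mul_assoc _ v, hav, one_mul, hbw]
  have h := hasDerivAt_apply_log hτ (eventually_of_mem (isOpen_Ioo.mem_nhds hs) hpos)
    (.of_forall fun x => (hlin (star u) x).mul (hlin u x)) hX'.continuousAt hinv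
  have hzero : τ (X' s * (v * w)) = 0 := by
    have hexpand : X' s * (v * w) =
        -(star u * ((1 - s • u) * v) * w) - (1 - s • star u) * (u * v * w) := by
      simp only [X', add_mul, neg_mul, mul_neg, mul_assoc, sub_eq_add_neg]
    rw [hexpand, hav, mul_one, map_sub, map_neg, hτ (1 - s • star u), mul_assoc, hwb, mul_one,
      apply_mul_geometric_eq_zero hτu' hnorm', apply_mul_geometric_eq_zero hτu hnorm, neg_zero,
      sub_zero]
  rwa [hzero] at h

lemma apply_log_one_sub_smul {τ : M →L[ℂ] ℂ} (hτ : ∀ a b, τ (a * b) = τ (b * a)) {u : M}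
    (hu : ‖u‖ ≤ 1) (hτu : ∀ n : ℕ, τ (u ^ (n + 1)) = 0)
    (hτu' : ∀ n : ℕ, τ (star u ^ (n + 1)) = 0) {q : ℝ} (hq : q ∈ Set.Ioo (-1) 1) :
    τ (CFC.log (star (1 - q • u) * (1 - q • u))) = 0 := by
  have hderiv {s : ℝ} (hs : s ∈ Set.Ioo (-1) 1) :=
    hasDerivAt_apply_log_one_sub_smul hτ hu hτu hτu' hs
  have hconst := isOpen_Ioo.is_const_of_deriv_eq_zero isPreconnected_Ioo
    (fun s hs => (hderiv hs).differentiableAt.differentiableWithinAt)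
    (fun s hs => (hderiv hs).deriv) hq (show (0 : ℝ) ∈ Set.Ioo (-1) 1 by norm_num)
  simpa using hconst

omit [PartialOrder M] [StarOrderedRing M] in
lemma star_one_sub_smul_mul_self {u : M} (hu : u ∈ unitary M) (s : ℝ) :
    star (1 - s • u) * (1 - s • u) = (1 + s ^ 2) • (1 : M) - s • (u + star u) := by
  rw [star_sub, star_one, star_smul, star_trivial, sub_mul, mul_sub, mul_sub, mul_one, one_mul,
    mul_one, smul_mul_smul_comm, Unitary.star_mul_self_of_mem hu, add_smul, one_smul, smul_add,
    pow_two]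
  abel

omit [PartialOrder M] [StarOrderedRing M] in
lemma star_one_sub_mul_self_add_sinh_sq {u : M} (hu : u ∈ unitary M) (y : ℝ) :
    star (1 - u) * (1 - u) + algebraMap ℝ M ((2 * Real.sinh y) ^ 2) =
      Real.exp (2 * y) •
        (star (1 - Real.exp (-(2 * y)) • u) * (1 - Real.exp (-(2 * y)) • u)) := by
  set q : ℝ := Real.exp (-(2 * y))
  have hexp : Real.exp (2 * y) * q = 1 := by rw [← Real.exp_add, add_neg_cancel, Real.exp_zero]
  have hcosh : Real.exp (2 * y) + q = 2 + (2 * Real.sinh y) ^ 2 := by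
    have := Real.cosh_eq (2 * y)
    have := Real.cosh_two_mul y
    have := Real.cosh_sq y
    linarith
  have hscal : Real.exp (2 * y) * (1 + q ^ 2) = 2 + (2 * Real.sinh y) ^ 2 := by
    linear_combination hcosh + q * hexp
  have h := star_one_sub_smul_mul_self hu 1
  rw [one_smul, one_smul] at h
  rw [h, star_one_sub_smul_mul_self hu, smul_sub, smul_smul, smul_smul, hexp, one_smul, hscal,
    Algebra.algebraMap_eq_smul_one, one_pow, one_add_one_eq_two, add_smul]
  abel

lemma regLogDet_one_sub {τ : M →L[ℂ] ℂ} (hτ : ∀ a b, τ (a * b) = τ (b * a)) (hτ1 : τ 1 = 1)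
    {u : M} (hu : u ∈ unitary M) (hτu : ∀ n : ℕ, τ (u ^ (n + 1)) = 0)
    (hτu' : ∀ n : ℕ, τ (star u ^ (n + 1)) = 0) {y : ℝ} (hy : 0 < y) :
    regLogDet τ ((2 * Real.sinh y) ^ 2) (1 - u) = 2 * y := by
  have hq : Real.exp (-(2 * y)) ∈ Set.Ioo (-1) 1 :=
    ⟨by linarith [Real.exp_pos (-(2 * y))], Real.exp_lt_one_iff.2 (by linarith)⟩
  have hnorm : ‖u‖ ≤ 1 := by
    rcases subsingleton_or_nontrivial M with _ | _
    · simp [Subsingleton.elim u 0]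
    · exact (CStarRing.norm_of_mem_unitary hu).le
  have hpos := isStrictlyPositive_star_mul_self_of_isUnit
    (isUnit_one_sub_of_norm_lt_one (norm_smul_lt_one_of_mem_Ioo hnorm hq))
  rw [regLogDet, star_one_sub_mul_self_add_sinh_sq hu, CFC.log_smul' _ (Real.exp_pos _) hpos,
    map_add, apply_log_one_sub_smul hτ hnorm hτu hτu' hq, add_zero,
    Algebra.algebraMap_eq_smul_one, ← Complex.coe_smul, map_smul, hτ1, smul_eq_mul, mul_one,
    Complex.ofReal_re, Real.log_exp]

lemma exists_le_regLogDet_conj {τ : M →L[ℂ] ℂ} (hτ : ∀ a b, τ (a * b) = τ (b * a))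
    (hpos : ∀ a : M, 0 ≤ (τ (star a * a)).re) (S : Mˣ) :
    ∃ c : ℝ, 0 < c ∧ ∀ (W : M) (δ : ℝ), 0 < δ →
      regLogDet τ (c * δ) W ≤ regLogDet τ δ (S * W * ↑S⁻¹) := by
  obtain ⟨c, hc, h⟩ := exists_regLogDet_conj_le hτ hpos S⁻¹
  refine ⟨c⁻¹, inv_pos.2 hc, fun W δ hδ => ?_⟩
  have h' := h (S * W * ↑S⁻¹) (c⁻¹ * δ) (mul_pos (inv_pos.2 hc) hδ)
  rwa [mul_inv_cancel_left₀ hc.ne', inv_inv, mul_assoc, mul_assoc, mul_assoc, Units.inv_mul,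
    mul_one, Units.inv_mul_cancel_left] at h'

omit [PartialOrder M] [StarOrderedRing M] in
theorem tendsto_regLogDet_conj_one_sub {τ : M →L[ℂ] ℂ} (hτ : ∀ a b, τ (a * b) = τ (b * a))
    (hτ1 : τ 1 = 1) (hpos : ∀ a : M, 0 ≤ (τ (star a * a)).re) {u : M} (hu : u ∈ unitary M)
    (hτu : ∀ n : ℕ, τ (u ^ (n + 1)) = 0) (hτu' : ∀ n : ℕ, τ (star u ^ (n + 1)) = 0) (S : Mˣ) :
    Tendsto (fun δ => regLogDet τ δ (S * (1 - u) * ↑S⁻¹)) (𝓝[>] 0) (𝓝 0) := by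
  let : PartialOrder M := CStarAlgebra.spectralOrder M
  let : StarOrderedRing M := CStarAlgebra.spectralOrderedRing M
  let y : ℝ → ℝ := fun δ => Real.arsinh (√δ / 2)
  have hy : ∀ δ > 0, regLogDet τ δ (1 - u) = 2 * y δ := by
    intro δ hδ
    have h := regLogDet_one_sub hτ hτ1 hu hτu hτu'
      (Real.arsinh_pos_iff.2 (by positivity) : 0 < y δ)
    rwa [Real.sinh_arsinh, mul_div_cancel₀ _ two_ne_zero, Real.sq_sqrt hδ.le] at h
  have hlim (c : ℝ) : Tendsto (fun δ => 2 * y (c * δ)) (𝓝[>] 0) (𝓝 0) := by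
    have hcont : Continuous fun δ : ℝ => 2 * y (c * δ) :=
      continuous_const.mul (Real.continuous_arsinh.comp (by fun_prop))
    simpa [y] using hcont.continuousWithinAt (s := Set.Ioi 0) (x := 0) |>.tendsto
  obtain ⟨c₁, hc₁, h₁⟩ := exists_le_regLogDet_conj hτ hpos S
  obtain ⟨c₂, hc₂, h₂⟩ := exists_regLogDet_conj_le hτ hpos S
  refine tendsto_of_tendsto_of_tendsto_of_le_of_le' (hlim c₁) (hlim c₂) ?_ ?_ <;>
    filter_upwards [self_mem_nhdsWithin] with δ hδ
  · exact (hy _ (mul_pos hc₁ hδ)).symm.trans_le (h₁ _ δ hδ)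
  · exact (h₂ _ δ hδ).trans_eq (hy _ (mul_pos hc₂ hδ))

end TraceLog

section LogIntegral

open Filter Topology

variable {μ : Measure ℝ} [IsFiniteMeasure μ] {B C L : ℝ}

lemma integrable_log_add (hB : ∀ᵐ s ∂μ, s ∈ Set.Icc 0 B) {ε : ℝ} (hε : 0 < ε) :
    Integrable (fun s => Real.log (s + ε)) μ := by
  refine .of_mem_Icc (Real.log ε) (Real.log (B + ε)) (by fun_prop) ?_
  filter_upwards [hB] with s hs
  exact ⟨Real.log_le_log hε (by linarith [hs.1]),
    Real.log_le_log (by linarith [hs.1]) (by linarith [hs.2])⟩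

lemma log_add_le_log_add_one {s ε : ℝ} (hs : s ∈ Set.Icc 0 B) (hε : ε ∈ Set.Ioc 0 1) :
    Real.log (s + ε) ≤ Real.log (B + 1) :=
  Real.log_le_log (by linarith [hs.1, hε.1]) (by linarith [hs.2, hε.2])

lemma integral_sub_log_add_le (hB : ∀ᵐ s ∂μ, s ∈ Set.Icc 0 B) {ε : ℝ} (hε : 0 < ε)
    (hC : C ≤ ∫ s, Real.log (s + ε) ∂μ) (D : ℝ) :
    ∫ s, (D - Real.log (s + ε)) ∂μ ≤ μ.real Set.univ * D - C := by
  rw [integral_sub (integrable_const _) (integrable_log_add hB hε), integral_const, smul_eq_mul]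
  exact sub_le_sub_left hC _

lemma ae_pos_of_le_integral_log_add (hB : ∀ᵐ s ∂μ, s ∈ Set.Icc 0 B)
    (hC : ∀ᶠ ε in 𝓝[>] 0, C ≤ ∫ s, Real.log (s + ε) ∂μ) : ∀ᵐ s ∂μ, 0 < s := by
  set D : ℝ := Real.log (B + 1)
  suffices hzero : μ.real {0} = 0 by
    filter_upwards [hB, measure_eq_zero_iff_ae_notMem.1 ((measureReal_eq_zero_iff).1 hzero)]
      with s hs hs0
    exact hs.1.lt_of_ne (Ne.symm hs0)
  by_contra hne
  have hpos : 0 < μ.real {0} := lt_of_le_of_ne measureReal_nonneg (Ne.symm hne)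
  have hbound : ∀ᶠ ε in 𝓝[>] (0 : ℝ),
      D - (μ.real Set.univ * D - C) / μ.real {0} ≤ Real.log ε := by
    filter_upwards [hC, Ioc_mem_nhdsGT zero_lt_one] with ε hCε hε
    have hle : μ.real {0} * (D - Real.log ε) ≤ μ.real Set.univ * D - C :=
      calc μ.real {0} * (D - Real.log ε)
          = ∫ s in ({0} : Set ℝ), (D - Real.log (s + ε)) ∂μ := by
            rw [integral_singleton, zero_add, smul_eq_mul]
        _ ≤ ∫ s, (D - Real.log (s + ε)) ∂μ := by
            refine setIntegral_le_integral
              ((integrable_const _).sub (integrable_log_add hB hε.1)) ?_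
            filter_upwards [hB] with s hs
            exact sub_nonneg.2 (log_add_le_log_add_one hs hε)
        _ ≤ μ.real Set.univ * D - C := integral_sub_log_add_le hB hε.1 hCε D
    linarith [(le_div_iff₀' hpos).2 hle]
  obtain ⟨ε, hε, hε'⟩ := (hbound.and (Real.tendsto_log_nhdsGT_zero.eventually_lt_atBot
    (D - (μ.real Set.univ * D - C) / μ.real {0}))).exists
  exact hε.not_gt hε'

lemma tendsto_log_add {s : ℝ} (hs : 0 < s) :
    Tendsto (fun ε => Real.log (s + ε)) (𝓝[>] 0) (𝓝 (Real.log s)) := by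
  have hcont : ContinuousAt (fun ε => Real.log (s + ε)) 0 :=
    ContinuousAt.log (by fun_prop) (by linarith)
  simpa only [add_zero] using hcont.tendsto.mono_left nhdsWithin_le_nhds

lemma integrable_log_of_le_integral_log_add (hB : ∀ᵐ s ∂μ, s ∈ Set.Icc 0 B)
    (hC : ∀ᶠ ε in 𝓝[>] 0, C ≤ ∫ s, Real.log (s + ε) ∂μ) : Integrable Real.log μ := by
  set D : ℝ := Real.log (B + 1)
  obtain ⟨ε, hε, hεlim⟩ : ∃ ε : ℕ → ℝ,
      (∀ n, ε n ∈ Set.Ioc 0 1 ∧ C ≤ ∫ s, Real.log (s + ε n) ∂μ) ∧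
        Tendsto ε atTop (𝓝[>] 0) := by
    obtain ⟨ε, hεlim⟩ := exists_seq_tendsto (𝓝[>] (0 : ℝ))
    obtain ⟨N, hN⟩ := eventually_atTop.1 <| hεlim.eventually <|
      (eventually_mem_set.2 (Ioc_mem_nhdsGT zero_lt_one)).and hC
    exact ⟨fun n => ε (n + N), fun n => hN _ (Nat.le_add_left N n),
      hεlim.comp (tendsto_add_atTop_nat N)⟩
  suffices hD : Integrable (fun s => D - Real.log s) μ by
    exact ((integrable_const D).sub hD).congr (.of_forall fun s => sub_sub_cancel _ _)
  refine integrable_of_tendsto (G := fun n s => D - Real.log (s + ε n)) ?_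
    (fun n => Measurable.aestronglyMeasurable (by fun_prop)) ?_
  · filter_upwards [ae_pos_of_le_integral_log_add hB hC] with s hs
    exact ((tendsto_log_add hs).comp hεlim).const_sub D
  · refine ne_top_of_le_ne_top (ENNReal.ofReal_ne_top (r := μ.real Set.univ * D - C))
      (liminf_le_of_frequently_le' (Frequently.of_forall fun n => ?_))
    obtain ⟨hεn, hCn⟩ := hε n
    have hint : Integrable (fun s => D - Real.log (s + ε n)) μ :=
      (integrable_const _).sub (integrable_log_add hB hεn.1)
    rw [← ofReal_integral_norm_eq_lintegral_enorm hint]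
    refine ENNReal.ofReal_le_ofReal
      ((integral_congr_ae ?_).trans_le (integral_sub_log_add_le hB hεn.1 hCn D))
    filter_upwards [hB] with s hs
    exact Real.norm_of_nonneg (sub_nonneg.2 (log_add_le_log_add_one hs hεn))

lemma integral_log_eq_of_tendsto (hB : ∀ᵐ s ∂μ, s ∈ Set.Icc 0 B)
    (hL : Tendsto (fun ε => ∫ s, Real.log (s + ε) ∂μ) (𝓝[>] 0) (𝓝 L)) :
    (∀ᵐ s ∂μ, 0 < s) ∧ Integrable Real.log μ ∧ ∫ s, Real.log s ∂μ = L := by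
  have hC : ∀ᶠ ε in 𝓝[>] 0, L - 1 ≤ ∫ s, Real.log (s + ε) ∂μ :=
    (hL.eventually_const_lt (sub_one_lt L)).mono fun _ => le_of_lt
  have hpos := ae_pos_of_le_integral_log_add hB hC
  have hint := integrable_log_of_le_integral_log_add hB hC
  refine ⟨hpos, hint, tendsto_nhds_unique (tendsto_integral_filter_of_dominated_convergence
    (fun s => |Real.log s| + |Real.log (B + 1)|)
    (.of_forall fun ε => Measurable.aestronglyMeasurable (by fun_prop)) ?_
    (hint.abs.add (integrable_const _)) (hpos.mono fun s hs => tendsto_log_add hs)) hL⟩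
  filter_upwards [Ioc_mem_nhdsGT zero_lt_one] with ε hε
  filter_upwards [hB, hpos] with s hs hs0
  have hlower : Real.log s ≤ Real.log (s + ε) := Real.log_le_log hs0 (by linarith [hε.1])
  have hupper := log_add_le_log_add_one hs hε
  rw [Real.norm_eq_abs, abs_le]
  constructor
  · linarith [neg_abs_le (Real.log s), abs_nonneg (Real.log (B + 1))]
  · linarith [le_abs_self (Real.log (B + 1)), abs_nonneg (Real.log s)]

end LogIntegral

section SpectralMeasure

open Filter Topology

lemma rightLim_eq_of_eq_measureReal_Iic {F : ℝ → ℝ} {ν : Measure ℝ} [IsFiniteMeasure ν]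
    (hF : ∀ r, F r = ν.real (Set.Iic r)) (r : ℝ) : Function.rightLim F r = F r := by
  obtain rfl : F = fun r => ν.real (Set.Iic r) := funext hF
  refine ContinuousWithinAt.rightLim_eq (continuousWithinAt_Ioi_iff_Ici.1 ?_)
  have hinter : ⋂ x > r, Set.Iic x = Set.Iic r := by
    ext s
    simp only [Set.mem_iInter, Set.mem_Iic]
    exact ⟨le_of_forall_gt_imp_ge_of_dense, fun h x hx => h.trans hx.le⟩
  have hlim := tendsto_measure_biInter_gt (μ := ν) (s := Set.Iic) (a := r)
    (fun _ _ => measurableSet_Iic.nullMeasurableSet)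
    (fun _ _ _ hij => Set.Iic_subset_Iic.2 hij) ⟨r + 1, by simp, measure_ne_top _ _⟩
  rw [hinter] at hlim
  exact (ENNReal.tendsto_toReal (measure_ne_top _ _)).comp hlim

lemma stieltjesFunction_measure_eq {F : ℝ → ℝ} (hmono : Monotone F) {ν : Measure ℝ}
    [IsFiniteMeasure ν] (hF : ∀ r, F r = ν.real (Set.Iic r)) :
    hmono.stieltjesFunction.measure = ν := by
  have hval : ∀ r, hmono.stieltjesFunction r = ν.real (Set.Iic r) := fun r => by
    rw [Monotone.stieltjesFunction_eq, rightLim_eq_of_eq_measureReal_Iic hF, hF]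
  have hbot : Tendsto hmono.stieltjesFunction atBot (𝓝 0) := by
    have hlim := tendsto_measure_iInter_atBot (μ := ν) (s := Set.Iic)
      (fun _ => measurableSet_Iic.nullMeasurableSet) (fun _ _ => Set.Iic_subset_Iic.2)
      ⟨(0 : ℝ), measure_ne_top _ _⟩
    have hempty : ⋂ r : ℝ, Set.Iic r = ∅ :=
      iInter_Iic_eq_empty_iff.2 (by simp [Set.range_id', not_bddBelow_univ])
    rw [hempty, measure_empty] at hlim
    exact ((ENNReal.tendsto_toReal ENNReal.zero_ne_top).comp hlim).congr fun r => (hval r).symm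
  refine (Measure.ext_of_Iic _ _ fun r => ?_).symm
  rw [StieltjesFunction.measure_Iic _ hbot, hval, sub_zero, ofReal_measureReal]

variable {G : Type*} [Group G] {ι : Type*} [Fintype ι]
variable {U : Type*} [NormedAddCommGroup U] [InnerProductSpace ℂ U] [CompleteSpace U]
variable {U' : Type*} [NormedAddCommGroup U'] [InnerProductSpace ℂ U'] [CompleteSpace U']
variable (j : U →ₗᵢ[ℂ] L2pow G ι) {T : U →L[ℂ] U} {c : ℝ}

lemma vnTrace_eq (T : U →L[ℂ] U) :
    vnTrace j T = ∑ i : ι,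
      inner ℂ (ContinuousLinearMap.adjoint j.toContinuousLinearMap (unitVec G i))
        (T (ContinuousLinearMap.adjoint j.toContinuousLinearMap (unitVec G i))) := by
  refine Finset.sum_congr rfl fun i _ => ?_
  rw [ContinuousLinearMap.adjoint_inner_left]
  rfl

lemma vnTrace_re_nonneg (hT : 0 ≤ T) : 0 ≤ (vnTrace j T).re := by
  rw [vnTrace_eq, Complex.re_sum]
  exact Finset.sum_nonneg fun i _ =>
    ((ContinuousLinearMap.nonneg_iff_isPositive T).1 hT).re_inner_nonneg_right _

/-- The real part of the von Neumann trace, as a linear map. -/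
def reTrace : (U →L[ℂ] U) →ₗ[ℝ] ℝ where
  toFun T := (vnTrace j T).re
  map_add' S T := by
    simp only [vnTrace_eq, add_apply, inner_add_right, Finset.sum_add_distrib, Complex.add_re]
  map_smul' c T := by
    simp only [vnTrace_eq, smul_apply, inner_smul_right_eq_smul, ← Finset.smul_sum,
      Complex.smul_re, RingHom.id_apply]

/-- The spectral measure of `T` for the von Neumann trace. -/
structure IsSpectralMeasure (T : U →L[ℂ] U) (μ : Measure ℝ) : Prop where
  ae_mem_spectrum : ∀ᵐ s ∂μ, s ∈ spectrum ℝ T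
  integral_eq : ∀ f : ℝ → ℝ, ContinuousOn f (spectrum ℝ T) →
    ∫ s, f s ∂μ = (vnTrace j (cfc f T)).re

-- Riesz representation of the positive functional `f ↦ Tr f(T)` on `C(spectrum T)`.
lemma exists_isSpectralMeasure (hT : IsSelfAdjoint T) :
    ∃ μ : Measure ℝ, IsFiniteMeasure μ ∧ IsSpectralMeasure j T μ := by
  have hcomp : IsCompact (spectrum ℝ T) := spectrum.isCompact T
  have : CompactSpace (spectrum ℝ T) := isCompact_iff_compactSpace.1 hcomp
  let Λ : CompactlySupportedContinuousMap (spectrum ℝ T) ℝ →ₚ[ℝ] ℝ := .mk₀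
    { toFun := fun f => reTrace j (cfcHom (R := ℝ) hT f.toContinuousMap)
      map_add' := fun f g => by
        rw [← map_add, ← map_add]
        rfl
      map_smul' := fun c f => by
        rw [RingHom.id_apply, ← map_smul, ← map_smul]
        rfl }
    fun f hf => vnTrace_re_nonneg j ((cfcHom_nonneg_iff (R := ℝ) hT).2 hf)
  have hemb : MeasurableEmbedding (Subtype.val : spectrum ℝ T → ℝ) :=
    MeasurableEmbedding.subtype_coe hcomp.isClosed.measurableSet
  refine ⟨(RealRMK.rieszMeasure Λ).map Subtype.val, inferInstance, ?_, fun f hf => ?_⟩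
  · exact hemb.ae_map_iff.2 (.of_forall Subtype.prop)
  · rw [hemb.integral_map, cfc_apply f T hT hf]
    exact RealRMK.integral_rieszMeasure Λ (CompactlySupportedContinuousMap.continuousMapEquiv
      ⟨(spectrum ℝ T).domRestrict f, hf.domRestrict⟩)

/-- Continuous functions decreasing to the indicator function of `(-∞, c]`. This choice makes
`1 - cutoff c n s` a multiple of `(s - c)⁺`. -/
def cutoff (c : ℝ) (n : ℕ) (s : ℝ) : ℝ := (1 + n * max (s - c) 0)⁻¹

lemma one_le_one_add_mul_max (c : ℝ) (n : ℕ) (s : ℝ) : 1 ≤ 1 + n * max (s - c) 0 :=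
  le_add_of_nonneg_right (by positivity)

lemma continuous_cutoff (c : ℝ) (n : ℕ) : Continuous (cutoff c n) :=
  Continuous.inv₀ (by fun_prop) fun s => (zero_lt_one.trans_le (one_le_one_add_mul_max c n s)).ne'

lemma cutoff_nonneg (c : ℝ) (n : ℕ) (s : ℝ) : 0 ≤ cutoff c n s :=
  inv_nonneg.2 (zero_le_one.trans (one_le_one_add_mul_max c n s))

lemma cutoff_le_one (c : ℝ) (n : ℕ) (s : ℝ) : cutoff c n s ≤ 1 :=
  inv_le_one_of_one_le₀ (one_le_one_add_mul_max c n s)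

lemma mul_cutoff_mul_max (c : ℝ) (n : ℕ) (s : ℝ) :
    n * (cutoff c n s * max (s - c) 0) = 1 - cutoff c n s := by
  have hne : 1 + n * max (s - c) 0 ≠ 0 :=
    (zero_lt_one.trans_le (one_le_one_add_mul_max c n s)).ne'
  rw [cutoff]
  field_simp
  ring

lemma tendsto_cutoff (c s : ℝ) :
    Tendsto (fun n => cutoff c n s) atTop (𝓝 ((Set.Iic c).indicator 1 s)) := by
  rcases le_or_gt s c with hs | hs
  · simp [cutoff, Set.indicator_of_mem (Set.mem_Iic.2 hs), max_eq_right (sub_nonpos.2 hs)]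
  · rw [Set.indicator_of_notMem (Set.notMem_Iic.2 hs)]
    refine tendsto_inv_atTop_zero.comp (tendsto_atTop_add_const_left _ _ ?_)
    exact tendsto_natCast_atTop_atTop.atTop_mul_const (lt_max_of_lt_left (sub_pos.2 hs))

lemma norm_cfc_cutoff_le (c : ℝ) (T : U →L[ℂ] U) (n : ℕ) :
    ‖(cfc (cutoff c n) T : U →L[ℂ] U)‖ ≤ 1 :=
  norm_cfc_le zero_le_one fun s _ => by
    rw [Real.norm_of_nonneg (cutoff_nonneg c n s)]
    exact cutoff_le_one c n s

lemma natCast_smul_cfc_cutoff_apply (hT : IsSelfAdjoint T) (c : ℝ) (n : ℕ) (x : U) :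
    (n : ℝ) • (cfc (cutoff c n) T : U →L[ℂ] U)
      ((cfc (fun s : ℝ => max (s - c) 0) T : U →L[ℂ] U) x) =
      x - (cfc (cutoff c n) T : U →L[ℂ] U) x := by
  have hcont := continuous_cutoff c n
  have hop : (n : ℝ) • (cfc (cutoff c n) T * cfc (fun s : ℝ => max (s - c) 0) T) =
      1 - cfc (cutoff c n) T := by
    rw [← cfc_mul _ _ T, ← cfc_const_mul _ _ T, ← cfc_const_one ℝ T, ← cfc_sub _ _ T]
    exact cfc_congr fun s _ => mul_cutoff_mul_max c n s
  exact DFunLike.congr_fun hop x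

lemma cfc_cutoff_apply_of_mem_ker (hT : IsSelfAdjoint T) (n : ℕ) {x : U}
    (hx : (cfc (fun s : ℝ => max (s - c) 0) T : U →L[ℂ] U) x = 0) :
    (cfc (cutoff c n) T : U →L[ℂ] U) x = x := by
  have hid := natCast_smul_cfc_cutoff_apply hT c n x
  rw [hx, map_zero, smul_zero] at hid
  exact (sub_eq_zero.1 hid.symm).symm

lemma tendsto_cfc_cutoff_range (hT : IsSelfAdjoint T) (c : ℝ) (x : U) :
    Tendsto (fun n => (cfc (cutoff c n) T : U →L[ℂ] U)
      ((cfc (fun s : ℝ => max (s - c) 0) T : U →L[ℂ] U) x)) atTop (𝓝 0) := by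
  refine squeeze_zero_norm' ?_ (tendsto_const_div_atTop_nhds_zero_nat (‖x‖ + ‖x‖))
  filter_upwards [eventually_gt_atTop 0] with n hn
  have hid := congr_arg norm (natCast_smul_cfc_cutoff_apply hT c n x)
  rw [norm_smul, Real.norm_natCast] at hid
  rw [le_div_iff₀' (Nat.cast_pos.2 hn), hid]
  have hle := (cfc (cutoff c n) T : U →L[ℂ] U).le_of_opNorm_le (norm_cfc_cutoff_le c T n) x
  exact (norm_sub_le _ _).trans (by linarith)

lemma tendsto_cfc_cutoff_of_mem_orthogonal (hT : IsSelfAdjoint T) {y : U}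
    (hy : y ∈ (LinearMap.ker (cfc (fun s : ℝ => max (s - c) 0) T : U →L[ℂ] U).toLinearMap)ᗮ) :
    Tendsto (fun n => (cfc (cutoff c n) T : U →L[ℂ] U) y) atTop (𝓝 0) := by
  have hsa : IsSelfAdjoint (cfc (fun s : ℝ => max (s - c) 0) T : U →L[ℂ] U) := cfc_predicate _ _
  rw [ContinuousLinearMap.orthogonal_ker, ← ContinuousLinearMap.star_eq_adjoint, hsa.star_eq] at hy
  have hequi : Equicontinuous fun n => ⇑(cfc (cutoff c n) T : U →L[ℂ] U) :=
    (show (∃ C, ∀ n, ‖(cfc (cutoff c n) T : U →L[ℂ] U)‖ ≤ C) ↔ _ from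
      (NormedSpace.equicontinuous_TFAE _).out 5 1).1 ⟨1, norm_cfc_cutoff_le c T⟩
  refine (hequi.isClosed_setOfPred_tendsto continuous_const).closure_subset_iff.2 ?_ hy
  rintro _ ⟨x, rfl⟩
  exact tendsto_cfc_cutoff_range hT c x

lemma tendsto_cfc_cutoff (hT : IsSelfAdjoint T) (c : ℝ) (x : U) :
    Tendsto (fun n => (cfc (cutoff c n) T : U →L[ℂ] U) x) atTop (𝓝 (spectralProj T c x)) := by
  set K : Submodule ℂ U :=
    LinearMap.ker (cfc (fun s : ℝ => max (s - c) 0) T : U →L[ℂ] U).toLinearMap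
  have hsum : ∀ n, (cfc (cutoff c n) T : U →L[ℂ] U) x =
      K.starProjection x + (cfc (cutoff c n) T : U →L[ℂ] U) (x - K.starProjection x) := fun n => by
    rw [map_sub, cfc_cutoff_apply_of_mem_ker hT n (K.starProjection_apply_mem x), add_sub_cancel]
  have hlim := (tendsto_cfc_cutoff_of_mem_orthogonal hT
    (K.sub_starProjection_mem_orthogonal x)).const_add (K.starProjection x)
  rw [add_zero] at hlim
  exact hlim.congr fun n => (hsum n).symm

section

variable {j} {μ : Measure ℝ}

lemma IsSpectralMeasure.measureReal_Iic [IsFiniteMeasure μ] (hμ : IsSpectralMeasure j T μ)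
    (hT : IsSelfAdjoint T) (c : ℝ) : μ.real (Set.Iic c) = (vnTrace j (spectralProj T c)).re := by
  have hint : Tendsto (fun n => ∫ s, cutoff c n s ∂μ) atTop (𝓝 (μ.real (Set.Iic c))) := by
    rw [← integral_indicator_one measurableSet_Iic]
    refine tendsto_integral_of_dominated_convergence (fun _ => 1)
      (fun n => (continuous_cutoff c n).aestronglyMeasurable) (integrable_const _)
      (fun n => .of_forall fun s => ?_) (.of_forall (tendsto_cutoff c))
    rw [Real.norm_of_nonneg (cutoff_nonneg c n s)]
    exact cutoff_le_one c n s
  have htrace : Tendsto (fun n => (vnTrace j (cfc (cutoff c n) T)).re) atTop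
      (𝓝 (vnTrace j (spectralProj T c)).re) := by
    simp_rw [vnTrace_eq]
    exact (Complex.continuous_re.tendsto _).comp
      (tendsto_finsetSum _ fun i _ => tendsto_const_nhds.inner (tendsto_cfc_cutoff hT c _))
  exact tendsto_nhds_unique hint
    (htrace.congr fun n => (hμ.integral_eq _ (continuous_cutoff c n).continuousOn).symm)

variable {A : U →L[ℂ] U'}

lemma isSelfAdjoint_adjoint_comp_self (A : U →L[ℂ] U') :
    IsSelfAdjoint (ContinuousLinearMap.adjoint A ∘L A) :=
  (ContinuousLinearMap.isPositive_adjoint_comp_self A).isSelfAdjoint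

lemma spectralDensityMeasure_eq_map [IsFiniteMeasure μ]
    (hμ : IsSpectralMeasure j (ContinuousLinearMap.adjoint A ∘L A) μ) :
    spectralDensityMeasure j A = μ.map Real.sqrt := by
  refine stieltjesFunction_measure_eq _ fun r => ?_
  rw [map_measureReal_apply Real.continuous_sqrt.measurable measurableSet_Iic, spectralDensity]
  split_ifs with hr
  · have hempty : Real.sqrt ⁻¹' Set.Iic r = ∅ :=
      Set.eq_empty_of_forall_notMem fun s hs => (hr.trans_le (Real.sqrt_nonneg s)).not_ge hs
    rw [hempty, measureReal_empty]
  · have hIic : Real.sqrt ⁻¹' Set.Iic r = Set.Iic (r ^ 2) :=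
      Set.ext fun s => Real.sqrt_le_left (not_lt.1 hr)
    rw [hIic, hμ.measureReal_Iic (isSelfAdjoint_adjoint_comp_self A)]

lemma IsSpectralMeasure.ae_mem_Icc
    (hμ : IsSpectralMeasure j (ContinuousLinearMap.adjoint A ∘L A) μ) :
    ∀ᵐ s ∂μ, s ∈ Set.Icc 0 ‖ContinuousLinearMap.adjoint A ∘L A‖ :=
  hμ.ae_mem_spectrum.mono fun _ hs =>
    ⟨spectrum_nonneg_of_nonneg ((ContinuousLinearMap.nonneg_iff_isPositive _).2
      (ContinuousLinearMap.isPositive_adjoint_comp_self A)) hs,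
    (le_abs_self _).trans (abs_le_norm_of_mem_spectrum hs)⟩

lemma IsSpectralMeasure.integral_log_add
    (hμ : IsSpectralMeasure j (ContinuousLinearMap.adjoint A ∘L A) μ) {ε : ℝ} (hε : 0 < ε) :
    ∫ s, Real.log (s + ε) ∂μ = (vnTrace j (CFC.log
      (ContinuousLinearMap.adjoint A ∘L A + algebraMap ℝ (U →L[ℂ] U) ε))).re := by
  set T : U →L[ℂ] U := ContinuousLinearMap.adjoint A ∘L A
  have hsa : IsSelfAdjoint T := isSelfAdjoint_adjoint_comp_self A
  have hne : ∀ s ∈ spectrum ℝ T, s + ε ≠ 0 := fun s hs =>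
    (add_pos_of_nonneg_of_pos (spectrum_nonneg_of_nonneg
      ((ContinuousLinearMap.nonneg_iff_isPositive T).2
        (ContinuousLinearMap.isPositive_adjoint_comp_self A)) hs) hε).ne'
  have hcont : ContinuousOn Real.log ((fun s => s + ε) '' spectrum ℝ T) :=
    Real.continuousOn_log.mono (Set.image_subset_iff.2 hne)
  have hlog : CFC.log (T + algebraMap ℝ (U →L[ℂ] U) ε) = cfc (fun s => Real.log (s + ε)) T := by
    rw [cfc_comp' Real.log (fun s => s + ε) T hcont, cfc_add_const ε (fun s => s) T,
      cfc_id' ℝ T, CFC.log]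
  rw [hlog, hμ.integral_eq _ (ContinuousOn.log (by fun_prop) hne)]

lemma fkDet_eq_of_ae_pos [IsFiniteMeasure μ]
    (hμ : IsSpectralMeasure j (ContinuousLinearMap.adjoint A ∘L A) μ)
    (hpos : ∀ᵐ s ∂μ, 0 < s) (hint : Integrable Real.log μ) :
    fkDet j A = Real.exp ((∫ s, Real.log s ∂μ) / 2) := by
  have hsqrt : Measurable Real.sqrt := Real.continuous_sqrt.measurable
  have hae : ∀ᵐ r ∂(μ.map Real.sqrt), r ∈ Set.Ioi (0 : ℝ) :=
    (ae_map_iff hsqrt.aemeasurable measurableSet_Ioi).2 (hpos.mono fun s => Real.sqrt_pos.2)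
  have hlog : (fun s => Real.log (Real.sqrt s)) =ᵐ[μ] fun s => Real.log s / 2 :=
    hpos.mono fun s hs => Real.log_sqrt hs.le
  have hint' : Integrable Real.log (μ.map Real.sqrt) := by
    rw [integrable_map_measure Real.measurable_log.aestronglyMeasurable hsqrt.aemeasurable]
    exact (hint.div_const 2).congr hlog.symm
  rw [fkDet, spectralDensityMeasure_eq_map hμ, IntegrableOn,
    Measure.restrict_eq_self_of_ae_mem hae, if_pos hint',
    integral_map hsqrt.aemeasurable Real.measurable_log.aestronglyMeasurable,
    integral_congr_ae hlog, integral_div]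

end

theorem fkDet_eq_one_of_tendsto (A : U →L[ℂ] U')
    (h : Tendsto (fun ε : ℝ => (vnTrace j (CFC.log (ContinuousLinearMap.adjoint A ∘L A +
      algebraMap ℝ (U →L[ℂ] U) ε))).re) (𝓝[>] 0) (𝓝 0)) : fkDet j A = 1 := by
  obtain ⟨μ, _, hμ⟩ := exists_isSpectralMeasure j (isSelfAdjoint_adjoint_comp_self A)
  have hlim : Tendsto (fun ε => ∫ s, Real.log (s + ε) ∂μ) (𝓝[>] 0) (𝓝 0) :=
    h.congr' (eventually_mem_nhdsWithin.mono fun ε hε => (hμ.integral_log_add hε).symm)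
  obtain ⟨hpos, hint, hzero⟩ := integral_log_eq_of_tendsto hμ.ae_mem_Icc hlim
  rw [fkDet_eq_of_ae_pos hμ hpos hint, hzero, zero_div, Real.exp_zero]

theorem fkDet_zero : fkDet j (0 : U →L[ℂ] U') = 1 := by
  obtain ⟨μ, _, hμ⟩ :=
    exists_isSpectralMeasure j (isSelfAdjoint_adjoint_comp_self (0 : U →L[ℂ] U'))
  have hzero : ∀ᵐ s ∂μ, s = 0 := by
    filter_upwards [hμ.ae_mem_Icc] with s hs
    simpa using hs
  have hnull : (μ.map Real.sqrt).restrict (Set.Ioi 0) = 0 := by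
    rw [Measure.restrict_eq_zero,
      Measure.map_apply Real.continuous_sqrt.measurable measurableSet_Ioi]
    refine measure_eq_zero_iff_ae_notMem.2 (hzero.mono ?_)
    rintro s rfl
    simp
  rw [fkDet, spectralDensityMeasure_eq_map hμ, IntegrableOn, hnull,
    if_pos integrable_zero_measure, integral_zero_measure, Real.exp_zero]

end SpectralMeasure

section Translations

variable {G : Type*} [Group G] {ι : Type*} [Fintype ι]

lemma leftMul_delta (g x : G) : leftMul g (delta x) = delta (g * x) :=
  pushforward_delta (g * ·) (mul_right_injective g) x

lemma leftMul_one : leftMul (1 : G) = 1 := ext_delta fun x => by simp [leftMul_delta]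

lemma leftMul_mul (g h : G) : leftMul (g * h) = leftMul g * leftMul h :=
  ext_delta fun x => by simp [leftMul_delta, mul_assoc]

lemma leftMul_mul_apply (g h : G) (ξ : L2 G) : leftMul (g * h) ξ = leftMul g (leftMul h ξ) := by
  rw [leftMul_mul]
  rfl

lemma inner_leftMul (g : G) (ξ η : L2 G) :
    inner ℂ (leftMul g ξ) (leftMul g η) = inner ℂ ξ η :=
  LinearIsometry.inner_map_map _ _ _

lemma leftMul_leftMul_inv (g : G) (ξ : L2 G) : leftMul g (leftMul g⁻¹ ξ) = ξ := by
  rw [← leftMul_mul_apply, mul_inv_cancel, leftMul_one]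
  rfl

lemma star_leftMul (g : G) : star (leftMul g) = leftMul g⁻¹ := by
  rw [ContinuousLinearMap.star_eq_adjoint, eq_comm, ContinuousLinearMap.eq_adjoint_iff]
  intro ξ η
  rw [← inner_leftMul g, leftMul_leftMul_inv]

lemma rshift_leftMul (s g : G) (ξ : L2 G) : rshift s (leftMul g ξ) = leftMul g (rshift s ξ) := by
  have hcomm : (rshift s).toContinuousLinearMap * leftMul g =
      leftMul g * (rshift s).toContinuousLinearMap :=
    ext_delta fun x => by simp [leftMul_delta, rshift_delta, mul_assoc]
  exact congrArg (fun T : L2 G →L[ℂ] L2 G => T ξ) hcomm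

lemma star_rshift (s : G) :
    star (rshift s).toContinuousLinearMap = (rshift s⁻¹).toContinuousLinearMap := by
  rw [ContinuousLinearMap.star_eq_adjoint, eq_comm, ContinuousLinearMap.eq_adjoint_iff]
  intro ξ η
  have hinv : rshift s (rshift s⁻¹ ξ) = ξ := by rw [← rshift_mul, inv_mul_cancel, rshift_one]
  refine ((rshift s).inner_map_map (rshift s⁻¹ ξ) η).symm.trans ?_
  rw [hinv]
  rfl

lemma rightMul_single (g : G) (c : ℂ) :
    rightMul (MonoidAlgebra.single g c) = c • (rshift g).toContinuousLinearMap := by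
  rw [rightMul, MonoidAlgebra.coeff_single, Finsupp.sum_single_index (by simp)]
  rfl

lemma rightMul_add (a b : MonoidAlgebra ℂ G) : rightMul (a + b) = rightMul a + rightMul b := by
  rw [rightMul, MonoidAlgebra.coeff_add, Finsupp.sum_add_index' (by simp) (by simp [add_smul])]
  rfl

lemma rightMul_zero : rightMul (0 : MonoidAlgebra ℂ G) = 0 := by
  simp [rightMul]

lemma rightMul_leftMul (a : MonoidAlgebra ℂ G) (g : G) (ξ : L2 G) :
    rightMul a (leftMul g ξ) = leftMul g (rightMul a ξ) := by
  induction a using MonoidAlgebra.induction_linear with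
  | zero => simp [rightMul_zero]
  | add a b ha hb => simp [rightMul_add, ha, hb]
  | single h c => simp [rightMul_single, rshift_leftMul]

lemma rightMul_one_sub_single (g : G) :
    rightMul (1 - MonoidAlgebra.single g 1) = 1 - (rshift g).toContinuousLinearMap := by
  rw [sub_eq_add_neg, rightMul_add, MonoidAlgebra.one_def, ← MonoidAlgebra.single_neg,
    rightMul_single, rightMul_single]
  ext ξ : 1
  simp [sub_eq_add_neg, rshift_one]

lemma matrixOp_apply {X Y κ : Type*} [Fintype κ] (T : ι → κ → L2 X →L[ℂ] L2 Y) (v : L2pow X ι)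
    (j : κ) : matrixOp T v j = ∑ i, T i j (v i) := by
  simp [matrixOp]

lemma diagOp_apply {X Y : Type*} (T : L2 X →L[ℂ] L2 Y) (v : L2pow X ι) (i : ι) :
    diagOp T v i = T (v i) := by
  classical
  rw [diagOp, matrixOp_apply, Finset.sum_eq_single i]
  · simp
  · intro b _ hb
    simp [hb]
  · simp

lemma diagOp_leftMul_mul_apply (g h : G) (v : L2pow G ι) :
    diagOp (leftMul (g * h)) v = diagOp (leftMul g) (diagOp (leftMul h) v) := by
  ext i : 1
  simp only [diagOp_apply, leftMul_mul_apply]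

lemma unitVec_apply_self (i : ι) : unitVec G i i = delta 1 := by
  simp [unitVec]

lemma unitVec_apply_of_ne {i k : ι} (h : k ≠ i) : unitVec G i k = 0 := by
  simp [unitVec, h]

lemma inner_unitVec (i : ι) (v : L2pow G ι) :
    inner ℂ (unitVec G i) v = inner ℂ (delta 1) (v i) := by
  rw [PiLp.inner_apply, Finset.sum_eq_single i]
  · rw [unitVec_apply_self]
  · intro k _ hk
    rw [unitVec_apply_of_ne hk, inner_zero_left]
  · simp

end Translations

section GroupVonNeumann

variable (G : Type*) [Group G]

/-- The group von Neumann algebra: the bounded operators on `L²(G)` that commute with left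
translations. -/
def vN : StarSubalgebra ℂ (L2 G →L[ℂ] L2 G) :=
  StarSubalgebra.centralizer ℂ (Set.range leftMul)

instance : IsClosed (vN G : Set (L2 G →L[ℂ] L2 G)) := by
  rw [vN, StarSubalgebra.coe_centralizer]
  exact Set.isClosed_centralizer _

instance : CStarAlgebra (vN G) := StarSubalgebra.cstarAlgebra _

variable {G}

lemma mem_vN_iff {X : L2 G →L[ℂ] L2 G} :
    X ∈ vN G ↔ ∀ (g : G) (ξ : L2 G), X (leftMul g ξ) = leftMul g (X ξ) := by
  rw [vN, StarSubalgebra.mem_centralizer_iff]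
  constructor
  · intro h g ξ
    exact (congrArg (fun T : L2 G →L[ℂ] L2 G => T ξ) (h _ ⟨g, rfl⟩).1).symm
  · rintro h _ ⟨g, rfl⟩
    rw [star_leftMul]
    exact ⟨ContinuousLinearMap.ext fun ξ => (h g ξ).symm,
      ContinuousLinearMap.ext fun ξ => (h g⁻¹ ξ).symm⟩

lemma rshift_mem_vN (s : G) : (rshift s).toContinuousLinearMap ∈ vN G :=
  mem_vN_iff.2 fun g ξ => rshift_leftMul s g ξ

/-- The trace of the group von Neumann algebra, as a functional on all bounded operators. -/
def opTrace : (L2 G →L[ℂ] L2 G) →L[ℂ] ℂ :=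
  (innerSL ℂ (delta (1 : G))) ∘L ContinuousLinearMap.apply ℂ (L2 G) (delta (1 : G))

lemma opTrace_apply (X : L2 G →L[ℂ] L2 G) : opTrace X = inner ℂ (delta 1) (X (delta 1)) := rfl

lemma opTrace_one : opTrace (1 : L2 G →L[ℂ] L2 G) = 1 := by
  rw [opTrace_apply, inner_delta]
  exact delta_apply_self 1

lemma opTrace_star_mul_self (X : L2 G →L[ℂ] L2 G) : 0 ≤ (opTrace (star X * X)).re := by
  rw [opTrace_apply, ContinuousLinearMap.star_eq_adjoint, mul_apply_eq_comp,
    ContinuousLinearMap.adjoint_inner_right]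
  exact inner_self_nonneg (𝕜 := ℂ)

lemma star_vN_apply_delta_one {X : L2 G →L[ℂ] L2 G} (hX : X ∈ vN G) (g : G) :
    (star X (delta 1)) g = star ((X (delta 1)) g⁻¹) := by
  rw [← inner_delta, ContinuousLinearMap.star_eq_adjoint, ContinuousLinearMap.adjoint_inner_right,
    ← inner_delta, ← inner_leftMul g⁻¹, leftMul_delta, ← mem_vN_iff.1 hX, leftMul_delta]
  simp

lemma opTrace_mul_eq_tsum {X : L2 G →L[ℂ] L2 G} (hX : X ∈ vN G) (Y : L2 G →L[ℂ] L2 G) :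
    opTrace (X * Y) = ∑' g : G, (X (delta 1)) g⁻¹ * (Y (delta 1)) g := by
  have h : opTrace (X * Y) = inner ℂ (star X (delta 1)) (Y (delta 1)) := by
    rw [ContinuousLinearMap.star_eq_adjoint, ContinuousLinearMap.adjoint_inner_left]
    rfl
  rw [h, lp.inner_eq_tsum]
  refine tsum_congr fun g => ?_
  rw [star_vN_apply_delta_one hX, RCLike.inner_apply]
  simp [mul_comm]

lemma opTrace_mul_comm {X Y : L2 G →L[ℂ] L2 G} (hX : X ∈ vN G) (hY : Y ∈ vN G) :
    opTrace (X * Y) = opTrace (Y * X) := by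
  rw [opTrace_mul_eq_tsum hX, opTrace_mul_eq_tsum hY, ← (Equiv.inv G).tsum_eq]
  refine tsum_congr fun g => ?_
  simp [mul_comm]

lemma opTrace_rshift {s : G} (h : s ≠ 1) : opTrace (rshift s).toContinuousLinearMap = 0 := by
  rw [opTrace_apply, inner_delta, LinearIsometry.coe_toContinuousLinearMap, rshift_delta, one_mul,
    delta_apply_of_ne h.symm]

lemma rshift_pow (s : G) (n : ℕ) :
    (rshift s).toContinuousLinearMap ^ n = (rshift (s ^ n)).toContinuousLinearMap := by
  induction n with
  | zero =>
    refine ext_delta fun x => ?_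
    simp [rshift_delta]
  | succ n ih =>
    rw [pow_succ', ih]
    refine ext_delta fun x => ?_
    simp [rshift_delta, pow_succ, mul_assoc]

end GroupVonNeumann

section Similarity

open ContinuousLinearMap Filter Topology

variable {G : Type*} {ι : Type*} [Fintype ι]
variable {U : Type*} [NormedAddCommGroup U] [InnerProductSpace ℂ U]

/-- The coordinates of an operator from `L²(G)` to a Hilbert module `U`, presented as a subspace
of `L²(G)^ι` by the embedding `j`. -/
def coordOp (j : U →ₗᵢ[ℂ] L2pow G ι) (O : L2 G →L[ℂ] U) (i : ι) : L2 G →L[ℂ] L2 G :=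
  PiLp.proj 2 (fun _ : ι => L2 G) i ∘L j.toContinuousLinearMap ∘L O

lemma coordOp_apply (j : U →ₗᵢ[ℂ] L2pow G ι) (O : L2 G →L[ℂ] U) (i : ι) (ξ : L2 G) :
    coordOp j O i ξ = j (O ξ) i := rfl

lemma sum_star_coordOp_mul [CompleteSpace U] (j : U →ₗᵢ[ℂ] L2pow G ι) (O : L2 G →L[ℂ] U) :
    ∑ i, star (coordOp j O i) * coordOp j O i = adjoint O ∘L O := by
  ext1 ξ
  refine ext_inner_right ℂ fun η => ?_
  rw [sum_apply, sum_inner, ContinuousLinearMap.comp_apply,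
    adjoint_inner_left, ← j.inner_map_map, PiLp.inner_apply]
  refine Finset.sum_congr rfl fun i _ => ?_
  rw [star_eq_adjoint, mul_apply_eq_comp, adjoint_inner_left]
  rfl

variable [Group G]

/-- Equivariance of a map from `L²(G)` to a Hilbert module `U`; the action of `G` on `U` is the
restriction of the diagonal action on `L²(G)^ι` along the embedding `j`. -/
def IsEquivariant (j : U →ₗᵢ[ℂ] L2pow G ι) (O : L2 G → U) : Prop :=
  ∀ (g : G) (ξ : L2 G), j (O (leftMul g ξ)) = diagOp (leftMul g) (j (O ξ))

lemma coordOp_mem_vN {j : U →ₗᵢ[ℂ] L2pow G ι} {O : L2 G →L[ℂ] U} (hO : IsEquivariant j O)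
    (i : ι) : coordOp j O i ∈ vN G :=
  mem_vN_iff.2 fun g ξ => by rw [coordOp_apply, hO, diagOp_apply, coordOp_apply]

variable [CompleteSpace U]

lemma adjoint_unitVec_eq_star_coordOp (j : U →ₗᵢ[ℂ] L2pow G ι) (e : L2 G ≃ₗᵢ[ℂ] U) (i : ι) :
    e.symm (adjoint j.toContinuousLinearMap (unitVec G i)) =
      star (coordOp j (e.toContinuousLinearEquiv : L2 G →L[ℂ] U) i) (delta 1) := by
  refine ext_inner_right ℂ fun ξ => ?_
  rw [star_eq_adjoint, adjoint_inner_left, ← e.inner_map_map, e.apply_symm_apply,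
    adjoint_inner_left, inner_unitVec]
  rfl

lemma adjoint_comp_self_of_isometry {E : Type*} [NormedAddCommGroup E] [InnerProductSpace ℂ E]
    [CompleteSpace E] (e : E ≃ₗᵢ[ℂ] U) :
    adjoint (e.toContinuousLinearEquiv : E →L[ℂ] U) ∘L (e.toContinuousLinearEquiv : E →L[ℂ] U) =
      1 := by
  ext1 ξ
  refine ext_inner_right ℂ fun η => ?_
  rw [ContinuousLinearMap.comp_apply, adjoint_inner_left]
  exact e.inner_map_map ξ η

lemma vnTrace_conj {j : U →ₗᵢ[ℂ] L2pow G ι} (e : L2 G ≃ₗᵢ[ℂ] U) (he : IsEquivariant j e)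
    {X : L2 G →L[ℂ] L2 G} (hX : X ∈ vN G) : vnTrace j (e.conjStarAlgEquiv X) = opTrace X := by
  set c := coordOp j (e.toContinuousLinearEquiv : L2 G →L[ℂ] U)
  have hc : ∀ i, c i ∈ vN G := coordOp_mem_vN he
  have hterm : ∀ i, inner ℂ (unitVec G i) (j (e.conjStarAlgEquiv X
      (adjoint j.toContinuousLinearMap (unitVec G i)))) = opTrace ((star (c i) * c i) * X) := by
    intro i
    rw [mul_assoc, opTrace_mul_comm (star_mem (hc i)) (mul_mem (hc i) hX), inner_unitVec,
      opTrace_apply, mul_assoc, mul_apply_eq_comp, mul_apply_eq_comp,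
      ← adjoint_unitVec_eq_star_coordOp]
    rfl
  rw [vnTrace, Finset.sum_congr rfl fun i _ => hterm i, ← map_sum, ← Finset.sum_mul,
    sum_star_coordOp_mul, adjoint_comp_self_of_isometry, one_mul]

/-- The canonical trace of the group von Neumann algebra. -/
def vNTrace (G : Type*) [Group G] : vN G →L[ℂ] ℂ where
  toLinearMap := (opTrace (G := G)).toLinearMap ∘ₗ (vN G).subtype.toLinearMap
  cont := (opTrace (G := G)).continuous.comp continuous_subtype_val

open scoped CStarAlgebra in
lemma map_log_star_mul_self_add {M N : Type*} [CStarAlgebra M] [CStarAlgebra N] (φ : M →⋆ₐ[ℂ] N)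
    (b : M) {ε : ℝ} (hε : 0 < ε) :
    φ (CFC.log (star b * b + algebraMap ℝ M ε)) =
      CFC.log (star (φ b) * φ b + algebraMap ℝ N ε) := by
  let : PartialOrder M := CStarAlgebra.spectralOrder M
  let : StarOrderedRing M := CStarAlgebra.spectralOrderedRing M
  have hb : IsStrictlyPositive (star b * b + algebraMap ℝ M ε) :=
    isStrictlyPositive_star_mul_self_add b hε
  have hlog : ContinuousOn Real.log (spectrum ℝ (star b * b + algebraMap ℝ M ε)) := fun y hy =>
    (Real.continuousAt_log (hb.spectrum_pos hy).ne').continuousWithinAt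
  have hmap : star (φ b) * φ b + algebraMap ℝ N ε = φ (star b * b + algebraMap ℝ M ε) := by
    rw [map_add, map_mul, map_star, IsScalarTower.algebraMap_apply ℝ ℂ M,
      AlgHomClass.commutes, IsScalarTower.algebraMap_apply ℝ ℂ N]
  rw [hmap]
  exact StarAlgHom.map_cfc φ Real.log _ hlog (map_continuous φ) hb.isSelfAdjoint
    (hb.isSelfAdjoint.map φ)

lemma fkDet_conj_eq_one {j : U →ₗᵢ[ℂ] L2pow G ι} (e : L2 G ≃ₗᵢ[ℂ] U) (he : IsEquivariant j e)
    (B : vN G) (hB : Tendsto (fun ε => regLogDet (vNTrace G) ε B) (𝓝[>] 0) (𝓝 0)) :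
    fkDet j (e.conjStarAlgEquiv (B : L2 G →L[ℂ] L2 G)) = 1 := by
  refine fkDet_eq_one_of_tendsto j _ (hB.congr' ?_)
  filter_upwards [self_mem_nhdsWithin] with ε hε
  have hlog := map_log_star_mul_self_add
    ((e.conjStarAlgEquiv : (L2 G →L[ℂ] L2 G) →⋆ₐ[ℂ] (U →L[ℂ] U)).comp (vN G).subtype) B hε
  have htrace := vnTrace_conj e he
    (SetLike.coe_mem (CFC.log (star B * B + algebraMap ℝ (vN G) ε)))
  exact congrArg Complex.re (htrace.symm.trans (congrArg (vnTrace j) hlog))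

lemma isUnit_adjoint_comp_self {E : Type*} [NormedAddCommGroup E] [InnerProductSpace ℂ E]
    [CompleteSpace E] (O : E ≃L[ℂ] U) :
    IsUnit (adjoint (O : E →L[ℂ] U) ∘L (O : E →L[ℂ] U)) := by
  have hinv : adjoint (O : E →L[ℂ] U) ∘L adjoint (O.symm : U →L[ℂ] E) = 1 := by
    rw [← adjoint_comp, O.coe_symm_comp_coe]
    exact star_one (E →L[ℂ] E)
  have hinv' : adjoint (O.symm : U →L[ℂ] E) ∘L adjoint (O : E →L[ℂ] U) = 1 := by
    rw [← adjoint_comp, O.coe_comp_coe_symm]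
    exact star_one (U →L[ℂ] U)
  refine isUnit_iff_exists.2 ⟨(O.symm : U →L[ℂ] E) ∘L adjoint (O.symm : U →L[ℂ] E), ?_, ?_⟩
  · ext1 ξ
    simpa using congrArg (fun T : E →L[ℂ] E => T ξ) hinv
  · ext1 ξ
    simpa using congrArg (fun T : U →L[ℂ] U => O.symm (T (O ξ))) hinv'

lemma norm_apply_eq_of_adjoint_comp_self_eq {E U' : Type*} [NormedAddCommGroup E]
    [InnerProductSpace ℂ E] [CompleteSpace E] [NormedAddCommGroup U'] [InnerProductSpace ℂ U']
    [CompleteSpace U'] {A : E →L[ℂ] U} {B : E →L[ℂ] U'}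
    (h : adjoint A ∘L A = adjoint B ∘L B) (ξ : E) : ‖A ξ‖ = ‖B ξ‖ := by
  rw [← sq_eq_sq₀ (norm_nonneg _) (norm_nonneg _), apply_norm_sq_eq_inner_adjoint_left, h,
    ← apply_norm_sq_eq_inner_adjoint_left]

lemma exists_units_star_mul_self_eq_sum {M : Type*} [CStarAlgebra M] {c : ι → M}
    (hc : IsUnit (∑ i, star (c i) * c i)) :
    ∃ S : Mˣ, star (S : M) * S = ∑ i, star (c i) * c i := by
  let : PartialOrder M := CStarAlgebra.spectralOrder M
  let : StarOrderedRing M := CStarAlgebra.spectralOrderedRing M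
  have hnonneg : 0 ≤ ∑ i, star (c i) * c i :=
    Finset.sum_nonneg fun i _ => star_mul_self_nonneg (c i)
  obtain ⟨S, hS⟩ := (CFC.isUnit_sqrt_iff _ hnonneg).2 hc
  exact ⟨S, by rw [hS, (CFC.sqrt_nonneg _).isSelfAdjoint.star_eq,
    CFC.sqrt_mul_sqrt_self _ hnonneg]⟩

lemma exists_units_adjoint_comp_self_eq {j : U →ₗᵢ[ℂ] L2pow G ι} {O : L2 G ≃L[ℂ] U}
    (hO : IsEquivariant j O) :
    ∃ S : (vN G)ˣ, adjoint ((S : vN G) : L2 G →L[ℂ] L2 G) ∘L ((S : vN G) : L2 G →L[ℂ] L2 G) =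
      adjoint (O : L2 G →L[ℂ] U) ∘L (O : L2 G →L[ℂ] U) := by
  let c : ι → vN G := fun i => ⟨coordOp j (O : L2 G →L[ℂ] U) i, coordOp_mem_vN hO i⟩
  have hsum : ((∑ i, star (c i) * c i : vN G) : L2 G →L[ℂ] L2 G) =
      adjoint (O : L2 G →L[ℂ] U) ∘L (O : L2 G →L[ℂ] U) := by
    rw [← sum_star_coordOp_mul j]
    exact map_sum (vN G).subtype _ _
  have hunit : IsUnit (∑ i, star (c i) * c i) :=
    (StarSubalgebra.coe_isUnit (vN G)).1 (hsum ▸ isUnit_adjoint_comp_self O)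
  obtain ⟨S, hS⟩ := exists_units_star_mul_self_eq_sum hunit
  exact ⟨S, hsum ▸ congrArg (fun T : vN G => (T : L2 G →L[ℂ] L2 G)) hS⟩

lemma exists_polar_decomposition {j : U →ₗᵢ[ℂ] L2pow G ι} {O : L2 G ≃L[ℂ] U}
    (hO : IsEquivariant j O) :
    ∃ (S : (vN G)ˣ) (e : L2 G ≃ₗᵢ[ℂ] U), IsEquivariant j e ∧
      ∀ ξ, O ξ = e (((S : vN G) : L2 G →L[ℂ] L2 G) ξ) := by
  obtain ⟨S, hS⟩ := exists_units_adjoint_comp_self_eq hO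
  let S' : L2 G ≃L[ℂ] L2 G :=
    ContinuousLinearEquiv.unitsEquiv ℂ (L2 G) (Units.map (vN G).subtype.toMonoidHom S)
  have hnorm : ∀ ξ, ‖O (S'.symm ξ)‖ = ‖ξ‖ := fun ξ =>
    (norm_apply_eq_of_adjoint_comp_self_eq hS.symm (S'.symm ξ)).trans
      (congrArg norm (S'.apply_symm_apply ξ))
  let e : L2 G ≃ₗᵢ[ℂ] U := ⟨(S'.symm.trans O).toLinearEquiv, hnorm⟩
  refine ⟨S, e, fun g ξ => ?_, fun ξ => (congrArg O (S'.symm_apply_apply ξ)).symm⟩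
  have hcomm : S'.symm (leftMul g ξ) = leftMul g (S'.symm ξ) :=
    mem_vN_iff.1 (SetLike.coe_mem ((S⁻¹ : (vN G)ˣ) : vN G)) g ξ
  exact (congrArg (fun η => j (O η)) hcomm).trans (hO g _)

lemma rshift_mem_unitary (h : G) :
    (⟨(rshift h).toContinuousLinearMap, rshift_mem_vN h⟩ : vN G) ∈ unitary (vN G) := by
  rw [Unitary.mem_iff]
  constructor <;> refine Subtype.ext ?_
  · change star (rshift h).toContinuousLinearMap * (rshift h).toContinuousLinearMap = 1
    rw [star_rshift]
    exact ext_delta fun x => by simp [rshift_delta]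
  · change (rshift h).toContinuousLinearMap * star (rshift h).toContinuousLinearMap = 1
    rw [star_rshift]
    exact ext_delta fun x => by simp [rshift_delta]

lemma tendsto_regLogDet_conj_one_sub_rshift {h : G} (hh : ¬IsOfFinOrder h)
    (S : (vN G)ˣ) :
    Tendsto (fun δ => regLogDet (vNTrace G) δ
      (S * (1 - ⟨(rshift h).toContinuousLinearMap, rshift_mem_vN h⟩) * ↑S⁻¹)) (𝓝[>] 0) (𝓝 0) := by
  have hpow : ∀ n : ℕ, h ^ (n + 1) ≠ 1 := fun n hn =>
    hh (isOfFinOrder_iff_pow_eq_one.2 ⟨n + 1, n.succ_pos, hn⟩)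
  refine tendsto_regLogDet_conj_one_sub (τ := vNTrace G) (fun a b => opTrace_mul_comm a.2 b.2)
    opTrace_one (fun a => opTrace_star_mul_self _)
    (rshift_mem_unitary h) (fun n => ?_) (fun n => ?_) S
  · change opTrace ((rshift h).toContinuousLinearMap ^ (n + 1)) = 0
    rw [rshift_pow, opTrace_rshift (hpow n)]
  · change opTrace (star (rshift h).toContinuousLinearMap ^ (n + 1)) = 0
    rw [star_rshift, rshift_pow, inv_pow, opTrace_rshift (inv_ne_one.2 (hpow n))]

theorem fkDet_eq_one_of_similar {j : U →ₗᵢ[ℂ] L2pow G ι} {O : L2 G ≃L[ℂ] U}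
    (hO : IsEquivariant j O) {h : G} (hh : ¬IsOfFinOrder h) :
    fkDet j ((O : L2 G →L[ℂ] U) ∘L (1 - (rshift h).toContinuousLinearMap) ∘L
      (O.symm : U →L[ℂ] L2 G)) = 1 := by
  obtain ⟨S, e, he, hOe⟩ := exists_polar_decomposition hO
  let B : vN G := S * (1 - ⟨(rshift h).toContinuousLinearMap, rshift_mem_vN h⟩) * ↑S⁻¹
  have hconj : (O : L2 G →L[ℂ] U) ∘L (1 - (rshift h).toContinuousLinearMap) ∘L
      (O.symm : U →L[ℂ] L2 G) = e.conjStarAlgEquiv (B : L2 G →L[ℂ] L2 G) := by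
    ext1 x
    obtain ⟨ξ, rfl⟩ := O.surjective x
    have hinv : (((S⁻¹ : (vN G)ˣ) : vN G) : L2 G →L[ℂ] L2 G)
        (((S : vN G) : L2 G →L[ℂ] L2 G) ξ) = ξ :=
      congrArg (fun T : vN G => (T : L2 G →L[ℂ] L2 G) ξ) S.inv_mul
    rw [LinearIsometryEquiv.conjStarAlgEquiv_apply_apply, hOe ξ, e.symm_apply_apply, ← hOe ξ,
      ContinuousLinearMap.comp_apply, ContinuousLinearMap.comp_apply]
    change O ((1 - (rshift h).toContinuousLinearMap) (O.symm (O ξ))) =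
      e (((S : vN G) : L2 G →L[ℂ] L2 G) ((1 - (rshift h).toContinuousLinearMap)
        ((((S⁻¹ : (vN G)ˣ) : vN G) : L2 G →L[ℂ] L2 G) (((S : vN G) : L2 G →L[ℂ] L2 G) ξ))))
    rw [hinv, O.symm_apply_apply, hOe]
  rw [hconj]
  exact fkDet_conj_eq_one e he B (tendsto_regLogDet_conj_one_sub_rshift hh S)

end Similarity

section RightMultiplication

variable {F G : Type*} [Group F] [Group G]

lemma leftMul_apply (s : G) (ξ : L2 G) (g : G) : leftMul s ξ g = ξ (s⁻¹ * g) := by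
  simpa [leftMul] using pushforward_apply (s * ·) (mul_right_injective s) ξ (s⁻¹ * g)

lemma rightMul_delta_one (a : MonoidAlgebra ℂ G) :
    rightMul a (delta 1) = a.coeff.sum fun g c => c • delta g := by
  rw [rightMul, Finsupp.sum, Finsupp.sum, sum_apply]
  refine Finset.sum_congr rfl fun g _ => ?_
  change a.coeff g • rshift g (delta 1) = _
  rw [rshift_delta, one_mul]

lemma rightMul_delta_one_apply (a : MonoidAlgebra ℂ G) (g : G) :
    rightMul a (delta 1) g = a.coeff g := by
  classical
  induction a using MonoidAlgebra.induction_linear with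
  | zero => simp [rightMul_zero]
  | add a b ha hb => simp [rightMul_add, ha, hb]
  | single h c =>
    rw [rightMul_single, MonoidAlgebra.coeff_single]
    change c * rshift h (delta 1) g = _
    rw [rshift_delta, one_mul]
    by_cases hg : g = h
    · rw [hg, delta_apply_self, Finsupp.single_eq_same, mul_one]
    · rw [delta_apply_of_ne hg, Finsupp.single_eq_of_ne hg, mul_zero]

lemma rightMul_single_mul_delta_one (s : G) (a : MonoidAlgebra ℂ G) :
    rightMul (MonoidAlgebra.single s 1 * a) (delta 1) = leftMul s (rightMul a (delta 1)) := by
  induction a using MonoidAlgebra.induction_linear with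
  | zero => simp [rightMul_zero]
  | add a b ha hb => simp [rightMul_add, ha, hb, mul_add]
  | single h c =>
    simp [rightMul_single, MonoidAlgebra.single_mul_single, rshift_delta, leftMul_delta]

lemma rightMul_mapDomain_delta_one (κ : F →* G) (hκ : Function.Injective κ)
    (a : MonoidAlgebra ℂ F) :
    rightMul (MonoidAlgebra.mapDomain κ a) (delta 1) =
      pushforward κ hκ (rightMul a (delta 1)) := by
  induction a using MonoidAlgebra.induction_linear with
  | zero => simp [rightMul_zero]
  | add a b ha hb => simp [rightMul_add, ha, hb, MonoidAlgebra.mapDomain_add]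
  | single h c =>
    simp [rightMul_single, MonoidAlgebra.mapDomain_single, rshift_delta, pushforward_delta]

lemma pushforward_leftMul (κ : F →* G) (hκ : Function.Injective κ) (s : F) (ξ : L2 F) :
    pushforward κ hκ (leftMul s ξ) = leftMul (κ s) (pushforward κ hκ ξ) := by
  have hcomm : (pushforward κ hκ).toContinuousLinearMap ∘L leftMul s =
      leftMul (κ s) ∘L (pushforward κ hκ).toContinuousLinearMap :=
    ext_delta fun x => by simp [leftMul_delta, pushforward_delta]
  exact congrArg (fun T : L2 F →L[ℂ] L2 G => T ξ) hcomm

lemma rightMulMatrix_apply {ι : Type*} [Fintype ι] (M : Matrix ι ι (MonoidAlgebra ℂ G))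
    (v : L2pow G ι) (i : ι) : rightMulMatrix M v i = ∑ k, rightMul (M k i) (v k) :=
  matrixOp_apply _ _ _

lemma rightMulMatrix_leftMul {ι : Type*} [Fintype ι] (M : Matrix ι ι (MonoidAlgebra ℂ G)) (g : G)
    (v : L2pow G ι) :
    rightMulMatrix M (diagOp (leftMul g) v) = diagOp (leftMul g) (rightMulMatrix M v) := by
  ext1 i
  rw [diagOp_apply, rightMulMatrix_apply, rightMulMatrix_apply, map_sum]
  refine Finset.sum_congr rfl fun k _ => ?_
  rw [diagOp_apply, rightMul_leftMul]

end RightMultiplication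

section Embedding

variable {V : Type*} [Quiver V]

namespace BasedHomotopyEquiv

variable {f : BasedHomotopyEquiv V} {H : Subgraph V} (lift : f.LiftChoice H)

lemma coords_coeff (x : f.RelC1 H) (e : RelEdge H) (g : f.F) :
    (coords lift x e).coeff g = (((x : f.C1) (f.edgeAct g ⟨e.1, lift e⟩) : ℚ) : ℂ) := rfl

lemma relC1_induction {p : f.RelC1 H → Prop} (zero : p 0) (add : ∀ x y, p x → p y → p (x + y))
    (basis : ∀ (q : ℚ) (g : f.F) (e : RelEdge H), p (q • f.relAct H g (basisChain lift e)))
    (x : f.RelC1 H) : p x := by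
  obtain ⟨z, rfl⟩ := (Finsupp.supportedEquivFinsupp (M := ℚ) (R := ℚ)
    (f.relCoverEdges H)).symm.surjective x
  induction z using Finsupp.induction_linear with
  | zero => rwa [map_zero]
  | add y z hy hz => rw [map_add]; exact add _ _ hy hz
  | single e q =>
    obtain ⟨⟨e, w⟩, he⟩ := e
    convert basis q (w ≫ inv (lift ⟨e, he⟩)) ⟨e, he⟩ using 1
    refine Subtype.ext ?_
    rw [Finsupp.supportedEquivFinsupp_symm_single]
    change Finsupp.single _ _ = q • Finsupp.mapDomain _ (Finsupp.single _ _)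
    rw [Finsupp.mapDomain_single, Finsupp.smul_single, smul_eq_mul, mul_one]
    simp [edgeAct]

lemma edgeAct_lift_eq_lift_iff {e e' : RelEdge H} {g : f.F} :
    f.edgeAct g ⟨e'.1, lift e'⟩ = ⟨e.1, lift e⟩ ↔ e' = e ∧ g = 1 := by
  constructor
  · intro h
    obtain rfl : e' = e := Subtype.ext (congrArg Sigma.fst h)
    simp only [edgeAct, Sigma.mk.injEq, heq_eq_eq, true_and] at h
    exact ⟨rfl, (cancel_mono (lift e')).1 (h.trans (Category.id_comp _).symm)⟩
  · rintro ⟨rfl, rfl⟩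
    exact f.edgeAct_one _

open Classical in
lemma basisChain_apply_edgeAct (e e' : RelEdge H) (g : f.F) :
    (basisChain lift e : f.C1) (f.edgeAct g ⟨e'.1, lift e'⟩) =
      if e' = e ∧ g = 1 then 1 else 0 :=
  Finsupp.single_apply.trans
    (if_congr (eq_comm.trans (edgeAct_lift_eq_lift_iff lift)) rfl rfl)

lemma inl_mul_t (x : f.F) :
    (SemidirectProduct.inl x : f.G) * f.t = f.t * SemidirectProduct.inl (f.Phi x) := by
  rw [← t_inv_mul_mul_t, mul_assoc, mul_inv_cancel_left]

variable [Finite (Quiver.Total V)]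

lemma toL2_apply (x : f.RelC1 H) (e : RelEdge H) :
    toL2 lift x e = rightMul (coords lift x e) (delta 1) :=
  (rightMul_delta_one _).symm

lemma toL2_apply_apply (x : f.RelC1 H) (e : RelEdge H) (g : f.F) :
    toL2 lift x e g = (((x : f.C1) (f.edgeAct g ⟨e.1, lift e⟩) : ℚ) : ℂ) := by
  rw [toL2_apply, rightMul_delta_one_apply, coords_coeff]

lemma toL2_add (x y : f.RelC1 H) : toL2 lift (x + y) = toL2 lift x + toL2 lift y := by
  ext e g
  simp [toL2_apply_apply]

lemma toL2_smul (q : ℚ) (x : f.RelC1 H) : toL2 lift (q • x) = (q : ℂ) • toL2 lift x := by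
  ext e g
  simp [toL2_apply_apply]

lemma toL2_zero : toL2 lift (0 : f.RelC1 H) = 0 := by
  simpa using toL2_smul lift 0 0

lemma toL2_relAct (h : f.F) (x : f.RelC1 H) :
    toL2 lift (f.relAct H h x) = diagOp (leftMul h) (toL2 lift x) := by
  ext e g
  rw [toL2_apply_apply, diagOp_apply, leftMul_apply, toL2_apply_apply, relAct_apply, edgeAct_mul]

lemma toL2_basisChain (e : RelEdge H) : toL2 lift (basisChain lift e) = unitVec f.F e := by
  classical
  ext e' g
  rw [toL2_apply_apply, basisChain_apply_edgeAct]
  by_cases he : e' = e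
  · subst he
    by_cases hg : g = 1
    · simp [hg, unitVec_apply_self, delta_apply_self]
    · rw [unitVec_apply_self, delta_apply_of_ne hg, if_neg fun h => hg h.2, Rat.cast_zero]
  · simp [he, unitVec_apply_of_ne]

/-- A relative 1-chain as an element of `L²(G_φ)^{n_H}`. -/
def emb (x : f.RelC1 H) : L2pow f.G (RelEdge H) := inclF (toL2 lift x)

lemma emb_apply (x : f.RelC1 H) (e : RelEdge H) :
    emb lift x e = rightMul (MonoidAlgebra.mapDomain (SemidirectProduct.inl : f.F →* f.G)
      (coords lift x e)) (delta 1) := by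
  rw [emb, inclF, diagOp_apply, toL2_apply,
    rightMul_mapDomain_delta_one _ SemidirectProduct.inl_injective]
  rfl

lemma emb_add (x y : f.RelC1 H) : emb lift (x + y) = emb lift x + emb lift y := by
  rw [emb, toL2_add, map_add]
  rfl

lemma emb_smul (q : ℚ) (x : f.RelC1 H) : emb lift (q • x) = (q : ℂ) • emb lift x := by
  rw [emb, toL2_smul, map_smul]
  rfl

lemma emb_zero : emb lift (0 : f.RelC1 H) = 0 := by
  rw [emb, toL2_zero, map_zero]

lemma emb_relAct (h : f.F) (x : f.RelC1 H) :
    emb lift (f.relAct H h x) = diagOp (leftMul (SemidirectProduct.inl h)) (emb lift x) := by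
  ext1 e
  rw [emb, toL2_relAct, diagOp_apply, emb, inclF, diagOp_apply, diagOp_apply, diagOp_apply]
  exact pushforward_leftMul _ SemidirectProduct.inl_injective _ _

lemma emb_basisChain (e : RelEdge H) : emb lift (basisChain lift e) = unitVec f.G e := by
  ext1 e'
  rw [emb, toL2_basisChain, inclF, diagOp_apply]
  by_cases he : e' = e
  · subst he
    rw [unitVec_apply_self, unitVec_apply_self]
    exact pushforward_delta _ SemidirectProduct.inl_injective _
  · rw [unitVec_apply_of_ne he, unitVec_apply_of_ne he, map_zero]

lemma opL_leftMul (g : f.G) (v : L2pow f.G (RelEdge H)) :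
    opL lift (diagOp (leftMul g) v) = diagOp (leftMul g) (opL lift v) :=
  rightMulMatrix_leftMul _ _ _

lemma opL_unitVec (e : RelEdge H) : opL lift (unitVec f.G e) =
    diagOp (leftMul f.t) (emb lift (f.relChainMap H (basisChain lift e))) := by
  ext1 i
  refine (rightMulMatrix_apply _ _ _).trans ?_
  rw [Finset.sum_eq_single e, unitVec_apply_self,
    rightMul_single_mul_delta_one, diagOp_apply, emb_apply]
  · rfl
  · intro k _ hk
    rw [unitVec_apply_of_ne hk, map_zero]
  · simp

lemma opL_emb (x : f.RelC1 H) :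
    opL lift (emb lift x) = diagOp (leftMul f.t) (emb lift (f.relChainMap H x)) := by
  induction x using relC1_induction lift with
  | zero => simp only [map_zero, emb_zero]
  | add x y hx hy => simp only [map_add, emb_add, hx, hy]
  | basis q g e =>
    rw [map_smul, emb_smul, emb_smul, map_smul, map_smul, emb_relAct, opL_leftMul, emb_basisChain,
      opL_unitVec, relChainMap_relAct, emb_relAct, ← diagOp_leftMul_mul_apply,
      ← diagOp_leftMul_mul_apply, inl_mul_t]

/-- The operator from `L²(G_φ)` to `L²(G_φ)^{n_H}` that sends the basis vector at `g` to the
translate by `g` of a relative 1-chain. -/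
def orbitOp (ρ : f.RelC1 H) : L2 f.G →L[ℂ] L2pow f.G (RelEdge H) :=
  ((PiLp.continuousLinearEquiv 2 ℂ (fun _ : RelEdge H => L2 f.G)).symm :
      (RelEdge H → L2 f.G) →L[ℂ] L2pow f.G (RelEdge H)) ∘L
    ContinuousLinearMap.pi fun e => rightMul (MonoidAlgebra.mapDomain
      (SemidirectProduct.inl : f.F →* f.G) (coords lift ρ e))

lemma orbitOp_apply (ρ : f.RelC1 H) (ξ : L2 f.G) (e : RelEdge H) :
    orbitOp lift ρ ξ e = rightMul (MonoidAlgebra.mapDomain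
      (SemidirectProduct.inl : f.F →* f.G) (coords lift ρ e)) ξ := rfl

lemma orbitOp_leftMul (ρ : f.RelC1 H) (g : f.G) (ξ : L2 f.G) :
    orbitOp lift ρ (leftMul g ξ) = diagOp (leftMul g) (orbitOp lift ρ ξ) := by
  ext1 e
  rw [orbitOp_apply, rightMul_leftMul, diagOp_apply, orbitOp_apply]

lemma orbitOp_delta_one (ρ : f.RelC1 H) : orbitOp lift ρ (delta 1) = emb lift ρ := by
  ext1 e
  rw [orbitOp_apply, emb_apply]

lemma orbitOp_delta (ρ : f.RelC1 H) (g : f.G) :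
    orbitOp lift ρ (delta g) = diagOp (leftMul g) (emb lift ρ) := by
  rw [← orbitOp_delta_one, ← orbitOp_leftMul, leftMul_delta, mul_one]

lemma opL_orbitOp {ρ : f.RelC1 H} (hρ : f.relChainMap H ρ = ρ) (ξ : L2 f.G) :
    opL lift (orbitOp lift ρ ξ) = orbitOp lift ρ (rshift f.t ξ) := by
  have hcomm : opL lift ∘L orbitOp lift ρ =
      orbitOp lift ρ ∘L (rshift f.t).toContinuousLinearMap := by
    refine ext_delta fun g => ?_
    simp only [ContinuousLinearMap.comp_apply, LinearIsometry.coe_toContinuousLinearMap,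
      rshift_delta, orbitOp_delta, opL_leftMul, opL_emb, hρ, diagOp_leftMul_mul_apply]
  exact congrArg (fun T : L2 f.G →L[ℂ] L2pow f.G (RelEdge H) => T ξ) hcomm

lemma opL_pow_orbitOp {ρ : f.RelC1 H} (hρ : f.relChainMap H ρ = ρ) (k : ℕ) (ξ : L2 f.G) :
    (opL lift ^ k) (orbitOp lift ρ ξ) = orbitOp lift ρ (rshift (f.t ^ k) ξ) := by
  induction k generalizing ξ with
  | zero => simp [rshift_one]
  | succ k ih =>
    rw [pow_succ, mul_apply_eq_comp, opL_orbitOp lift hρ, ih, ← rshift_mul, ← pow_succ']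

lemma one_sub_opL_pow_orbitOp {ρ : f.RelC1 H} (hρ : f.relChainMap H ρ = ρ) (k : ℕ)
    (ξ : L2 f.G) :
    (1 - opL lift ^ k) (orbitOp lift ρ ξ) =
      orbitOp lift ρ ((1 - (rshift (f.t ^ k)).toContinuousLinearMap) ξ) := by
  simp [opL_pow_orbitOp lift hρ]

end BasedHomotopyEquiv

end Embedding

section Modulus

variable {G : Type*}

/-- The pointwise absolute value of a square summable function. -/
def modulus (ξ : L2 G) : L2 G :=
  ⟨fun x => (‖ξ x‖ : ℂ), memℓp_of_norm_le ξ _ fun x => by simp⟩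

lemma modulus_apply (ξ : L2 G) (x : G) : modulus ξ x = (‖ξ x‖ : ℂ) := rfl

lemma norm_le_of_norm_apply_le {ξ η : L2 G} (h : ∀ x, ‖ξ x‖ ≤ ‖η x‖) : ‖ξ‖ ≤ ‖η‖ := by
  refine (sq_le_sq₀ (norm_nonneg _) (norm_nonneg _)).1 ?_
  exact hasSum_le (fun x => pow_le_pow_left₀ (norm_nonneg _) (h x) 2) (hasSum_norm_sq _)
    (hasSum_norm_sq _)

lemma norm_le_norm_modulus (ξ : L2 G) : ‖ξ‖ ≤ ‖modulus ξ‖ :=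
  norm_le_of_norm_apply_le fun x => by simp [modulus_apply]

variable [Group G]

lemma norm_rshift_modulus_sub_le {a b : ℂ} (ha : ‖a‖ = 1) (hb : ‖b‖ = 1) (s : G) (ξ : L2 G) :
    ‖rshift s (modulus ξ) - modulus ξ‖ ≤ ‖a • ξ + b • rshift s ξ‖ := by
  refine norm_le_of_norm_apply_le fun x => ?_
  have hleft : (rshift s (modulus ξ) - modulus ξ) x = ((‖ξ (x * s⁻¹)‖ - ‖ξ x‖ : ℝ) : ℂ) := by
    rw [lp.coeFn_sub, Pi.sub_apply, rshift_apply, modulus_apply, modulus_apply]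
    push_cast
    rfl
  have hright : (a • ξ + b • rshift s ξ) x = b * ξ (x * s⁻¹) - (-(a * ξ x)) := by
    rw [lp.coeFn_add, Pi.add_apply, lp.coeFn_smul, lp.coeFn_smul, Pi.smul_apply, Pi.smul_apply,
      rshift_apply, smul_eq_mul, smul_eq_mul]
    ring
  rw [hleft, hright, Complex.norm_real, Real.norm_eq_abs]
  simpa [ha, hb] using abs_norm_sub_norm_le (b * ξ (x * s⁻¹)) (-(a * ξ x))

lemma norm_rshift_modulus_sub_le_rightMul {F : Type*} [Group F] (κ : F →* G) {a b : ℂ}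
    (ha : ‖a‖ = 1) (hb : ‖b‖ = 1) (g y : F) (ξ : L2 G) :
    ‖rshift (κ g) (modulus ξ) - modulus ξ‖ ≤ ‖rightMul (MonoidAlgebra.mapDomain κ
      (MonoidAlgebra.single y a + MonoidAlgebra.single (g⁻¹ * y) b)) ξ‖ := by
  have heval : rightMul (MonoidAlgebra.mapDomain κ
      (MonoidAlgebra.single y a + MonoidAlgebra.single (g⁻¹ * y) b)) ξ =
      rshift (κ y) (a • ξ + b • rshift (κ g)⁻¹ ξ) := by
    rw [MonoidAlgebra.mapDomain_add, MonoidAlgebra.mapDomain_single,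
      MonoidAlgebra.mapDomain_single, rightMul_add, rightMul_single, rightMul_single, map_mul,
      map_inv, map_add, map_smul, map_smul, ← rshift_mul]
    rfl
  rw [heval, LinearIsometry.norm_map, ← norm_rshift_inv_sub]
  exact norm_rshift_modulus_sub_le ha hb _ _

end Modulus

section LowerBound

variable {V : Type*} [Quiver V]

namespace BasedHomotopyEquiv

variable {f : BasedHomotopyEquiv V} {H : Subgraph V}

lemma mem_supp_iff {x : f.RelC1 H} {e : f.CoverEdge} : e ∈ supp x ↔ (x : f.C1) e ≠ 0 :=
  Finsupp.mem_support_iff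

lemma relAct_one (x : f.RelC1 H) : f.relAct H 1 x = x := by
  ext e
  rw [relAct_apply, inv_one, edgeAct_one]

lemma norm_fixedSegment_coeff {ρ : f.RelC1 H} (hρ : f.IsFixedSegment H ρ) {e : f.CoverEdge}
    (he : e ∈ supp ρ) : ‖(((ρ : f.C1) e : ℚ) : ℂ)‖ = 1 := by
  rcases f.fixedSegment_coeff hρ e with h | h | h
  · exact absurd h (mem_supp_iff.1 he)
  · simp [h]
  · simp [h]

lemma supp_inter_supp_eq_singleton {ρ : f.RelC1 H} (hρ : f.IsGeometricNielsen H ρ) {g h : f.F}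
    (hgh : g ≠ h) {e : f.CoverEdge} (hg : e ∈ supp (f.relAct H g ρ))
    (hh : e ∈ supp (f.relAct H h ρ)) :
    supp (f.relAct H g ρ) ∩ supp (f.relAct H h ρ) = {e} := by
  have he : e ∈ supp (f.relAct H g ρ) ∩ supp (f.relAct H h ρ) := ⟨hg, hh⟩
  rcases hρ.single g h hgh with hempty | ⟨e', hsingle⟩
  · exact absurd hempty (Set.Nonempty.ne_empty ⟨e, he⟩)
  · obtain rfl : e = e' := hsingle.subset he
    exact hsingle

lemma eq_of_mem_supp_relAct {ρ : f.RelC1 H} (hρ : f.IsGeometricNielsen H ρ) {e : f.CoverEdge}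
    (he : e ∈ supp ρ) {g h : f.F} (hg : g ≠ 1) (hh : h ≠ 1) (heg : e ∈ supp (f.relAct H g ρ))
    (heh : e ∈ supp (f.relAct H h ρ)) : h = g := by
  obtain ⟨g₁, g₂, -, -, hunique⟩ := hρ.pair e (ρ.2 he)
  have heq_pair : ∀ {k : f.F}, k ≠ 1 → e ∈ supp (f.relAct H k ρ) →
      ({1, k} : Set f.F) = {g₁, g₂} := fun hk hek =>
    hunique 1 _ hk.symm
      (supp_inter_supp_eq_singleton hρ hk.symm (by rwa [relAct_one]) hek)
  have hmem : h ∈ ({1, g} : Set f.F) := by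
    rw [heq_pair hg heg, ← heq_pair hh heh]
    exact Or.inr rfl
  exact hmem.resolve_left hh

variable (lift : f.LiftChoice H)

lemma exists_edgeAct_lift {e : f.CoverEdge} (he : e ∈ f.relCoverEdges H) :
    ∃ (i : RelEdge H) (y : f.F), f.edgeAct y ⟨i.1, lift i⟩ = e := by
  obtain ⟨e, w⟩ := e
  refine ⟨⟨e, he⟩, w ≫ inv (lift ⟨e, he⟩), ?_⟩
  simp [edgeAct]

lemma coords_eq_single {x : f.RelC1 H} {i : RelEdge H} {y : f.F}
    (hx : ∀ g : f.F, g ≠ 1 → (x : f.C1) (f.edgeAct g (f.edgeAct y ⟨i.1, lift i⟩)) = 0) :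
    coords lift x i =
      MonoidAlgebra.single y (((x : f.C1) (f.edgeAct y ⟨i.1, lift i⟩) : ℚ) : ℂ) := by
  refine MonoidAlgebra.ext (Finsupp.ext fun z => ?_)
  rw [coords_coeff, MonoidAlgebra.coeff_single]
  rcases eq_or_ne z y with rfl | hzy
  · rw [Finsupp.single_eq_same]
  · have hzero := hx (z * y⁻¹) fun h => hzy (mul_inv_eq_one.1 h)
    rw [← edgeAct_mul, inv_mul_cancel_right] at hzero
    rw [Finsupp.single_eq_of_ne hzy, hzero, Rat.cast_zero]

lemma coords_eq_single_add_single {x : f.RelC1 H} {i : RelEdge H} {y g : f.F} (hg : g ≠ 1)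
    (hx : ∀ h : f.F, h ≠ 1 → f.edgeAct y ⟨i.1, lift i⟩ ∈ supp (f.relAct H h x) → h = g) :
    coords lift x i =
      MonoidAlgebra.single y (((x : f.C1) (f.edgeAct y ⟨i.1, lift i⟩) : ℚ) : ℂ) +
        MonoidAlgebra.single (g⁻¹ * y)
          (((x : f.C1) (f.edgeAct (g⁻¹ * y) ⟨i.1, lift i⟩) : ℚ) : ℂ) := by
  have hne : y ≠ g⁻¹ * y := fun h => hg (inv_eq_one.1 (right_eq_mul.1 h))
  refine MonoidAlgebra.ext (Finsupp.ext fun z => ?_)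
  rw [coords_coeff, MonoidAlgebra.coeff_add, MonoidAlgebra.coeff_single,
    MonoidAlgebra.coeff_single, Finsupp.add_apply]
  by_cases hzy : z = y
  · rw [hzy, Finsupp.single_eq_same, Finsupp.single_eq_of_ne hne, add_zero]
  by_cases hzg : z = g⁻¹ * y
  · rw [hzg, Finsupp.single_eq_same, Finsupp.single_eq_of_ne hne.symm, zero_add]
  have hzero : (x : f.C1) (f.edgeAct z ⟨i.1, lift i⟩) = 0 := by
    by_contra hcoeff
    refine hzg ?_
    rw [← hx (y * z⁻¹) (fun h => hzy (mul_inv_eq_one.1 h).symm) ?_]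
    · group
    · rwa [mem_supp_iff, relAct_apply, ← edgeAct_mul, mul_inv_rev, inv_inv, inv_mul_cancel_right]
  rw [Finsupp.single_eq_of_ne hzy, Finsupp.single_eq_of_ne hzg, add_zero, hzero, Rat.cast_zero]

variable [Finite (Quiver.Total V)]

lemma exists_antilipschitzWith_orbitOp_of_isNonGeometricNielsen {ρ : f.RelC1 H}
    (hρ : f.IsNonGeometricNielsen H ρ) : ∃ K, AntilipschitzWith K (orbitOp lift ρ) := by
  obtain ⟨-, e, he, hunit, hzero⟩ := hρ
  obtain ⟨i, y, rfl⟩ := exists_edgeAct_lift lift he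
  have hnorm : ‖(((ρ : f.C1) (f.edgeAct y ⟨i.1, lift i⟩) : ℚ) : ℂ)‖ = 1 := by
    rcases hunit with h | h <;> simp [h]
  refine ⟨1, (orbitOp lift ρ).antilipschitz_of_bound fun ξ => ?_⟩
  calc ‖ξ‖ = ‖orbitOp lift ρ ξ i‖ := by
        rw [orbitOp_apply, coords_eq_single lift hzero, MonoidAlgebra.mapDomain_single,
          rightMul_single, smul_apply, norm_smul, hnorm, one_mul,
          LinearIsometry.coe_toContinuousLinearMap, LinearIsometry.norm_map]
    _ ≤ ‖orbitOp lift ρ ξ‖ := PiLp.norm_apply_le _ i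
    _ = (1 : NNReal) * ‖orbitOp lift ρ ξ‖ := (one_mul _).symm

lemma norm_rshift_modulus_sub_le_orbitOp {ρ : f.RelC1 H} (hρ : f.IsGeometricNielsen H ρ) {g : f.F}
    (hg : g ≠ 1) (hmeet : (supp ρ ∩ supp (f.relAct H g ρ)).Nonempty) (ξ : L2 f.G) :
    ‖rshift (SemidirectProduct.inl g) (modulus ξ) - modulus ξ‖ ≤ ‖orbitOp lift ρ ξ‖ := by
  obtain ⟨e, he, heg⟩ := hmeet
  obtain ⟨i, y, rfl⟩ := exists_edgeAct_lift lift (ρ.2 he)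
  have heg' : f.edgeAct (g⁻¹ * y) ⟨i.1, lift i⟩ ∈ supp ρ := by
    rwa [mem_supp_iff, edgeAct_mul, ← relAct_apply, ← mem_supp_iff]
  refine le_trans ?_ (PiLp.norm_apply_le (orbitOp lift ρ ξ) i)
  rw [orbitOp_apply, coords_eq_single_add_single lift hg fun h hh heh =>
    eq_of_mem_supp_relAct hρ he hg hh heg heh]
  exact norm_rshift_modulus_sub_le_rightMul _ (norm_fixedSegment_coeff hρ.fixedSegment he)
    (norm_fixedSegment_coeff hρ.fixedSegment heg') g y ξ

lemma exists_antilipschitzWith_orbitOp_of_isGeometricNielsen {ρ : f.RelC1 H}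
    (hρ : f.IsGeometricNielsen H ρ) : ∃ K, AntilipschitzWith K (orbitOp lift ρ) := by
  obtain ⟨g₁, g₂, hcomm, hmeet₁, hmeet₂⟩ := hρ.noncommuting
  have hg₁ : g₁ ≠ 1 := by rintro rfl; simp at hcomm
  have hg₂ : g₂ ≠ 1 := by rintro rfl; simp at hcomm
  obtain ⟨C, hC, hgap⟩ := exists_spectral_gap
    (SemidirectProduct.inl_injective : Function.Injective (SemidirectProduct.inl : f.F →* f.G))
    hcomm
  refine ⟨⟨C * 2, by positivity⟩, (orbitOp lift ρ).antilipschitz_of_bound fun ξ => ?_⟩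
  calc ‖ξ‖ ≤ ‖modulus ξ‖ := norm_le_norm_modulus ξ
    _ ≤ C * (‖rshift (SemidirectProduct.inl g₁) (modulus ξ) - modulus ξ‖ +
          ‖rshift (SemidirectProduct.inl g₂) (modulus ξ) - modulus ξ‖) := hgap _
    _ ≤ C * (‖orbitOp lift ρ ξ‖ + ‖orbitOp lift ρ ξ‖) := by
      gcongr
      exacts [norm_rshift_modulus_sub_le_orbitOp lift hρ hg₁ hmeet₁ ξ,
        norm_rshift_modulus_sub_le_orbitOp lift hρ hg₂ hmeet₂ ξ]
    _ = C * 2 * ‖orbitOp lift ρ ξ‖ := by ring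

lemma exists_antilipschitzWith_orbitOp {ρ : f.RelC1 H} (hρ : f.IsNielsen H ρ) :
    ∃ K, AntilipschitzWith K (orbitOp lift ρ) :=
  hρ.elim (exists_antilipschitzWith_orbitOp_of_isNonGeometricNielsen lift)
    (exists_antilipschitzWith_orbitOp_of_isGeometricNielsen lift)

end BasedHomotopyEquiv

end LowerBound

section Cyclic

variable {G : Type*} [Group G]

lemma regularEmbedding_leftMul (g : G) (ξ : L2 G) :
    regularEmbedding G (leftMul g ξ) = diagOp (leftMul g) (regularEmbedding G ξ) := by
  ext1 i
  rw [diagOp_apply]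
  rfl

lemma fkDet_conj_one_sub_rshift_pow {ι : Type*} [Fintype ι] {U : Type*} [NormedAddCommGroup U]
    [InnerProductSpace ℂ U] [CompleteSpace U] {j : U →ₗᵢ[ℂ] L2pow G ι} {O : L2 G ≃L[ℂ] U}
    (hO : IsEquivariant j (O : L2 G →L[ℂ] U)) {t : G} (ht : ¬IsOfFinOrder t) (k : ℕ) :
    fkDet j ((O : L2 G →L[ℂ] U) ∘L (1 - (rshift (t ^ k)).toContinuousLinearMap) ∘L
      (O.symm : U →L[ℂ] L2 G)) = 1 := by
  rcases eq_or_ne k 0 with rfl | hk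
  · have hzero : (1 : L2 G →L[ℂ] L2 G) - (rshift (t ^ 0)).toContinuousLinearMap = 0 := by
      ext1 ξ
      simp [rshift_one]
    rw [hzero, ContinuousLinearMap.zero_comp, ContinuousLinearMap.comp_zero, fkDet_zero]
  · exact fkDet_eq_one_of_similar hO fun h => ht ((isOfFinOrder_pow.1 h).resolve_right hk)

lemma cyclicOp_eq (t : G) (k : ℕ) : cyclicOp t k =
    1 - (rshift (⟨t, Subgroup.mem_zpowers t⟩ ^ k : Subgroup.zpowers t)).toContinuousLinearMap :=
  rightMul_one_sub_single _

lemma fkDet_cyclicOp {t : G} (ht : ¬IsOfFinOrder t) (k : ℕ) :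
    fkDet (regularEmbedding (Subgroup.zpowers t)) (cyclicOp t k) = 1 := by
  have ht' : ¬IsOfFinOrder (⟨t, Subgroup.mem_zpowers t⟩ : Subgroup.zpowers t) := fun h =>
    ht ((Subgroup.zpowers t).subtype.isOfFinOrder h)
  rw [cyclicOp_eq]
  exact fkDet_conj_one_sub_rshift_pow (O := ContinuousLinearEquiv.refl ℂ _)
    regularEmbedding_leftMul ht' k

lemma isInduced_cyclicOp (t : G) (k : ℕ) :
    IsInduced (Subgroup.zpowers t) (cyclicOp t k)
      (1 - (rshift (t ^ k)).toContinuousLinearMap) := by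
  refine ⟨fun g ξ => ?_, fun ξ => ?_⟩
  · change leftMul g ξ - rshift (t ^ k) (leftMul g ξ) = leftMul g (ξ - rshift (t ^ k) ξ)
    rw [rshift_leftMul, map_sub]
  · let ι : L2 (Subgroup.zpowers t) →L[ℂ] L2 G := (pushforward
      (fun x : Subgroup.zpowers t => (x : G)) Subtype.val_injective).toContinuousLinearMap
    have hcomm : (1 - (rshift (t ^ k)).toContinuousLinearMap) ∘L ι = ι ∘L cyclicOp t k := by
      refine ext_delta fun x => ?_
      simp [ι, cyclicOp_eq, pushforward_delta, rshift_delta]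
    exact congrArg (fun T : L2 (Subgroup.zpowers t) →L[ℂ] L2 G => T ξ) hcomm

lemma BasedHomotopyEquiv.not_isOfFinOrder_t {V : Type*} [Quiver V] (f : BasedHomotopyEquiv V) :
    ¬IsOfFinOrder f.t := fun h =>
  not_isOfFinOrder_of_isMulTorsionFree (a := Multiplicative.ofAdd (1 : ℤ)) (by decide)
    (SemidirectProduct.rightHom.isOfFinOrder h)

end Cyclic

section InducedSpace

variable {V : Type*} [Quiver V]

namespace BasedHomotopyEquiv

variable {f : BasedHomotopyEquiv V} {H : Subgraph V}

lemma exists_t_zpow_mul_inl (g : f.G) :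
    ∃ (l : ℤ) (y : f.F), f.t ^ l * SemidirectProduct.inl y = g := by
  have ht : f.t ^ g.right.toAdd = SemidirectProduct.inr g.right := by
    rw [t, ← map_zpow, ← ofAdd_zsmul, smul_eq_mul, mul_one, ofAdd_toAdd]
  refine ⟨g.right.toAdd, ((f.t ^ g.right.toAdd)⁻¹ * g).left, ?_⟩
  rw [← eq_inv_mul_iff_mul_eq]
  refine SemidirectProduct.ext rfl ?_
  simp [ht]

lemma relChainMap_mem_span_relAct {ρ x : f.RelC1 H} (hρ : f.relChainMap H ρ = ρ)
    (hx : x ∈ Submodule.span ℚ (Set.range fun g : f.F => f.relAct H g ρ)) :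
    f.relChainMap H x ∈ Submodule.span ℚ (Set.range fun g : f.F => f.relAct H g ρ) := by
  refine (Submodule.span_le (p := (Submodule.span ℚ _).comap (f.relChainMap H))).2 ?_ hx
  rintro _ ⟨g, rfl⟩
  refine Submodule.subset_span ⟨f.Phi g, ?_⟩
  rw [relChainMap_relAct, hρ]

lemma IsNielsen.relChainMap_eq_self (hH : H.IsInvariant f.toGraphMorphism) {ρ : f.RelC1 H}
    (hρ : f.IsNielsen H ρ) : f.relChainMap H ρ = ρ :=
  relChainMap_fixedSegment f hH (hρ.elim And.left fun h => h.fixedSegment)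

/-- A submodule is trivial or generated by a Nielsen 1-chain: the third clause of the chain flare
condition. -/
def IsNielsenGenerated (W : Submodule ℚ (f.RelC1 H)) : Prop :=
  W ≠ ⊥ → ∃ ρ : f.RelC1 H, f.IsNielsen H ρ ∧
    W = Submodule.span ℚ (Set.range fun g : f.F => f.relAct H g ρ)

lemma IsNielsenGenerated.relChainMap_mem {W : Submodule ℚ (f.RelC1 H)} (hW : IsNielsenGenerated W)
    (hH : H.IsInvariant f.toGraphMorphism)
    {x : f.RelC1 H} (hx : x ∈ W) : f.relChainMap H x ∈ W := by
  rcases eq_or_ne W ⊥ with rfl | hne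
  · rw [(Submodule.mem_bot ℚ).1 hx, map_zero]
    exact Submodule.zero_mem _
  · obtain ⟨ρ, hρ, rfl⟩ := hW hne
    exact relChainMap_mem_span_relAct (hρ.relChainMap_eq_self hH) hx

variable [Finite (Quiver.Total V)] (lift : f.LiftChoice H)

lemma diagOp_emb_mem_inducedSpace {W : Submodule ℚ (f.RelC1 H)} {x : f.RelC1 H} (hx : x ∈ W)
    (l : ℤ) : diagOp (leftMul (f.t ^ l)) (emb lift x) ∈ inducedSpace lift W :=
  Submodule.le_topologicalClosure _ <| Submodule.mem_iSup_of_mem l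
    ⟨toL2 lift x, Submodule.le_topologicalClosure _ (Submodule.subset_span ⟨x, hx, rfl⟩), rfl⟩

lemma isClosed_inducedSpace (W : Submodule ℚ (f.RelC1 H)) :
    IsClosed (inducedSpace lift W : Set (L2pow f.G (RelEdge H))) :=
  Submodule.isClosed_topologicalClosure _

lemma inducedSpace_le {W : Submodule ℚ (f.RelC1 H)} {K : Submodule ℂ (L2pow f.G (RelEdge H))}
    (hK : IsClosed (K : Set (L2pow f.G (RelEdge H))))
    (hW : ∀ (l : ℤ), ∀ x ∈ W, diagOp (leftMul (f.t ^ l)) (emb lift x) ∈ K) :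
    inducedSpace lift W ≤ K := by
  refine Submodule.topologicalClosure_minimal _ (iSup_le fun l => ?_) hK
  rw [Submodule.map_le_iff_le_comap]
  refine Submodule.topologicalClosure_minimal _ (Submodule.span_le.2 ?_)
    (hK.preimage (ContinuousLinearMap.continuous _))
  rintro _ ⟨x, hx, rfl⟩
  exact hW l x hx

lemma inducedSpace_bot : inducedSpace lift (⊥ : Submodule ℚ (f.RelC1 H)) = ⊥ := by
  refine le_bot_iff.1 (inducedSpace_le lift isClosed_singleton ?_)
  rintro l x rfl
  rw [emb_zero, map_zero]
  exact Submodule.zero_mem _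

lemma opL_mem_inducedSpace {W : Submodule ℚ (f.RelC1 H)}
    (hW : ∀ x ∈ W, f.relChainMap H x ∈ W) {w : L2pow f.G (RelEdge H)}
    (hw : w ∈ inducedSpace lift W) : opL lift w ∈ inducedSpace lift W := by
  refine inducedSpace_le lift (K := (inducedSpace lift W).comap (opL lift).toLinearMap)
    ((isClosed_inducedSpace lift W).preimage (opL lift).continuous) (fun l x hx => ?_) hw
  change opL lift (diagOp (leftMul (f.t ^ l)) (emb lift x)) ∈ inducedSpace lift W
  rw [opL_leftMul, opL_emb, ← diagOp_leftMul_mul_apply, ← zpow_add_one]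
  exact diagOp_emb_mem_inducedSpace lift (hW x hx) _

lemma one_sub_opL_pow_mem_inducedSpace {W : Submodule ℚ (f.RelC1 H)}
    (hW : ∀ x ∈ W, f.relChainMap H x ∈ W) (k : ℕ) {w : L2pow f.G (RelEdge H)}
    (hw : w ∈ inducedSpace lift W) : (1 - opL lift ^ k) w ∈ inducedSpace lift W := by
  have hpow : (opL lift ^ k) w ∈ inducedSpace lift W := by
    induction k with
    | zero => exact hw
    | succ k ih =>
      rw [pow_succ', mul_apply_eq_comp]
      exact opL_mem_inducedSpace lift hW ih
  exact Submodule.sub_mem _ hw hpow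

lemma orbitOp_mem_inducedSpace {W : Submodule ℚ (f.RelC1 H)} {ρ : f.RelC1 H}
    (hW : ∀ g : f.F, f.relAct H g ρ ∈ W) (ξ : L2 f.G) :
    orbitOp lift ρ ξ ∈ inducedSpace lift W := by
  suffices h : (Submodule.span ℂ (Set.range (delta : f.G → L2 f.G))).topologicalClosure ≤
      (inducedSpace lift W).comap (orbitOp lift ρ).toLinearMap from
    h (closure_span_delta f.G ▸ Submodule.mem_top)
  refine Submodule.topologicalClosure_minimal _ (Submodule.span_le.2 ?_)
    ((isClosed_inducedSpace lift W).preimage (orbitOp lift ρ).continuous)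
  rintro _ ⟨g, rfl⟩
  obtain ⟨l, y, rfl⟩ := exists_t_zpow_mul_inl g
  change orbitOp lift ρ (delta _) ∈ inducedSpace lift W
  rw [orbitOp_delta, diagOp_leftMul_mul_apply, ← emb_relAct]
  exact diagOp_emb_mem_inducedSpace lift (hW y) l

lemma emb_mem_range_orbitOp {ρ x : f.RelC1 H}
    (hx : x ∈ Submodule.span ℚ (Set.range fun g : f.F => f.relAct H g ρ)) :
    emb lift x ∈ LinearMap.range (orbitOp lift ρ).toLinearMap := by
  induction hx using Submodule.span_induction with
  | mem x hx =>
    obtain ⟨g, rfl⟩ := hx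
    exact ⟨delta (SemidirectProduct.inl g),
      (orbitOp_delta lift ρ _).trans (emb_relAct lift g ρ).symm⟩
  | zero =>
    rw [emb_zero]
    exact Submodule.zero_mem _
  | add x y _ _ hx hy =>
    rw [emb_add]
    exact Submodule.add_mem _ hx hy
  | smul q x _ hx =>
    rw [emb_smul]
    exact Submodule.smul_mem _ _ hx

lemma inducedSpace_le_range_orbitOp {ρ : f.RelC1 H}
    (hclosed : IsClosed (Set.range (orbitOp lift ρ))) :
    inducedSpace lift (Submodule.span ℚ (Set.range fun g : f.F => f.relAct H g ρ)) ≤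
      LinearMap.range (orbitOp lift ρ).toLinearMap := by
  refine inducedSpace_le lift (by rwa [LinearMap.coe_range]) fun l x hx => ?_
  obtain ⟨ξ, hξ⟩ := emb_mem_range_orbitOp lift hx
  rw [← hξ]
  exact ⟨leftMul (f.t ^ l) ξ, orbitOp_leftMul lift ρ _ _⟩

lemma exists_orbitEquiv {ρ : f.RelC1 H} (hρ : f.IsNielsen H ρ) {W : Submodule ℚ (f.RelC1 H)}
    (hW : W = Submodule.span ℚ (Set.range fun g : f.F => f.relAct H g ρ)) :
    ∃ O : L2 f.G ≃L[ℂ] inducedSpace lift W,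
      ∀ ξ, (O ξ : L2pow f.G (RelEdge H)) = orbitOp lift ρ ξ := by
  obtain ⟨K, hK⟩ := exists_antilipschitzWith_orbitOp lift hρ
  let O : L2 f.G →L[ℂ] inducedSpace lift W := (orbitOp lift ρ).codRestrict _
    (orbitOp_mem_inducedSpace lift fun g => hW ▸ Submodule.subset_span ⟨g, rfl⟩)
  have hinj : LinearMap.ker O.toLinearMap = ⊥ :=
    LinearMap.ker_eq_bot.2 fun ξ η h => hK.injective (congrArg Subtype.val h)
  have hsurj : LinearMap.range O.toLinearMap = ⊤ := by
    refine LinearMap.range_eq_top.2 fun ⟨w, hw⟩ => ?_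
    obtain ⟨ξ, hξ⟩ := inducedSpace_le_range_orbitOp lift
      (hK.isClosed_range (orbitOp lift ρ).uniformContinuous) (hW ▸ hw)
    exact ⟨ξ, Subtype.ext hξ⟩
  exact ⟨ContinuousLinearEquiv.ofBijective O hinj hsurj, fun ξ => rfl⟩

lemma exists_similar_restrictOp (hH : H.IsInvariant f.toGraphMorphism)
    {W : Submodule ℚ (f.RelC1 H)} (hW : IsNielsenGenerated W) (hne : inducedSpace lift W ≠ ⊥) :
    ∃ O : L2 f.G ≃L[ℂ] inducedSpace lift W,
      IsEquivariant (inducedSpace lift W).subtypeₗᵢ (O : L2 f.G →L[ℂ] inducedSpace lift W) ∧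
      ∀ (k : ℕ) (hk : ∀ w ∈ inducedSpace lift W, (1 - opL lift ^ k) w ∈ inducedSpace lift W),
        restrictOp (1 - opL lift ^ k) (inducedSpace lift W) hk =
          (O : L2 f.G →L[ℂ] inducedSpace lift W) ∘L
            (1 - (rshift (f.t ^ k)).toContinuousLinearMap) ∘L
              (O.symm : inducedSpace lift W →L[ℂ] L2 f.G) := by
  obtain ⟨ρ, hρ, hspan⟩ := hW fun h => hne (h ▸ inducedSpace_bot lift)
  obtain ⟨O, hO⟩ := exists_orbitEquiv lift hρ hspan
  refine ⟨O, fun g ξ => ?_, fun k hk => ContinuousLinearMap.ext fun w => Subtype.ext ?_⟩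
  · change (O _ : L2pow f.G (RelEdge H)) = diagOp (leftMul g) (O ξ : L2pow f.G (RelEdge H))
    rw [hO, hO, orbitOp_leftMul]
  · change (1 - opL lift ^ k) (w : L2pow f.G (RelEdge H)) =
      O ((1 - (rshift (f.t ^ k)).toContinuousLinearMap) (O.symm w))
    rw [hO, ← one_sub_opL_pow_orbitOp lift (hρ.relChainMap_eq_self hH), ← hO, O.apply_symm_apply]

lemma fkDet_restrictOp_one_sub_opL_pow (hH : H.IsInvariant f.toGraphMorphism)
    {W : Submodule ℚ (f.RelC1 H)} (hW : IsNielsenGenerated W) (k : ℕ)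
    (hk : ∀ w ∈ inducedSpace lift W, (1 - opL lift ^ k) w ∈ inducedSpace lift W) :
    fkDet (inducedSpace lift W).subtypeₗᵢ
      (restrictOp (1 - opL lift ^ k) (inducedSpace lift W) hk) = 1 := by
  by_cases hbot : inducedSpace lift W = ⊥
  · have : Subsingleton (inducedSpace lift W) := Submodule.subsingleton_iff_eq_bot.2 hbot
    rw [Subsingleton.elim (restrictOp _ _ hk) 0, fkDet_zero]
  · obtain ⟨O, hO, hconj⟩ := exists_similar_restrictOp lift hH hW hbot
    rw [hconj, fkDet_conj_one_sub_rshift_pow hO f.not_isOfFinOrder_t]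

end BasedHomotopyEquiv

end InducedSpace

end FreeByCyclic

end

open FreeByCyclic BasedHomotopyEquiv in
theorem mainTheorem6_general {V : Type*} [Quiver V] [Finite (Quiver.Total V)]
    (f : BasedHomotopyEquiv V) (H : Subgraph V) (hH : H.IsInvariant f.toGraphMorphism)
    (Vqf : Submodule ℚ (f.RelC1 H)) (hVqf : IsNielsenGenerated Vqf) (lift : f.LiftChoice H) :
    ∃ hW : ∀ k : ℕ, ∀ w ∈ inducedSpace lift Vqf,
        (1 - opL lift ^ k) w ∈ inducedSpace lift Vqf,
      (∀ k : ℕ,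
        0 < fkDet (inducedSpace lift Vqf).subtypeₗᵢ
            (restrictOp (1 - opL lift ^ k) (inducedSpace lift Vqf) (hW k)) ∧
        Real.log (fkDet (inducedSpace lift Vqf).subtypeₗᵢ
            (restrictOp (1 - opL lift ^ k) (inducedSpace lift Vqf) (hW k))) = 0) ∧
      (inducedSpace lift Vqf ≠ ⊥ →
        ∃ O : L2 f.G ≃L[ℂ] inducedSpace lift Vqf,
          (∀ (g : f.G) (ξ : L2 f.G),
            (O (leftMul g ξ) : L2pow f.G (RelEdge H)) = diagOp (leftMul g) (O ξ)) ∧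
          ∀ k : ℕ, ∃ Q : L2 f.G →L[ℂ] L2 f.G,
            IsInduced (Subgroup.zpowers f.t) (cyclicOp f.t k) Q ∧
            restrictOp (1 - opL lift ^ k) (inducedSpace lift Vqf) (hW k) =
              (O : L2 f.G →L[ℂ] inducedSpace lift Vqf) ∘L Q ∘L
                (O.symm : inducedSpace lift Vqf →L[ℂ] L2 f.G)) ∧
      ∀ k : ℕ, fkDet (regularEmbedding (Subgroup.zpowers f.t)) (cyclicOp f.t k) = 1 := by
  have hW : ∀ k : ℕ, ∀ w ∈ inducedSpace lift Vqf,
      (1 - opL lift ^ k) w ∈ inducedSpace lift Vqf := fun k w =>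
    one_sub_opL_pow_mem_inducedSpace lift (fun x => hVqf.relChainMap_mem hH) k
  refine ⟨hW, fun k => ?_, fun hne => ?_, fkDet_cyclicOp f.not_isOfFinOrder_t⟩
  · rw [fkDet_restrictOp_one_sub_opL_pow lift hH hVqf]
    exact ⟨one_pos, Real.log_one⟩
  · obtain ⟨O, hO, hconj⟩ := exists_similar_restrictOp lift hH hVqf hne
    exact ⟨O, hO, fun k => ⟨_, isInduced_cyclicOp f.t k, hconj k (hW k)⟩⟩

open FreeByCyclic BasedHomotopyEquiv in
theorem mainTheorem6 {V : Type*} [Quiver V] [Finite V] [Finite (Quiver.Total V)]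
    (hconn : IsConnectedGraph V) (f : BasedHomotopyEquiv V) (H : Subgraph V)
    (hH : H.IsInvariant f.toGraphMorphism) (Vh Vqf : Submodule ℚ (f.RelC1 H))
    (hflare : f.ChainFlare H Vh Vqf) (lift : f.LiftChoice H) :
    ∃ hW : ∀ k : ℕ, ∀ w ∈ inducedSpace lift Vqf,
        (1 - opL lift ^ k) w ∈ inducedSpace lift Vqf,
      (∀ k : ℕ,
        0 < fkDet (inducedSpace lift Vqf).subtypeₗᵢ
            (restrictOp (1 - opL lift ^ k) (inducedSpace lift Vqf) (hW k)) ∧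
        Real.log (fkDet (inducedSpace lift Vqf).subtypeₗᵢ
            (restrictOp (1 - opL lift ^ k) (inducedSpace lift Vqf) (hW k))) = 0) ∧
      (inducedSpace lift Vqf ≠ ⊥ →
        ∃ O : L2 f.G ≃L[ℂ] inducedSpace lift Vqf,
          (∀ (g : f.G) (ξ : L2 f.G),
            (O (leftMul g ξ) : L2pow f.G (RelEdge H)) = diagOp (leftMul g) (O ξ)) ∧
          ∀ k : ℕ, ∃ Q : L2 f.G →L[ℂ] L2 f.G,
            IsInduced (Subgroup.zpowers f.t) (cyclicOp f.t k) Q ∧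
            restrictOp (1 - opL lift ^ k) (inducedSpace lift Vqf) (hW k) =
              (O : L2 f.G →L[ℂ] inducedSpace lift Vqf) ∘L Q ∘L
                (O.symm : inducedSpace lift Vqf →L[ℂ] L2 f.G)) ∧
      ∀ k : ℕ, fkDet (regularEmbedding (Subgroup.zpowers f.t)) (cyclicOp f.t k) = 1 :=
  mainTheorem6_general f H hH Vqf hflare.generated lift
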